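/- Let $s\ge 1$ be a real number. For $M\ge 0$, $T>0$, let $\mathbb D\in\mathbb R^{M\times M}$ be a matrix such that $\mathbb D+\mathbb D^T$ is negative semidefinite, let $\mathbf R:(0,T)\to\mathbb R^M$, $\mathbf Y_0\in\mathbb R^M$, and let $\mathbf Y$ be the solution of $$\mathbf Y'=\mathbb D\mathbf Y+\mathbf R\ \text{ in }(0,T),\qquad \mathbf Y(0)=\mathbf Y_0 .$$ Let $0=t_0<t_1<\dots<t_N=T$ be a partition, $I_n=(t_n,t_{n+1})$, $\tau=\max_{0\le n\le N-1}(t_{n+1}-t_n)$, and let $r\ge1$ be an integer. Let $\mathcal P_{r-1}$ be the local $L^2(I_n)$-orthogonal projection onto $[P^{r-1}]^M$ ($P^m$: polynomials of degree at most $m$), and let $\mathbf Y_r$ be the continuous time Galerkin solution: $\mathbf Y_r$ is continuous on $[0,T]$, $\mathbf Y_r|_{I_n}\in[P^r]^M$ for every $n$, $\mathbf Y_r(0)=\mathbf Y_0$, and $$\mathbf Y_r'=\mathbb D\,\mathcal P_{r-1}\mathbf Y_r+\mathcal P_{r-1}\mathbf R\quad\text{in } I_n,\qquad 0\le n\le N-1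 .$$ Assume $\mathbf R\in[H^s(0,T)]^M$ and $\mathbf Y\in[W^{1+s,\infty}(0,T)]^M$. (i) There is a constant $C>0$ depending only on $s$ such that, in all such situations, $$\max_{1\le n\le N}\|(\mathbf Y-\mathbf Y_r)(t_n)\|_{\mathbb R^M}\le C\,T^{1/2}\,\frac{\tau^{\min(r+1,s)}}{r^{s}}\,\|\mathbb D\mathbf Y\|_{H^s(0,T)} .$$ (ii) For every $T_0>0$ there is a constant $C>0$ depending only on $s$ and $T_0$ such that, in all such situations with $T\ge T_0$ or $r\ge s$, $$\max_{0\le t\le T}\|\mathbf Y-\mathbf Y_r\|_{\mathbb R^M}\le C(1+T^{1/2})\frac{\tau^{\min(r+1,s)}}{r^{s-2}}\Bigl(T^{1/2}\|\mathbf Y\|_{W^{s+1,\infty}(0,T)}+\|\mathbf R\|_{H^s(0,T)}\Bigr).$$ In particular, for each fixed $T>0$ both estimates hold with constants depending only on $s$ and $T$, and independent of $\tau$, $r$ and $\mathbb D$. Here $\|\cdot\|_{\mathbb R^M}$ is the Euclidean norm and, with $k=\lfloor\sigma\rfloor$, $\theta=\sigma-k$, and weak derivatives $v^{(j)}$, $$\|v\|_{H^\sigma(0,T)}^2=\sum_{j=0}^k\|v^{(j)}\|_{L^2(0,T)}^2+\int_0^T\!\!\int_0^T\frac{\|v^{(k)}(x)-v^{(k)}(y)\|^2}{|x-y|^{1+2\theta}}\,dx\,dy,$$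 $$\|v\|_{W^{\sigma,\infty}(0,T)}=\max\Bigl\{\max_{0\le j\le k}\|v^{(j)}\|_{L^\infty(0,T)},\ \operatorname*{ess\,sup}_{x\ne y}\frac{\|v^{(k)}(x)-v^{(k)}(y)\|}{|x-y|^{\theta}}\Bigr\},$$ where the double integral and the difference quotient are omitted when $\theta=0$. -/

import Mathlib

open MeasureTheory Set
open scoped ENNReal

noncomputable section

namespace CTG

/-! Sobolev spaces `W^{s,p}(a,b)` of vector-valued functions on a bounded interval, for real `s ≥ 0`. -/

/-- `v` is the `j`-th weak derivative of `u` on the open interval `(a, b)`. -/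
def HasWeakDeriv {E : Type*} [NormedAddCommGroup E] [NormedSpace ℝ E]
    (a b : ℝ) (j : ℕ) (u v : ℝ → E) : Prop :=
  LocallyIntegrableOn u (Ioo a b) ∧ LocallyIntegrableOn v (Ioo a b) ∧
    ∀ φ : ℝ → ℝ, ContDiff ℝ (⊤ : ℕ∞) φ → HasCompactSupport φ → tsupport φ ⊆ Ioo a b →
      ∫ t in Ioo a b, iteratedDeriv j φ t • u t = (-1 : ℝ) ^ j • ∫ t in Ioo a b, φ t • v t

open Classical in
/-- A representative of the `j`-th weak derivative of `u` on `(a, b)` (unique up to null sets);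
zero if there is none. -/
def weakDeriv {E : Type*} [NormedAddCommGroup E] [NormedSpace ℝ E]
    (a b : ℝ) (j : ℕ) (u : ℝ → E) : ℝ → E :=
  if h : ∃ v : ℝ → E, HasWeakDeriv a b j u v then h.choose else 0

/-- The Sobolev-Slobodeckij (for `p = ∞`: Hölder) seminorm of order `σ` of `g` on `(a, b)`:
the `L^p` norm on `(a,b) × (a,b)` of `(g x - g y) / |x - y| ^ (σ + 1/p)`. -/
def slobodeckij {E : Type*} [NormedAddCommGroup E] [NormedSpace ℝ E]
    (a b σ : ℝ) (p : ℝ≥0∞) (g : ℝ → E) : ℝ≥0∞ :=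
  eLpNorm (fun z : ℝ × ℝ => (|z.1 - z.2| ^ (σ + (p⁻¹).toReal))⁻¹ • (g z.1 - g z.2)) p
    ((volume.restrict (Ioo a b)).prod (volume.restrict (Ioo a b)))

/-- The fractional part of the `W^{s,p}` norm: with `k = ⌊s⌋`, the seminorm of order `s - k` of the
`k`-th weak derivative; absent when `s` is an integer. -/
def fracSeminorm {E : Type*} [NormedAddCommGroup E] [NormedSpace ℝ E]
    (a b s : ℝ) (p : ℝ≥0∞) (u : ℝ → E) : ℝ≥0∞ :=
  if Int.fract s = 0 then 0 else slobodeckij a b (Int.fract s) p (weakDeriv a b ⌊s⌋₊ u)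

/-- `u ∈ W^{s,p}(a, b)`; in particular `H^s(a, b) = W^{s,2}(a, b)`. -/
def MemSobolev {E : Type*} [NormedAddCommGroup E] [NormedSpace ℝ E]
    (a b s : ℝ) (p : ℝ≥0∞) (u : ℝ → E) : Prop :=
  (∀ j ≤ ⌊s⌋₊, ∃ v : ℝ → E, HasWeakDeriv a b j u v ∧ MemLp v p (volume.restrict (Ioo a b))) ∧
    fracSeminorm a b s p u < ∞

/-- The norm of `H^s(a, b)`. -/
def normH {E : Type*} [NormedAddCommGroup E] [NormedSpace ℝ E]
    (a b s : ℝ) (u : ℝ → E) : ℝ :=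
  √((∑ j ∈ Finset.range (⌊s⌋₊ + 1),
      (eLpNorm (weakDeriv a b j u) 2 (volume.restrict (Ioo a b))).toReal ^ 2)
    + (fracSeminorm a b s 2 u).toReal ^ 2)

/-- The norm of `W^{s,∞}(a, b)`. -/
def normWInf {E : Type*} [NormedAddCommGroup E] [NormedSpace ℝ E]
    (a b s : ℝ) (u : ℝ → E) : ℝ :=
  (((Finset.range (⌊s⌋₊ + 1)).sup
      fun j => eLpNorm (weakDeriv a b j u) ∞ (volume.restrict (Ioo a b)))
    ⊔ fracSeminorm a b s ∞ u).toReal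

/-! The initial value problem and the continuous time Galerkin method. -/

/-- The action of the matrix `D` on a function with values in Euclidean space, `t ↦ D (u t)`. -/
def matMul {M : ℕ} (D : Matrix (Fin M) (Fin M) ℝ) (u : ℝ → EuclideanSpace ℝ (Fin M)) :
    ℝ → EuclideanSpace ℝ (Fin M) :=
  fun t => Matrix.toEuclideanLin D (u t)

/-- `Y` (continuous on `[0, T]`) solves `Y' = D Y + R` in `(0, T)`, `Y 0 = Y₀`. The equation is
between `L^1_loc` functions, so it does not depend on the chosen representative of `R`. -/
def IsExactSolution {M : ℕ} (T : ℝ) (D : Matrix (Fin M) (Fin M) ℝ)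
    (R : ℝ → EuclideanSpace ℝ (Fin M)) (Y₀ : EuclideanSpace ℝ (Fin M))
    (Y : ℝ → EuclideanSpace ℝ (Fin M)) : Prop :=
  ContinuousOn Y (Icc 0 T) ∧ Y 0 = Y₀ ∧ HasWeakDeriv 0 T 1 Y (matMul D Y + R)

/-- The nodes `0 = t_0 < t_1 < ⋯ < t_N = T` of a partition of `(0, T)`. -/
def IsPartition (T : ℝ) {N : ℕ} (t : Fin (N + 1) → ℝ) : Prop :=
  StrictMono t ∧ t 0 = 0 ∧ t (Fin.last N) = T

/-- The maximal time step `τ = max_n (t_{n+1} - t_n)`. -/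
def maxStep {N : ℕ} (t : Fin (N + 1) → ℝ) : ℝ :=
  ⨆ n : Fin N, (t n.succ - t n.castSucc)

/-- `w ∈ [P^m]^M` on `(a, b)`: each component is a polynomial of degree at most `m` there. -/
def IsPolyOn {M : ℕ} (a b : ℝ) (m : ℕ) (w : ℝ → EuclideanSpace ℝ (Fin M)) : Prop :=
  ∀ i, ∃ p : Polynomial ℝ, p.natDegree ≤ m ∧ ∀ t ∈ Ioo a b, w t i = p.eval t

/-- `w` is on `(a, b)` the local `L²` projection of `v` onto `[P^m]^M`. -/
def IsLocalProj {M : ℕ} (a b : ℝ) (m : ℕ) (v w : ℝ → EuclideanSpace ℝ (Fin M)) : Prop :=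
  IsPolyOn a b m w ∧ ∀ q : ℝ → EuclideanSpace ℝ (Fin M), IsPolyOn a b m q →
    ∫ t in Ioo a b, inner ℝ (w t) (q t) = ∫ t in Ioo a b, inner ℝ (v t) (q t)

/-- `Yr` is the solution in `V_τ^r` of the continuous time Galerkin method of degree `r ≥ 1`:
it is continuous on `[0, T]`, in `[P^r]^M` on each `I_n = (t_n, t_{n+1})`, `Yr 0 = Y₀`, and
`Yr' = D (𝒫 Yr) + 𝒫 R` in `I_n`, `𝒫` the local `L²` projection onto `[P^{r-1}]^M`. -/
def IsCTGSolution {M : ℕ} (T : ℝ) (D : Matrix (Fin M) (Fin M) ℝ)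
    (R : ℝ → EuclideanSpace ℝ (Fin M)) (Y₀ : EuclideanSpace ℝ (Fin M))
    {N : ℕ} (t : Fin (N + 1) → ℝ) (r : ℕ) (Yr : ℝ → EuclideanSpace ℝ (Fin M)) : Prop :=
  ContinuousOn Yr (Icc 0 T) ∧ Yr 0 = Y₀ ∧
    ∀ n : Fin N, IsPolyOn (t n.castSucc) (t n.succ) r Yr ∧
      ∃ U F : ℝ → EuclideanSpace ℝ (Fin M),
        IsLocalProj (t n.castSucc) (t n.succ) (r - 1) Yr U ∧
        IsLocalProj (t n.castSucc) (t n.succ) (r - 1) R F ∧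
        ∀ x ∈ Ioo (t n.castSucc) (t n.succ), HasDerivAt Yr (matMul D U x + F x) x

end CTG

end

noncomputable section

namespace CTG

open Polynomial

/-! ### Polynomials on an interval: orthogonal projection and inverse estimates -/

/-! On an interval (a, b) of length h, let Z be the polynomial of degree at most r with Z(a) = Y(a)
whose derivative is the L² projection of Y' onto degree less than r. Constants are admissible test
functions because r ≥ 1, so Y' and Z' have the same mean and Z(b) = Y(b): nodal errors only see θ =
Z - Y_r. Projecting the equation shows that θ solves a Galerkin problem with the same D, the
inherited initial error, and as source g the projection of D(Y - Z) (`local_error`).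

Two facts keep D out of the constants. Stability (`sum_polyInt_sq_le`, `sum_sq_eval_right_le`) comes
from testing with the projected solution, with weights b - x and 1, and uses only the sign of D +
Dᵀ. For consistency, D(Y - Z) is the primitive of D(Y' - Z'), the residual of the L² projection of
DY'; by duality (`integral_sq_primitive_le_of_orthogonal`) a primitive of such a residual gains a
factor h/r. So D enters only through the best approximation of DY', controlled by the H^s norm of DY
in (i), and by Y'' and R' in (ii) because DY' = Y'' - R'. A discrete Gronwall argument with a Young
parameter proportional to T (`le_of_local_growth`) sums the local bounds with a factor linear in T
instead of exponential.

The approximation rates must be explicit in h and in the degree. The Legendre operator has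
eigenvalues n(n+1), and this spectral gap yields the rate h/n for one derivative
(`legendre_spectral`, `exists_poly_approx`). Repeated integration gives integer orders; for the
fractional part, the top derivative is first mollified at scale h/n (`exists_mollified_approx`).

Between the nodes, θ is bounded by the L^∞-L² inverse estimate (`sq_eval_le`), at the price of a
power of r, and Y - Z by Cauchy-Schwarz from the best approximation of Y'. The latter is where the
condition T ≥ T₀ or r ≥ s enters. -/

/-- The integral over `[a, b]` as a linear form on polynomials. -/
def polyInt (a b : ℝ) : ℝ[X] →ₗ[ℝ] ℝ where
  toFun p := ∫ x in a..b, p.eval x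
  map_add' p q := by
    simp only [eval_add]
    exact intervalIntegral.integral_add (p.continuous.intervalIntegrable _ _)
      (q.continuous.intervalIntegrable _ _)
  map_smul' c p := by
    simp only [eval_smul, smul_eq_mul, RingHom.id_apply]
    exact intervalIntegral.integral_const_mul c _

lemma polyInt_apply (a b : ℝ) (p : ℝ[X]) : polyInt a b p = ∫ x in a..b, p.eval x := rfl

lemma polyInt_C_mul (a b c : ℝ) (p : ℝ[X]) : polyInt a b (C c * p) = c * polyInt a b p := by
  rw [← smul_eq_C_mul, map_smul, smul_eq_mul]

lemma polyInt_derivative (a b : ℝ) (p : ℝ[X]) :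
    polyInt a b (derivative p) = p.eval b - p.eval a :=
  intervalIntegral.integral_eq_sub_of_hasDerivAt (fun x _ => p.hasDerivAt x)
    ((derivative p).continuous.intervalIntegrable _ _)

lemma polyInt_nonneg {a b : ℝ} (hab : a ≤ b) {p : ℝ[X]} (hp : ∀ x ∈ Icc a b, 0 ≤ p.eval x) :
    0 ≤ polyInt a b p :=
  intervalIntegral.integral_nonneg hab hp

lemma polyInt_mul_self_nonneg {a b : ℝ} (hab : a ≤ b) (p : ℝ[X]) : 0 ≤ polyInt a b (p * p) :=
  polyInt_nonneg hab fun x _ => by simpa using mul_self_nonneg _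

lemma polyInt_mul_self_pos {a b : ℝ} (hab : a < b) {p : ℝ[X]} (hp : p ≠ 0) :
    0 < polyInt a b (p * p) := by
  refine lt_of_le_of_ne (polyInt_mul_self_nonneg hab.le p) fun h => hp ?_
  have h0 : ∀ x ∈ Ioo a b, (p * p).eval x = 0 := by
    intro x hx
    have h1 := (intervalIntegral.integral_eq_zero_iff_of_le_of_nonneg_ae (μ := volume)
      (f := fun x => (p * p).eval x) hab.le
      (Filter.Eventually.of_forall fun x => by simpa using mul_self_nonneg _)
      ((p * p).continuous.intervalIntegrable _ _)).1 h.symm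
    have h2 := Measure.eqOn_Ioc_of_ae_eq volume h1 (p * p).continuous.continuousOn
      continuousOn_const
    exact h2 (Ioo_subset_Ioc_self hx)
  have : p * p = 0 := Polynomial.eq_zero_of_infinite_isRoot _
    ((Ioo_infinite hab).mono fun x hx => h0 x hx)
  exact mul_self_eq_zero.1 this

lemma eq_zero_of_mem_degreeLT {p : ℝ[X]} (hp : p ∈ degreeLT ℝ 0) : p = 0 := by
  rw [mem_degreeLT, degree_lt_iff_coeff_zero] at hp
  ext j
  simpa using hp j (Nat.zero_le j)

lemma degreeLT_mono' {m n : ℕ} (h : m ≤ n) {p : ℝ[X]} (hp : p ∈ degreeLT ℝ m) :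
    p ∈ degreeLT ℝ n := by
  rw [mem_degreeLT] at *
  exact hp.trans_le (by exact_mod_cast h)

lemma mem_degreeLT_of_coeff {n : ℕ} {p : ℝ[X]} (h : ∀ j, n ≤ j → p.coeff j = 0) :
    p ∈ degreeLT ℝ n := by
  rw [mem_degreeLT, degree_lt_iff_coeff_zero]
  exact h

lemma coeff_of_mem_degreeLT {n : ℕ} {p : ℝ[X]} (h : p ∈ degreeLT ℝ n) {j : ℕ} (hj : n ≤ j) :
    p.coeff j = 0 := by
  rw [mem_degreeLT, degree_lt_iff_coeff_zero] at h
  exact h j hj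

/-! ### Euler and Legendre operators on polynomials -/

/-- The Euler operator `(x - c) d/dx` acts as `k` on the leading term of degree `k`. -/
lemma euler_sub_mem (c : ℝ) {k : ℕ} {q : ℝ[X]} (hq : q ∈ degreeLT ℝ (k + 1)) :
    (X - C c) * derivative q - C (k : ℝ) * q ∈ degreeLT ℝ k := by
  refine mem_degreeLT_of_coeff fun j hj => ?_
  have h1 := coeff_of_mem_degreeLT hq (j := j + 1) (by omega)
  rw [sub_mul, coeff_sub, coeff_sub, coeff_C_mul, coeff_C_mul, coeff_derivative, h1]
  rcases j with _ | j
  · obtain rfl : k = 0 := by omega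
    simp
  · rw [coeff_X_mul, coeff_derivative]
    rcases eq_or_lt_of_le hj with h | h
    · rw [h]; push_cast; ring
    · rw [coeff_of_mem_degreeLT hq (j := j + 1) (by omega)]; simp

/-- The Legendre differential operator of the interval `[a, b]`. -/
def legendreOp (a b : ℝ) (p : ℝ[X]) : ℝ[X] :=
  -derivative ((X - C a) * (C b - X) * derivative p)

lemma derivative_mem_degreeLT {k : ℕ} {q : ℝ[X]} (hq : q ∈ degreeLT ℝ (k + 1)) :
    derivative q ∈ degreeLT ℝ k :=
  mem_degreeLT_of_coeff fun j hj => by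
    rw [coeff_derivative, coeff_of_mem_degreeLT hq (by omega), zero_mul]

/-- The operator is q ↦ ((X - b)(X - a)q')', the composition of (X - a) d/dx with 1 + (X - b) d/dx.
On a leading term of degree k these act as k and as k + 1, which gives k(k + 1) modulo lower degree.
-/
lemma legendreOp_sub_mem (a b : ℝ) {k : ℕ} {q : ℝ[X]} (hq : q ∈ degreeLT ℝ (k + 1)) :
    legendreOp a b q - C ((k : ℝ) * (k + 1)) * q ∈ degreeLT ℝ k := by
  have h1 := euler_sub_mem a hq
  set e := (X - C a) * derivative q - C (k : ℝ) * q with he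
  have hd : derivative q ∈ degreeLT ℝ k := derivative_mem_degreeLT hq
  have h2 : derivative e ∈ degreeLT ℝ k := by
    rcases k with _ | k
    · have : e = 0 := eq_zero_of_mem_degreeLT h1
      simp [this]
    · exact degreeLT_mono' (Nat.le_succ k) (derivative_mem_degreeLT h1)
  have h3 : (X - C b) * derivative e ∈ degreeLT ℝ k := by
    rcases k with _ | k
    · have : e = 0 := eq_zero_of_mem_degreeLT h1
      simp [this]
    · have := euler_sub_mem b h1
      have h4 : (X - C b) * derivative e =
        ((X - C b) * derivative e - C (k : ℝ) * e) + (k : ℝ) • e := by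
        rw [smul_eq_C_mul]; ring
      rw [h4]
      exact Submodule.add_mem _ (degreeLT_mono' (Nat.le_succ k) this)
        (Submodule.smul_mem _ _ h1)
  have h5 := euler_sub_mem b hq
  have h6 : legendreOp a b q - C ((k : ℝ) * (k + 1)) * q =
      e + (X - C b) * derivative e + (k : ℝ) • ((X - C b) * derivative q - C (k : ℝ) * q) := by
    have hx : (X - C a) * (C b - X) * derivative q = -((X - C b) * (e + C (k : ℝ) * q)) := by
      rw [he]; ring
    rw [legendreOp, hx, smul_eq_C_mul]
    simp only [derivative_neg, derivative_mul, derivative_sub, derivative_X,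
      derivative_C, map_mul, map_add, map_one]
    ring
  rw [h6]
  exact Submodule.add_mem _ (Submodule.add_mem _ h1 h3) (Submodule.smul_mem _ _ h5)

/-- Integration by parts; the weight (x - a)(b - x) vanishes at both ends, so there are no boundary
terms. The right side is symmetric in p and q, hence the operator is symmetric. -/
lemma polyInt_legendreOp_mul (a b : ℝ) (p q : ℝ[X]) :
    polyInt a b (legendreOp a b p * q) =
      polyInt a b ((X - C a) * (C b - X) * (derivative p * derivative q)) := by
  have h := polyInt_derivative a b ((X - C a) * (C b - X) * derivative p * q)
  rw [derivative_mul, map_add] at h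
  have h1 : legendreOp a b p * q =
      -(derivative ((X - C a) * (C b - X) * derivative p) * q) := by
    rw [legendreOp]; ring
  have h2 : (X - C a) * (C b - X) * (derivative p * derivative q) =
      (X - C a) * (C b - X) * derivative p * derivative q := by ring
  rw [h1, h2, map_neg]
  simp only [eval_mul, eval_sub, eval_X, eval_C, sub_self, zero_mul, mul_zero] at h
  linarith

lemma polyInt_legendreOp_comm (a b : ℝ) (p q : ℝ[X]) :
    polyInt a b (legendreOp a b p * q) = polyInt a b (p * legendreOp a b q) := by
  rw [polyInt_legendreOp_mul, mul_comm p, polyInt_legendreOp_mul, mul_comm (derivative p)]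

lemma legendreOp_mem (a b : ℝ) {k : ℕ} {q : ℝ[X]} (hq : q ∈ degreeLT ℝ k) :
    legendreOp a b q ∈ degreeLT ℝ k := by
  rcases k with _ | k
  · have : q = 0 := eq_zero_of_mem_degreeLT hq
    simp [this, legendreOp]
  · have h := degreeLT_mono' (Nat.le_succ k) (legendreOp_sub_mem a b hq)
    have := Submodule.add_mem _ h (Submodule.smul_mem _ ((k : ℝ) * (k + 1)) hq)
    rwa [smul_eq_C_mul, sub_add_cancel] at this

/-! ### Orthogonal projection, spectral gap and the basic approximation rate -/

lemma intervalIntegrable_mul_eval {a b : ℝ} {u : ℝ → ℝ} (hu : IntervalIntegrable u volume a b)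
    (q : ℝ[X]) : IntervalIntegrable (fun x => u x * q.eval x) volume a b :=
  hu.mul_continuousOn q.continuous.continuousOn

/-- Existence of the `L²` projection onto polynomials of degree less than `n`. -/
lemma exists_proj {a b : ℝ} (hab : a < b) (n : ℕ) :
    ∀ u : ℝ → ℝ, IntervalIntegrable u volume a b →
      ∃ p ∈ degreeLT ℝ n, ∀ q ∈ degreeLT ℝ n, ∫ x in a..b, (u x - p.eval x) * q.eval x = 0 := by
  induction n with
  | zero =>
    intro u _
    refine ⟨0, Submodule.zero_mem _, fun q hq => ?_⟩
    have : q = 0 := eq_zero_of_mem_degreeLT hq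
    simp [this]
  | succ n ih =>
    intro u hu
    -- Gram-Schmidt: the induction hypothesis is applied to X^n, which produces the next orthogonal
    -- polynomial l, and to u itself; the component of u along l is then added.
    obtain ⟨s, hs, hs'⟩ := ih (fun x => ((X : ℝ[X]) ^ n).eval x)
      ((X ^ n : ℝ[X]).continuous.intervalIntegrable _ _)
    obtain ⟨p, hp, hp'⟩ := ih u hu
    set l : ℝ[X] := X ^ n - s with hl
    have hlo : ∀ q ∈ degreeLT ℝ n, polyInt a b (l * q) = 0 := fun q hq => by
      rw [polyInt_apply]; simpa [hl] using hs' q hq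
    have hlc : l.coeff n = 1 := by
      rw [hl, coeff_sub, coeff_of_mem_degreeLT hs le_rfl]; simp
    have hl0 : l ≠ 0 := fun h => by simp [h] at hlc
    have hln : l ∈ degreeLT ℝ (n + 1) :=
      Submodule.sub_mem _ (by rw [mem_degreeLT, degree_X_pow]; exact_mod_cast Nat.lt_succ_self n)
        (degreeLT_mono' (Nat.le_succ n) hs)
    have hpos := polyInt_mul_self_pos hab hl0
    set d := (∫ x in a..b, u x * l.eval x) / polyInt a b (l * l) with hd
    have key : ∀ q : ℝ[X], ∫ x in a..b, (u x - (p + C d * l).eval x) * q.eval x =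
        (∫ x in a..b, (u x - p.eval x) * q.eval x) - d * polyInt a b (l * q) := by
      intro q
      rw [← polyInt_C_mul, polyInt_apply, ← intervalIntegral.integral_sub
        (intervalIntegrable_mul_eval (hu.sub (p.continuous.intervalIntegrable _ _)) q)
        ((C d * (l * q)).continuous.intervalIntegrable _ _)]
      congr 1; ext x; simp; ring
    refine ⟨p + C d * l, Submodule.add_mem _ (degreeLT_mono' (Nat.le_succ n) hp)
      (by rw [← smul_eq_C_mul]; exact Submodule.smul_mem _ _ hln), fun q hq => ?_⟩
    have hq' : q - C (q.coeff n) * l ∈ degreeLT ℝ n := by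
      refine mem_degreeLT_of_coeff fun j hj => ?_
      rcases eq_or_lt_of_le hj with h | h
      · rw [← h, coeff_sub, coeff_C_mul, hlc]; ring
      · rw [coeff_sub, coeff_C_mul, coeff_of_mem_degreeLT hq h, coeff_of_mem_degreeLT hln h]; ring
    have h1 : ∫ x in a..b, (u x - (p + C d * l).eval x) * l.eval x = 0 := by
      rw [key]
      have h2 : ∫ x in a..b, (u x - p.eval x) * l.eval x =
          (∫ x in a..b, u x * l.eval x) - polyInt a b (l * p) := by
        rw [polyInt_apply, ← intervalIntegral.integral_sub (intervalIntegrable_mul_eval hu l)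
          ((l * p).continuous.intervalIntegrable _ _)]
        congr 1; ext x; simp; ring
      rw [h2, hlo p hp, hd, div_mul_cancel₀ _ hpos.ne']; ring
    have h2 : ∫ x in a..b, (u x - (p + C d * l).eval x) * (q - C (q.coeff n) * l).eval x = 0 := by
      rw [key, hp' _ hq', hlo _ hq']; ring
    have hv := hu.sub ((p + C d * l).continuous.intervalIntegrable (μ := volume) a b)
    have h3 : ∫ x in a..b, (u x - (p + C d * l).eval x) * q.eval x =
        (∫ x in a..b, (u x - (p + C d * l).eval x) * (q - C (q.coeff n) * l).eval x) +
        q.coeff n * ∫ x in a..b, (u x - (p + C d * l).eval x) * l.eval x := by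
      rw [← intervalIntegral.integral_const_mul, ← intervalIntegral.integral_add
        (intervalIntegrable_mul_eval hv _) ((intervalIntegrable_mul_eval hv _).const_mul _)]
      congr 1; ext x; simp; ring
    rw [h3, h1, h2]; ring

/-- The monic orthogonal polynomial of degree `n` on `[a, b]`. -/
lemma exists_orthogonal_monic {a b : ℝ} (hab : a < b) (n : ℕ) :
    ∃ l ∈ degreeLT ℝ (n + 1), (∀ q ∈ degreeLT ℝ n, polyInt a b (l * q) = 0) ∧
      ∀ q ∈ degreeLT ℝ (n + 1), q - C (q.coeff n) * l ∈ degreeLT ℝ n := by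
  obtain ⟨s, hs, hs'⟩ := exists_proj hab n (fun x => ((X : ℝ[X]) ^ n).eval x)
      ((X ^ n : ℝ[X]).continuous.intervalIntegrable _ _)
  have hln : X ^ n - s ∈ degreeLT ℝ (n + 1) :=
    Submodule.sub_mem _ (by rw [mem_degreeLT, degree_X_pow]; exact_mod_cast Nat.lt_succ_self n)
      (degreeLT_mono' (Nat.le_succ n) hs)
  refine ⟨X ^ n - s, hln, fun q hq => ?_, fun q hq => mem_degreeLT_of_coeff fun j hj => ?_⟩
  · rw [polyInt_apply]; simpa using hs' q hq
  · rcases eq_or_lt_of_le hj with h | h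
    · rw [← h, coeff_sub, coeff_C_mul, coeff_sub, coeff_of_mem_degreeLT hs le_rfl]; simp
    · rw [coeff_sub, coeff_C_mul, coeff_of_mem_degreeLT hq h, coeff_of_mem_degreeLT hln h]; ring

lemma legendreWeight_nonneg {a b : ℝ} (hab : a ≤ b) (p : ℝ[X]) :
    0 ≤ polyInt a b ((X - C a) * (C b - X) * (p * p)) :=
  polyInt_nonneg hab fun x hx => by
    simp only [eval_mul, eval_sub, eval_X, eval_C]
    exact mul_nonneg (mul_nonneg (by linarith [hx.1]) (by linarith [hx.2])) (mul_self_nonneg _)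

/-- Spectral gap of the Legendre operator on the complement of low degrees. -/
lemma legendre_spectral {a b : ℝ} (hab : a < b) (n k : ℕ) :
    ∀ p ∈ degreeLT ℝ k, (∀ q ∈ degreeLT ℝ n, polyInt a b (p * q) = 0) →
      (n : ℝ) * (n + 1) * polyInt a b (p * p) ≤
        polyInt a b ((X - C a) * (C b - X) * (derivative p * derivative p)) := by
  induction k with
  | zero =>
    intro p hp _
    have : p = 0 := eq_zero_of_mem_degreeLT hp
    simp [this]
  | succ k ih =>
    intro p hp ho
    -- If p has degree less than n it is one of its own test functions, so the left side vanishes.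
    rcases le_or_gt (k + 1) n with hkn | hkn
    · rw [ho p (degreeLT_mono' hkn hp), mul_zero]
      exact legendreWeight_nonneg hab.le _
    obtain ⟨l, hl, hlo, hld⟩ := exists_orthogonal_monic hab k
    set c := p.coeff k
    have hp' := hld p hp
    set p' := p - C c * l with hpp
    have hpe : p = p' + C c * l := by rw [hpp]; ring
    have h1 := ih p' hp' fun q hq => by
      rw [hpp, sub_mul, map_sub, ho q hq, mul_assoc, polyInt_C_mul,
        hlo q (degreeLT_mono' (by omega) hq)]; ring
    have h2 : polyInt a b (p * p) = polyInt a b (p' * p') + c ^ 2 * polyInt a b (l * l) := by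
      have : p * p = p' * p' + C (2 * c) * (l * p') + C (c ^ 2) * (l * l) := by
        rw [hpe]; simp only [map_mul, map_pow, C_ofNat]; ring
      rw [this, map_add, map_add, polyInt_C_mul, polyInt_C_mul, hlo p' hp']; ring
    -- The cross term vanishes in the weighted energy as well: move the operator onto p', whose
    -- degree it does not raise, and use that l is orthogonal to lower degree.
    have h3 : polyInt a b ((X - C a) * (C b - X) * (derivative l * derivative p')) = 0 := by
      rw [← polyInt_legendreOp_mul, polyInt_legendreOp_comm]
      exact hlo _ (legendreOp_mem a b hp')
    have h4 : polyInt a b ((X - C a) * (C b - X) * (derivative l * derivative l)) =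
        (k : ℝ) * (k + 1) * polyInt a b (l * l) := by
      rw [← polyInt_legendreOp_mul]
      have : legendreOp a b l * l = l * (legendreOp a b l - C ((k : ℝ) * (k + 1)) * l) +
        C ((k : ℝ) * (k + 1)) * (l * l) := by ring
      rw [this, map_add, hlo _ (legendreOp_sub_mem a b hl), polyInt_C_mul, zero_add]
    have h5 : polyInt a b ((X - C a) * (C b - X) * (derivative p * derivative p)) =
        polyInt a b ((X - C a) * (C b - X) * (derivative p' * derivative p')) +
        c ^ 2 * ((k : ℝ) * (k + 1) * polyInt a b (l * l)) := by
      have : (X - C a) * (C b - X) * (derivative p * derivative p) =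
          (X - C a) * (C b - X) * (derivative p' * derivative p') +
          C (2 * c) * ((X - C a) * (C b - X) * (derivative l * derivative p')) +
          C (c ^ 2) * ((X - C a) * (C b - X) * (derivative l * derivative l)) := by
        rw [hpe, derivative_add, derivative_C_mul]; simp only [map_mul, map_pow, C_ofNat]; ring
      rw [this, map_add, map_add, polyInt_C_mul, polyInt_C_mul, h3, h4]; ring
    rw [h2, h5, mul_add]
    refine add_le_add h1 ?_
    have hk : (n : ℝ) ≤ k := by exact_mod_cast (by omega : n ≤ k)
    have hll := polyInt_mul_self_nonneg hab.le l
    have : (n : ℝ) * (n + 1) ≤ (k : ℝ) * (k + 1) := by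
      have := n.cast_nonneg (α := ℝ); nlinarith
    calc (n : ℝ) * (n + 1) * (c ^ 2 * polyInt a b (l * l))
        = c ^ 2 * ((n : ℝ) * (n + 1) * polyInt a b (l * l)) := by ring
      _ ≤ _ := by gcongr

/-- Polynomial approximation in `L²` with the rate `(b - a) / n` in terms of the derivative. -/
lemma exists_poly_approx_poly {a b : ℝ} (hab : a < b) (n : ℕ) (p : ℝ[X]) :
    ∃ q ∈ degreeLT ℝ n, (n : ℝ) ^ 2 * polyInt a b ((p - q) * (p - q)) ≤
      (b - a) ^ 2 / 4 * polyInt a b (derivative p * derivative p) := by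
  obtain ⟨q, hq, ho⟩ := exists_proj hab n (fun x => p.eval x) (p.continuous.intervalIntegrable _ _)
  refine ⟨q, hq, ?_⟩
  have ho' : ∀ s ∈ degreeLT ℝ n, polyInt a b ((p - q) * s) = 0 := fun s hs => by
    rw [polyInt_apply]; simpa using ho s hs
  obtain ⟨k, hk⟩ : ∃ k, p - q ∈ degreeLT ℝ k :=
    ⟨(p - q).natDegree + 1, by
      rw [mem_degreeLT]
      exact lt_of_le_of_lt degree_le_natDegree (by exact_mod_cast Nat.lt_succ_self _)⟩
  have h1 := legendre_spectral hab n k _ hk ho'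
  set e := p - q with he
  -- The projection is orthogonal for the weighted energy too, because the Legendre operator
  -- preserves degrees. Hence the energy of e is at most that of p.
  have h2 : polyInt a b ((X - C a) * (C b - X) * (derivative e * derivative q)) = 0 := by
    rw [← polyInt_legendreOp_mul, polyInt_legendreOp_comm]
    exact ho' _ (legendreOp_mem a b hq)
  have h3 : polyInt a b ((X - C a) * (C b - X) * (derivative p * derivative p)) =
      polyInt a b ((X - C a) * (C b - X) * (derivative e * derivative e)) +
      polyInt a b ((X - C a) * (C b - X) * (derivative q * derivative q)) := by
    have : (X - C a) * (C b - X) * (derivative p * derivative p) =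
        (X - C a) * (C b - X) * (derivative e * derivative e) +
        C 2 * ((X - C a) * (C b - X) * (derivative e * derivative q)) +
        (X - C a) * (C b - X) * (derivative q * derivative q) := by
      have : p = e + q := by rw [he]; ring
      rw [this, derivative_add, C_ofNat]; ring
    rw [this, map_add, map_add, polyInt_C_mul, h2]; ring
  have h4 := legendreWeight_nonneg hab.le (derivative q)
  -- The weight (x - a)(b - x) has maximum (b - a)²/4, attained at the midpoint.
  have h5 : polyInt a b ((X - C a) * (C b - X) * (derivative p * derivative p)) ≤
      (b - a) ^ 2 / 4 * polyInt a b (derivative p * derivative p) := by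
    rw [← polyInt_C_mul]
    refine intervalIntegral.integral_mono_on hab.le (Polynomial.continuous _|>.intervalIntegrable _ _)
      (Polynomial.continuous _|>.intervalIntegrable _ _) fun x _ => ?_
    simp only [eval_mul, eval_sub, eval_X, eval_C]
    refine mul_le_mul_of_nonneg_right ?_ (mul_self_nonneg _)
    nlinarith [sq_nonneg (2 * x - a - b)]
  have h6 := polyInt_mul_self_nonneg hab.le e
  have h7 : (n : ℝ) ^ 2 * polyInt a b (e * e) ≤ (n : ℝ) * (n + 1) * polyInt a b (e * e) := by
    refine mul_le_mul_of_nonneg_right ?_ h6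
    have := n.cast_nonneg (α := ℝ); nlinarith
  linarith

/-! ### Inverse estimates and the weighted comparison with the projection -/

/-- Inverse estimate at an endpoint `c` of the interval. -/
lemma sq_eval_endpoint_le {a b c : ℝ} (hab : a < b) (hc : c = a ∨ c = b) (k : ℕ) :
    ∀ p ∈ degreeLT ℝ k, (b - a) * p.eval c ^ 2 ≤ (k : ℝ) ^ 2 * polyInt a b (p * p) := by
  induction k with
  | zero =>
    intro p hp
    have : p = 0 := eq_zero_of_mem_degreeLT hp
    simp [this]
  | succ k ih =>
    intro p hp
    obtain ⟨l, hl, hlo, hld⟩ := exists_orthogonal_monic hab k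
    have h1 := ih _ (hld p hp)
    set d := p.coeff k
    set p' := p - C d * l with hpp
    have hpe : p = p' + C d * l := by rw [hpp]; ring
    have h2 : polyInt a b (p * p) = polyInt a b (p' * p') + d ^ 2 * polyInt a b (l * l) := by
      have : p * p = p' * p' + C (2 * d) * (l * p') + C (d ^ 2) * (l * l) := by
        rw [hpe]; simp only [map_mul, map_pow, C_ofNat]; ring
      rw [this, map_add, map_add, polyInt_C_mul, polyInt_C_mul, hlo p' (hld p hp)]; ring
    -- Let o be the opposite endpoint. Integrating ((x - o)l²)' leaves only the value at c. By
    -- Euler's identity the integrand is (2k + 1)l² plus 2l times a polynomial of lower degree, and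
    -- that last product integrates to 0. The odd numbers 2k + 1 sum to the square in the statement.
    have h3 : (b - a) * l.eval c ^ 2 = (2 * k + 1) * polyInt a b (l * l) := by
      obtain ⟨o, ho⟩ : ∃ o, ∀ q : ℝ[X], polyInt a b (derivative ((X - C o) * q)) =
          (b - a) * q.eval c := by
        rcases hc with rfl | rfl
        · exact ⟨b, fun q => by rw [polyInt_derivative]; simp; ring⟩
        · exact ⟨a, fun q => by rw [polyInt_derivative]; simp⟩
      have h4 : polyInt a b (derivative ((X - C o) * (l * l))) = (b - a) * l.eval c ^ 2 := by
        rw [ho, eval_mul, sq]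
      rw [← h4]
      have : derivative ((X - C o) * (l * l)) = C (2 * k + 1 : ℝ) * (l * l) +
          C 2 * (l * ((X - C o) * derivative l - C (k : ℝ) * l)) := by
        simp only [derivative_mul, derivative_sub, derivative_X, derivative_C, map_mul,
          map_add, C_ofNat, map_one]
        ring
      rw [this, map_add, polyInt_C_mul, polyInt_C_mul, hlo _ (euler_sub_mem o hl)]; ring
    have h5 : p.eval c = p'.eval c + d * l.eval c := by rw [hpe]; simp
    have hll := polyInt_mul_self_nonneg hab.le l
    have hpp' := polyInt_mul_self_nonneg hab.le p'
    rw [h5, h2]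
    push_cast
    set α := polyInt a b (p' * p')
    set β := polyInt a b (l * l)
    have hk := k.cast_nonneg (α := ℝ)
    have h6 : (b - a) * (d * l.eval c) ^ 2 = (2 * k + 1) * (d ^ 2 * β) := by
      rw [mul_pow, mul_left_comm, h3]; ring
    set u := p'.eval c
    set v := d * l.eval c
    have hh : 0 < b - a := by linarith
    have hβ : 0 ≤ d ^ 2 * β := by positivity
    -- Cauchy-Schwarz with the weights k² and 2k + 1, whose sum is (k + 1)². Multiplying through by
    -- k²(2k + 1) avoids division; the factor is degenerate for k = 0, treated separately below.
    have key : ((k : ℝ) ^ 2 * (2 * k + 1)) * ((b - a) * (u + v) ^ 2) ≤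
        ((k : ℝ) ^ 2 * (2 * k + 1)) * ((k + 1) ^ 2 * (α + d ^ 2 * β)) := by
      have e1 : ((k : ℝ) ^ 2 * (2 * k + 1)) * (u + v) ^ 2 ≤
          (k + 1) ^ 2 * ((2 * k + 1) * u ^ 2 + k ^ 2 * v ^ 2) := by
        nlinarith [sq_nonneg ((2 * k + 1) * u - k ^ 2 * v)]
      have e2 : (b - a) * ((2 * k + 1) * u ^ 2 + k ^ 2 * v ^ 2) ≤
          (2 * k + 1) * (k ^ 2 * α) + k ^ 2 * ((2 * k + 1) * (d ^ 2 * β)) := by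
        rw [mul_add, mul_left_comm, mul_left_comm (b - a) ((k : ℝ) ^ 2), h6]
        gcongr
      calc _ = (b - a) * (((k : ℝ) ^ 2 * (2 * k + 1)) * (u + v) ^ 2) := by ring
        _ ≤ (b - a) * ((k + 1) ^ 2 * ((2 * k + 1) * u ^ 2 + k ^ 2 * v ^ 2)) := by gcongr
        _ = (k + 1) ^ 2 * ((b - a) * ((2 * k + 1) * u ^ 2 + k ^ 2 * v ^ 2)) := by ring
        _ ≤ (k + 1) ^ 2 * ((2 * k + 1) * (k ^ 2 * α) + k ^ 2 * ((2 * k + 1) * (d ^ 2 * β))) := by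
          gcongr
        _ = _ := by ring
    rcases Nat.eq_zero_or_pos k with h0 | h0
    · subst h0
      have hu : u = 0 := by
        have : p' = 0 := eq_zero_of_mem_degreeLT (hld p hp)
        simp [u, this]
      rw [hu]
      simp only [Nat.cast_zero] at *
      nlinarith
    · have : (0 : ℝ) < (k : ℝ) ^ 2 * (2 * k + 1) := by
        have : (0 : ℝ) < k := by exact_mod_cast h0
        positivity
      exact le_of_mul_le_mul_left key this

/-- The `L^∞`-`L²` inverse estimate for polynomials. -/
lemma sq_eval_le {a b : ℝ} (hab : a < b) {k : ℕ} {p : ℝ[X]} (hp : p ∈ degreeLT ℝ k) {x : ℝ}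
    (hx : x ∈ Icc a b) : (b - a) * p.eval x ^ 2 ≤ 2 * (k : ℝ) ^ 2 * polyInt a b (p * p) := by
  have hi : ∀ u v : ℝ, IntervalIntegrable (fun x => (p * p).eval x) volume u v :=
    fun u v => (p * p).continuous.intervalIntegrable _ _
  have hnn : ∀ x, 0 ≤ (p * p).eval x := fun x => by simpa using mul_self_nonneg _
  have hadd : polyInt a x (p * p) + polyInt x b (p * p) = polyInt a b (p * p) :=
    intervalIntegral.integral_add_adjacent_intervals (hi a x) (hi x b)
  have h1 := polyInt_mul_self_nonneg hx.1 p
  have h2 := polyInt_mul_self_nonneg hx.2 p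
  have hk : (0 : ℝ) ≤ (k : ℝ) ^ 2 := by positivity
  -- The point x is an endpoint of the longer of [a, x] and [x, b], which has length at least (b -
  -- a)/2; this is the factor 2.
  rcases le_total ((a + b) / 2) x with h | h
  · have h3 := sq_eval_endpoint_le (a := a) (b := x) (by linarith) (Or.inr rfl) k p hp
    nlinarith [sq_nonneg (p.eval x), mul_nonneg hk h2]
  · have h3 := sq_eval_endpoint_le (a := x) (b := b) (by linarith) (Or.inl rfl) k p hp
    nlinarith [sq_nonneg (p.eval x), mul_nonneg hk h1]

/-- If `q` is the projection of `p` (of degree at most `k`) onto degree less than `k`, then the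
weight `b - x` favours `p` over `q`. -/
lemma polyInt_weight_le {a b : ℝ} (hab : a ≤ b) {k : ℕ} {p q : ℝ[X]} (hp : p ∈ degreeLT ℝ (k + 1))
    (hq : q ∈ degreeLT ℝ k) (ho : ∀ s ∈ degreeLT ℝ k, polyInt a b ((p - q) * s) = 0) :
    polyInt a b ((C b - X) * (derivative p * p)) ≤
      polyInt a b ((C b - X) * (derivative p * q)) := by
  -- By Euler's identity, (x - b)p' equals kp up to degree less than k. Tested with p - q this shows
  -- that the two sides differ exactly by k times the squared L² norm of p - q.
  have h1 : (C b - X) * (derivative p * p) = (C b - X) * (derivative p * q) -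
      (p - q) * ((X - C b) * derivative p - C (k : ℝ) * p) -
      C (k : ℝ) * ((p - q) * q) - C (k : ℝ) * ((p - q) * (p - q)) := by ring
  rw [h1, map_sub, map_sub, map_sub, polyInt_C_mul, polyInt_C_mul, ho q hq,
    ho _ (euler_sub_mem b hp)]
  have := mul_nonneg (k.cast_nonneg (α := ℝ)) (polyInt_mul_self_nonneg hab (p - q))
  linarith

/-! ### `L²` approximation by polynomials -/

/-- The Cauchy-Schwarz inequality. -/
lemma sq_integral_mul_le {α : Type*} [MeasurableSpace α] {μ : Measure α} {u v : α → ℝ}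
    (hu : MemLp u 2 μ) (hv : MemLp v 2 μ) :
    (∫ x, u x * v x ∂μ) ^ 2 ≤ (∫ x, u x ^ 2 ∂μ) * ∫ x, v x ^ 2 ∂μ := by
  have huv : Integrable (fun x => u x * v x) μ := hu.integrable_mul hv
  have key : ∀ t : ℝ, 0 ≤ (∫ x, u x ^ 2 ∂μ) * (t * t) + 2 * (∫ x, u x * v x ∂μ) * t +
      ∫ x, v x ^ 2 ∂μ := by
    intro t
    have h1 : 0 ≤ ∫ x, (t * u x + v x) ^ 2 ∂μ := integral_nonneg fun x => sq_nonneg _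
    have h2 : ∫ x, (t * u x + v x) ^ 2 ∂μ =
        ∫ x, (t * t * u x ^ 2 + 2 * t * (u x * v x)) + v x ^ 2 ∂μ := by
      congr 1; ext x; ring
    have h3 : Integrable (fun x => t * t * u x ^ 2 + 2 * t * (u x * v x)) μ :=
      (hu.integrable_sq.const_mul _).add (huv.const_mul _)
    rw [h2, integral_add h3 hv.integrable_sq,
      integral_add (hu.integrable_sq.const_mul _) (huv.const_mul _), integral_const_mul,
      integral_const_mul] at h1
    linarith
  have := discrim_le_zero key
  rw [discrim] at this
  nlinarith

lemma memLp_of_continuous {a b : ℝ} {u : ℝ → ℝ} (hu : ContinuousOn u (Icc a b)) :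
    MemLp u 2 (volume.restrict (Ioc a b)) := by
  obtain ⟨K, hK⟩ := isCompact_Icc.exists_bound_of_continuousOn hu
  refine MemLp.of_bound ((hu.mono Ioc_subset_Icc_self).aestronglyMeasurable measurableSet_Ioc) K ?_
  filter_upwards [ae_restrict_mem measurableSet_Ioc] with x hx using hK x (Ioc_subset_Icc_self hx)

lemma memLp_poly (a b : ℝ) (p : ℝ[X]) : MemLp (fun x => p.eval x) 2 (volume.restrict (Ioc a b)) :=
  memLp_of_continuous p.continuous.continuousOn

lemma intervalIntegrable_of_memLp {a b : ℝ} (hab : a ≤ b) {u : ℝ → ℝ}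
    (hu : MemLp u 2 (volume.restrict (Ioc a b))) : IntervalIntegrable u volume a b :=
  (intervalIntegrable_iff_integrableOn_Ioc_of_le hab).2 (hu.integrable (by norm_num))

lemma intervalIntegrable_sq {a b : ℝ} (hab : a ≤ b) {u : ℝ → ℝ}
    (hu : MemLp u 2 (volume.restrict (Ioc a b))) :
    IntervalIntegrable (fun x => u x ^ 2) volume a b :=
  (intervalIntegrable_iff_integrableOn_Ioc_of_le hab).2 hu.integrable_sq

lemma intervalIntegrable_mul {a b : ℝ} (hab : a ≤ b) {u v : ℝ → ℝ}
    (hu : MemLp u 2 (volume.restrict (Ioc a b))) (hv : MemLp v 2 (volume.restrict (Ioc a b))) :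
    IntervalIntegrable (fun x => u x * v x) volume a b :=
  (intervalIntegrable_iff_integrableOn_Ioc_of_le hab).2 (hu.integrable_mul hv)

lemma sq_intervalIntegral_mul_le {a b : ℝ} (hab : a ≤ b) {u v : ℝ → ℝ}
    (hu : MemLp u 2 (volume.restrict (Ioc a b))) (hv : MemLp v 2 (volume.restrict (Ioc a b))) :
    (∫ x in a..b, u x * v x) ^ 2 ≤ (∫ x in a..b, u x ^ 2) * ∫ x in a..b, v x ^ 2 := by
  simp only [intervalIntegral.integral_of_le hab]
  exact sq_integral_mul_le hu hv

lemma integral_sq_nonneg {a b : ℝ} (hab : a ≤ b) (u : ℝ → ℝ) : 0 ≤ ∫ x in a..b, u x ^ 2 :=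
  intervalIntegral.integral_nonneg hab fun _ _ => sq_nonneg _

/-- `‖u‖² ≤ 2 ‖v‖² + 2 ‖w‖²` when `|u| ≤ |v| + |w|`, in `L²(a, b)`. -/
lemma integral_sq_le_of_eq_add {a b : ℝ} (hab : a ≤ b) {u v w : ℝ → ℝ}
    (hv : MemLp v 2 (volume.restrict (Ioc a b))) (hw : MemLp w 2 (volume.restrict (Ioc a b)))
    (h : ∀ x ∈ Ioc a b, u x = v x + w x) :
    ∫ x in a..b, u x ^ 2 ≤ 2 * (∫ x in a..b, v x ^ 2) + 2 * ∫ x in a..b, w x ^ 2 := by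
  have h1 : ∫ x in a..b, u x ^ 2 = ∫ x in a..b, (v x + w x) ^ 2 := by
    rw [intervalIntegral.integral_of_le hab, intervalIntegral.integral_of_le hab]
    exact setIntegral_congr_fun measurableSet_Ioc fun x hx => by simp only [h x hx]
  rw [h1, ← intervalIntegral.integral_const_mul, ← intervalIntegral.integral_const_mul,
    ← intervalIntegral.integral_add ((intervalIntegrable_sq hab hv).const_mul _)
      ((intervalIntegrable_sq hab hw).const_mul _)]
  refine intervalIntegral.integral_mono_on hab (intervalIntegrable_sq hab (hv.add hw))
    (((intervalIntegrable_sq hab hv).const_mul _).add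
      ((intervalIntegrable_sq hab hw).const_mul _)) fun x _ => ?_
  nlinarith [sq_nonneg (v x - w x)]

lemma sq_primitive_le {a b : ℝ} {g : ℝ → ℝ} (hg : MemLp g 2 (volume.restrict (Ioc a b)))
    {x : ℝ} (hx : x ∈ Icc a b) :
    (∫ t in a..x, g t) ^ 2 ≤ (b - a) * ∫ t in a..b, g t ^ 2 := by
  have hab : a ≤ b := hx.1.trans hx.2
  have hg' : MemLp g 2 (volume.restrict (Ioc a x)) :=
    hg.mono_measure (Measure.restrict_mono (Ioc_subset_Ioc_right hx.2) le_rfl)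
  have h1 := sq_intervalIntegral_mul_le hx.1 hg'
    (memLp_of_continuous (u := fun _ => 1) continuousOn_const)
  simp only [mul_one, one_pow, intervalIntegral.integral_const, smul_eq_mul] at h1
  have h2 : ∫ t in a..x, g t ^ 2 ≤ ∫ t in a..b, g t ^ 2 :=
    intervalIntegral.integral_mono_interval le_rfl hx.1 hx.2
      (Filter.Eventually.of_forall fun t => sq_nonneg _) (intervalIntegrable_sq hab hg)
  have h3 := integral_sq_nonneg hx.1 g
  nlinarith [hx.1, hx.2]

lemma continuousOn_primitive_add {a b : ℝ} (hab : a ≤ b) {g : ℝ → ℝ}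
    (hg : IntervalIntegrable g volume a b) (c : ℝ) :
    ContinuousOn (fun x => c + ∫ t in a..x, g t) (Icc a b) := by
  have := intervalIntegral.continuousOn_primitive_interval' hg left_mem_uIcc
  rw [uIcc_of_le hab] at this
  exact continuousOn_const.add this

/-- Polynomials are dense in `L²(a, b)`. -/
lemma exists_poly_integral_sq_le {a b : ℝ} (hab : a < b) {u : ℝ → ℝ}
    (hu : MemLp u 2 (volume.restrict (Ioc a b))) {ε : ℝ} (hε : 0 < ε) :
    ∃ p : ℝ[X], ∫ x in a..b, (u x - p.eval x) ^ 2 ≤ ε := by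
  have hu' : MemLp u (ENNReal.ofReal 2) (volume.restrict (Ioc a b)) := by simpa using hu
  obtain ⟨g, -, hg1, hg2, -⟩ :=
    hu'.exists_hasCompactSupport_integral_rpow_sub_le two_pos (ε := ε / 4) (by positivity)
  have hd : 0 < √(ε / (4 * (b - a))) := by
    have : 0 < b - a := by linarith
    positivity
  obtain ⟨p, hp⟩ := exists_polynomial_near_of_continuousOn a b g hg2.continuousOn _ hd
  refine ⟨p, ?_⟩
  have h1 : ∫ x in a..b, (u x - g x) ^ 2 ≤ ε / 4 := by
    rw [intervalIntegral.integral_of_le hab.le]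
    simpa using hg1
  have h2 : ∫ x in a..b, (g x - p.eval x) ^ 2 ≤ ε / 4 := by
    have h3 : ∫ x in a..b, (g x - p.eval x) ^ 2 ≤ ∫ _ in a..b, ε / (4 * (b - a)) := by
      refine intervalIntegral.integral_mono_on hab.le
        ((hg2.sub p.continuous).pow 2 |>.intervalIntegrable _ _)
        (continuous_const.intervalIntegrable _ _) fun x hx => ?_
      have h4 := (hp x hx).le
      rw [Real.le_sqrt (abs_nonneg _) , sq_abs] at h4
      · linarith [sq_nonneg (g x - p.eval x), (by ring : (p.eval x - g x) ^ 2 = (g x - p.eval x) ^ 2)]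
      · have : 0 < b - a := by linarith
        positivity
    have : 0 < b - a := by linarith
    rw [intervalIntegral.integral_const, smul_eq_mul] at h3
    have e : (b - a) * (ε / (4 * (b - a))) = ε / 4 := by field_simp
    linarith
  have hgL : MemLp g 2 (volume.restrict (Ioc a b)) := memLp_of_continuous hg2.continuousOn
  have := integral_sq_le_of_eq_add hab.le (hu.sub hgL) (hgL.sub (memLp_poly a b p))
    (u := fun x => u x - p.eval x) (fun x _ => by simp)
  simp only [Pi.sub_apply] at this
  linarith

lemma exists_antiderivative {n : ℕ} {q : ℝ[X]} (hq : q ∈ degreeLT ℝ n) (a c : ℝ) :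
    ∃ Q ∈ degreeLT ℝ (n + 1), derivative Q = q ∧ Q.eval a = c := by
  obtain ⟨Q, hQ, hQ'⟩ : ∃ Q ∈ degreeLT ℝ (n + 1), derivative Q = q := by
    refine ⟨∑ i ∈ Finset.range n, C (q.coeff i / (i + 1)) * X ^ (i + 1),
      Submodule.sum_mem _ fun i hi => ?_, ?_⟩
    · rw [mem_degreeLT]
      refine (degree_C_mul_X_pow_le _ _).trans_lt ?_
      exact_mod_cast Nat.succ_lt_succ (Finset.mem_range.1 hi)
    · ext j
      rw [derivative_sum, finsetSum_coeff]
      have : ∀ i, (derivative (C (q.coeff i / ((i : ℝ) + 1)) * X ^ (i + 1))).coeff j =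
          if i = j then q.coeff i else 0 := by
        intro i
        have h0 : (i : ℝ) + 1 ≠ 0 := by positivity
        rw [derivative_C_mul_X_pow, coeff_C_mul_X_pow]
        simp only [Nat.add_sub_cancel, eq_comm (a := j)]
        split_ifs
        · push_cast; field_simp
        · rfl
      rw [Finset.sum_congr rfl fun i _ => this i, Finset.sum_ite_eq']
      split_ifs with h
      · rfl
      · exact (coeff_of_mem_degreeLT hq (by simpa using h)).symm
  refine ⟨Q + C (c - Q.eval a), Submodule.add_mem _ hQ ?_, by simp [hQ'], by simp⟩
  rw [mem_degreeLT]
  exact degree_C_le.trans_lt (by exact_mod_cast Nat.succ_pos n)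

lemma eval_eq_add_integral (Q : ℝ[X]) (a x : ℝ) :
    Q.eval x = Q.eval a + ∫ t in a..x, (derivative Q).eval t := by
  rw [← polyInt_apply, polyInt_derivative]; ring

/-- Direct estimate: a function with derivative `g` in `L²(a, b)` is approximated by polynomials of
degree less than `n` with the rate `(b - a) / n`. -/
lemma exists_poly_approx {a b : ℝ} (hab : a < b) {n : ℕ} (hn : 1 ≤ n) {g : ℝ → ℝ}
    (hg : MemLp g 2 (volume.restrict (Ioc a b))) (c : ℝ) :
    ∃ p ∈ degreeLT ℝ n, ∫ x in a..b, (c + (∫ t in a..x, g t) - p.eval x) ^ 2 ≤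
      4 * ((b - a) / n) ^ 2 * ∫ x in a..b, g x ^ 2 := by
  have hgi := intervalIntegrable_of_memLp hab.le hg
  have hh : 0 < b - a := by linarith
  have hn0 : (0 : ℝ) < n := by exact_mod_cast hn
  -- When g vanishes in L², the tolerance chosen below would be 0, so density does not apply; the
  -- function is then the constant c.
  rcases (integral_sq_nonneg hab.le g).eq_or_lt with h0 | h0
  · refine ⟨C c, by
      rw [mem_degreeLT]
      exact degree_C_le.trans_lt (by exact_mod_cast hn), ?_⟩
    rw [← h0, mul_zero]
    have h1 : ∫ x in a..b, (c + (∫ t in a..x, g t) - (C c).eval x) ^ 2 ≤ ∫ _ in a..b, (0 : ℝ) := by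
      refine intervalIntegral.integral_mono_on hab.le (ContinuousOn.intervalIntegrable ?_)
        (continuous_const.intervalIntegrable _ _) fun x hx => ?_
      · rw [uIcc_of_le hab.le]
        exact ((continuousOn_primitive_add hab.le hgi c).sub (C c).continuous.continuousOn).pow 2
      · have := sq_primitive_le hg hx
        rw [← h0, mul_zero] at this
        simpa using this
    simpa using h1
  · set G := ∫ x in a..b, g x ^ 2 with hG
    have hn1 : (1 : ℝ) ≤ n := by exact_mod_cast hn
    -- The tolerance G/n² is small enough that passing from g to the polynomial q costs no more than
    -- the rate being proved, and that the squared norm of q is at most 4G.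
    obtain ⟨q, hq⟩ := exists_poly_integral_sq_le hab hg (ε := G / (n : ℝ) ^ 2) (by positivity)
    have hgq : MemLp (fun x => g x - q.eval x) 2 (volume.restrict (Ioc a b)) :=
      hg.sub (memLp_poly a b q)
    obtain ⟨Q, -, hQ, hQa⟩ := exists_antiderivative (n := q.natDegree + 1) (q := q) (by
      rw [mem_degreeLT]
      exact lt_of_le_of_lt degree_le_natDegree (by exact_mod_cast Nat.lt_succ_self _)) a c
    obtain ⟨p, hp, hp'⟩ := exists_poly_approx_poly hab n Q
    refine ⟨p, hp, ?_⟩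
    have hzQ : ∀ x ∈ Icc a b, c + (∫ t in a..x, g t) - Q.eval x = ∫ t in a..x, (g t - q.eval t) := by
      intro x hx
      rw [eval_eq_add_integral Q a x, hQ, hQa, intervalIntegral.integral_sub
        (hgi.mono_set (by rw [uIcc_of_le hx.1, uIcc_of_le hab.le]; exact Icc_subset_Icc_right hx.2))
        (q.continuous.intervalIntegrable _ _)]
      ring
    have hcont : ContinuousOn (fun x => c + (∫ t in a..x, g t) - Q.eval x) (Icc a b) :=
      (continuousOn_primitive_add hab.le hgi c).sub Q.continuous.continuousOn
    have h1 : ∫ x in a..b, (c + (∫ t in a..x, g t) - Q.eval x) ^ 2 ≤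
        (b - a) ^ 2 * (G / (n : ℝ) ^ 2) := by
      have : ∫ x in a..b, (c + (∫ t in a..x, g t) - Q.eval x) ^ 2 ≤
          ∫ _ in a..b, (b - a) * (G / (n : ℝ) ^ 2) := by
        refine intervalIntegral.integral_mono_on hab.le (ContinuousOn.intervalIntegrable ?_)
          (continuous_const.intervalIntegrable _ _) fun x hx => ?_
        · rw [uIcc_of_le hab.le]; exact hcont.pow 2
        · rw [hzQ x hx]
          exact (sq_primitive_le hgq hx).trans (by gcongr)
      rw [intervalIntegral.integral_const, smul_eq_mul] at this
      linarith [(by ring : (b - a) * ((b - a) * (G / (n : ℝ) ^ 2)) = (b - a) ^ 2 * (G / (n : ℝ) ^ 2))]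
    have h2 : ∫ x in a..b, q.eval x ^ 2 ≤ 4 * G := by
      have := integral_sq_le_of_eq_add hab.le hg hgq.neg (u := fun x => q.eval x)
        (fun x _ => by simp)
      have e : ∫ x in a..b, ((-fun x => g x - q.eval x) x) ^ 2 =
          ∫ x in a..b, (g x - q.eval x) ^ 2 := by
        congr 1; ext x; simp only [Pi.neg_apply]; ring
      rw [e] at this
      have : G / (n : ℝ) ^ 2 ≤ G := div_le_self h0.le (one_le_pow₀ hn1)
      linarith
    have h3 : ∫ x in a..b, (Q.eval x - p.eval x) ^ 2 ≤ ((b - a) / n) ^ 2 * G := by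
      have e1 : polyInt a b ((Q - p) * (Q - p)) = ∫ x in a..b, (Q.eval x - p.eval x) ^ 2 := by
        rw [polyInt_apply]; congr 1; ext x; simp; ring
      have e2 : polyInt a b (derivative Q * derivative Q) = ∫ x in a..b, q.eval x ^ 2 := by
        rw [polyInt_apply, hQ]; congr 1; ext x; simp; ring
      rw [e1, e2] at hp'
      rw [div_pow, div_mul_eq_mul_div, le_div_iff₀ (by positivity), mul_comm]
      calc _ ≤ _ := hp'
        _ ≤ (b - a) ^ 2 / 4 * (4 * G) := by gcongr
        _ = _ := by ring
    have h4 := integral_sq_le_of_eq_add hab.le (memLp_of_continuous hcont)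
      ((memLp_poly a b Q).sub (memLp_poly a b p))
      (u := fun x => c + (∫ t in a..x, g t) - p.eval x) (fun x _ => by simp)
    simp only [Pi.sub_apply] at h4
    have e3 : (b - a) ^ 2 * (G / (n : ℝ) ^ 2) = ((b - a) / n) ^ 2 * G := by rw [div_pow]; ring
    linarith

/-- Integration by parts for two primitives vanishing at the left end, the first one also at
the right end. -/
lemma integral_primitive_mul {a b : ℝ} {e f : ℝ → ℝ}
    (he : IntervalIntegrable e volume a b) (hf : IntervalIntegrable f volume a b)
    (h0 : ∫ t in a..b, e t = 0) :
    ∫ x in a..b, (∫ t in a..x, e t) * f x = -∫ x in a..b, e x * ∫ t in a..x, f t := by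
  have hE := he.absolutelyContinuousOnInterval_intervalIntegral (c := a) left_mem_uIcc
  have hF := hf.absolutelyContinuousOnInterval_intervalIntegral (c := a) left_mem_uIcc
  have h := hE.integral_mul_deriv_eq_deriv_mul hF
  have h1 : ∫ x in a..b, (∫ t in a..x, e t) * deriv (fun x => ∫ t in a..x, f t) x =
      ∫ x in a..b, (∫ t in a..x, e t) * f x := by
    refine intervalIntegral.integral_congr_ae ?_
    filter_upwards [hf.ae_hasDerivAt_integral] with x hx hx'
    rw [(hx (uIoc_subset_uIcc hx') a left_mem_uIcc).deriv]
  have h2 : ∫ x in a..b, deriv (fun x => ∫ t in a..x, e t) x * (∫ t in a..x, f t) =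
      ∫ x in a..b, e x * ∫ t in a..x, f t := by
    refine intervalIntegral.integral_congr_ae ?_
    filter_upwards [he.ae_hasDerivAt_integral] with x hx hx'
    rw [(hx (uIoc_subset_uIcc hx') a left_mem_uIcc).deriv]
  rw [h1, h2, h0] at h
  simpa using h

/-- Duality estimate: if `e` is orthogonal to polynomials of degree less than `n ≥ 1`, its primitive
gains a factor `(b - a) / n`. -/
lemma integral_sq_primitive_le_of_orthogonal {a b : ℝ} (hab : a < b) {n : ℕ} (hn : 1 ≤ n)
    {e : ℝ → ℝ} (he : MemLp e 2 (volume.restrict (Ioc a b)))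
    (ho : ∀ p ∈ degreeLT ℝ n, ∫ x in a..b, e x * p.eval x = 0) :
    ∫ x in a..b, (∫ t in a..x, e t) ^ 2 ≤ 4 * ((b - a) / n) ^ 2 * ∫ x in a..b, e x ^ 2 := by
  have hei := intervalIntegrable_of_memLp hab.le he
  have h0 : ∫ t in a..b, e t = 0 := by
    simpa using ho 1 (by rw [mem_degreeLT, degree_one]; exact_mod_cast hn)
  have hEc : ContinuousOn (fun x => ∫ t in a..x, e t) (Icc a b) := by
    simpa using continuousOn_primitive_add hab.le hei 0
  have hE : MemLp (fun x => ∫ t in a..x, e t) 2 (volume.restrict (Ioc a b)) :=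
    memLp_of_continuous hEc
  have hEi := intervalIntegrable_of_memLp hab.le hE
  set A := ∫ x in a..b, (∫ t in a..x, e t) ^ 2 with hA
  set B := ∫ x in a..b, e x ^ 2
  obtain ⟨p, hp, hp'⟩ := exists_poly_approx hab hn hE 0
  have hPhi : MemLp (fun x => 0 + (∫ t in a..x, ∫ s in a..t, e s) - p.eval x) 2
      (volume.restrict (Ioc a b)) :=
    memLp_of_continuous ((continuousOn_primitive_add hab.le hEi 0).sub p.continuous.continuousOn)
  -- Write E for the primitive of e, and Φ for the primitive of E. Then the squared norm A of E is
  -- minus the integral of eΦ, and a polynomial may be subtracted from Φ by orthogonality. The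
  -- approximation error of Φ is controlled by A itself, so one factor A cancels in the end.
  have h1 : A = -∫ x in a..b, e x * (0 + (∫ t in a..x, ∫ s in a..t, e s) - p.eval x) := by
    have h2 := integral_primitive_mul hei hEi h0
    have h3 : ∫ x in a..b, e x * (0 + (∫ t in a..x, ∫ s in a..t, e s) - p.eval x) =
        (∫ x in a..b, e x * ∫ t in a..x, ∫ s in a..t, e s) - ∫ x in a..b, e x * p.eval x := by
      rw [← intervalIntegral.integral_sub _ (intervalIntegrable_mul_eval hei p)]
      · congr 1; ext x; ring
      · refine hei.mul_continuousOn ?_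
        rw [uIcc_of_le hab.le]
        simpa using continuousOn_primitive_add hab.le hEi 0
    rw [h3, ho p hp, sub_zero, ← h2, hA]
    congr 1; ext x; ring
  have h4 := sq_intervalIntegral_mul_le hab.le he hPhi
  rw [← neg_sq, ← h1] at h4
  have hB : 0 ≤ B := integral_sq_nonneg hab.le e
  have hA0 : 0 ≤ A := integral_sq_nonneg hab.le _
  have h5 : A * A ≤ (4 * ((b - a) / n) ^ 2 * B) * A :=
    calc A * A = A ^ 2 := by ring
      _ ≤ B * (4 * ((b - a) / n) ^ 2 * A) := h4.trans (mul_le_mul_of_nonneg_left hp' hB)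
      _ = _ := by ring
  rcases hA0.eq_or_lt with h | h
  · rw [← h]; positivity
  · exact le_of_mul_le_mul_right h5 h

/-- `u` is approximated by polynomials of degree less than `n` in `L²(a, b)` with squared
error `ε`. -/
def PolyApprox (a b : ℝ) (n : ℕ) (u : ℝ → ℝ) (ε : ℝ) : Prop :=
  ∃ p ∈ degreeLT ℝ n, ∫ x in a..b, (u x - p.eval x) ^ 2 ≤ ε

lemma PolyApprox.mono {a b : ℝ} {n : ℕ} {u : ℝ → ℝ} {ε δ : ℝ} (h : PolyApprox a b n u ε)
    (hε : ε ≤ δ) : PolyApprox a b n u δ :=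
  let ⟨p, hp, hp'⟩ := h; ⟨p, hp, hp'.trans hε⟩

lemma PolyApprox.zero (a b : ℝ) (n : ℕ) (u : ℝ → ℝ) :
    PolyApprox a b n u (∫ x in a..b, u x ^ 2) :=
  ⟨0, Submodule.zero_mem _, by simp⟩

lemma integral_congr_ae_Ioc {a b : ℝ} (hab : a ≤ b) {u v : ℝ → ℝ} (F : ℝ → ℝ → ℝ)
    (h : u =ᵐ[volume.restrict (Ioc a b)] v) :
    ∫ x in a..b, F x (u x) = ∫ x in a..b, F x (v x) := by
  rw [intervalIntegral.integral_of_le hab, intervalIntegral.integral_of_le hab]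
  refine integral_congr_ae ?_
  filter_upwards [h] with x hx
  rw [hx]

lemma PolyApprox.congr {a b : ℝ} (hab : a ≤ b) {n : ℕ} {u v : ℝ → ℝ} {ε : ℝ}
    (h : PolyApprox a b n u ε) (huv : u =ᵐ[volume.restrict (Ioc a b)] v) :
    PolyApprox a b n v ε := by
  obtain ⟨p, hp, hp'⟩ := h
  exact ⟨p, hp, by rwa [← integral_congr_ae_Ioc hab (fun x y => (y - p.eval x) ^ 2) huv]⟩

lemma PolyApprox.sub {a b : ℝ} (hab : a ≤ b) {n : ℕ} {u v : ℝ → ℝ} {ε δ : ℝ}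
    (hu : MemLp u 2 (volume.restrict (Ioc a b))) (hv : MemLp v 2 (volume.restrict (Ioc a b)))
    (h : PolyApprox a b n u ε) (h' : PolyApprox a b n v δ) :
    PolyApprox a b n (fun x => u x - v x) (2 * ε + 2 * δ) := by
  obtain ⟨p, hp, hp'⟩ := h
  obtain ⟨q, hq, hq'⟩ := h'
  refine ⟨p - q, Submodule.sub_mem _ hp hq, ?_⟩
  have := integral_sq_le_of_eq_add hab (hu.sub (memLp_poly a b p))
    ((hv.sub (memLp_poly a b q)).neg) (u := fun x => u x - v x - (p - q).eval x)
    (fun x _ => by simp; ring)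
  simp only [Pi.sub_apply, Pi.neg_apply, neg_sq] at this
  linarith

/-- One integration: `u` is a primitive of `v`. -/
lemma PolyApprox.primitive {a b : ℝ} (hab : a < b) {n : ℕ} {u v : ℝ → ℝ} {ε c : ℝ}
    (hv : MemLp v 2 (volume.restrict (Ioc a b)))
    (huv : u =ᵐ[volume.restrict (Ioc a b)] fun x => c + ∫ t in a..x, v t)
    (h : PolyApprox a b n v ε) :
    PolyApprox a b (n + 1) u (4 * ((b - a) / (n + 1)) ^ 2 * ε) := by
  obtain ⟨q, hq, hq'⟩ := h
  obtain ⟨Q, hQ, hQd, hQa⟩ := exists_antiderivative hq a c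
  -- With Q the antiderivative of the approximant of v satisfying Q(a) = c, the remainder u - Q is a
  -- primitive of v - q and is approximated once more.
  obtain ⟨p, hp, hp'⟩ := exists_poly_approx hab (n := n + 1) (by omega)
    (hv.sub (memLp_poly a b q)) 0
  have hvi := intervalIntegrable_of_memLp hab.le hv
  refine PolyApprox.congr hab.le ⟨Q + p, Submodule.add_mem _ hQ hp, ?_⟩ huv.symm
  refine le_trans (le_of_eq ?_) (hp'.trans ?_)
  · rw [intervalIntegral.integral_of_le hab.le, intervalIntegral.integral_of_le hab.le]
    refine setIntegral_congr_fun measurableSet_Ioc fun x hx => ?_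
    simp only [eval_add, Pi.sub_apply]
    rw [eval_eq_add_integral Q a x, hQd, hQa, intervalIntegral.integral_sub
        (hvi.mono_set (by
          rw [uIcc_of_le hx.1.le, uIcc_of_le hab.le]; exact Icc_subset_Icc_right hx.2))
        (q.continuous.intervalIntegrable _ _)]
    ring
  · push_cast
    exact mul_le_mul_of_nonneg_left hq' (by positivity)

/-- Repeated integration, along `g 0, g 1, …, g K` where each function is a primitive of
the next one. -/
lemma PolyApprox.iterate {a b : ℝ} (hab : a < b) {n : ℕ} {ε κ : ℝ} (hκ : 0 < κ) (hκn : κ ≤ n + 1)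
    (K : ℕ) : ∀ g : ℕ → ℝ → ℝ, (∀ j ≤ K, MemLp (g j) 2 (volume.restrict (Ioc a b))) →
      (∀ j < K, ∃ c, g j =ᵐ[volume.restrict (Ioc a b)] fun x => c + ∫ t in a..x, g (j + 1) t) →
      PolyApprox a b n (g K) ε →
      PolyApprox a b (n + K) (g 0) ((2 * (b - a) / κ) ^ (2 * K) * ε) := by
  induction K with
  | zero => intro g _ _ h; simpa using h
  | succ K ih =>
    intro g hg hgp h
    have h1 := ih (fun j => g (j + 1)) (fun j hj => hg _ (by omega)) (fun j hj => hgp _ (by omega)) h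
    obtain ⟨c, hc⟩ := hgp 0 (by omega)
    have h2 := PolyApprox.primitive hab (hg 1 (by omega)) hc h1
    refine h2.mono ?_
    have hε : 0 ≤ ε := by
      obtain ⟨p, -, hp⟩ := h
      exact (integral_sq_nonneg hab.le (fun x => g (K + 1) x - p.eval x)).trans hp
    have hh : 0 < b - a := by linarith
    -- The degree grows at every integration, so κ ≤ n + 1 bounds all the denominators from below
    -- and each integration costs at most the same factor.
    have h3 : 4 * ((b - a) / (((n + K : ℕ) : ℝ) + 1)) ^ 2 ≤ (2 * (b - a) / κ) ^ 2 := by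
      have : (b - a) / (((n + K : ℕ) : ℝ) + 1) ≤ (b - a) / κ := by
        refine div_le_div_of_nonneg_left hh.le hκ (hκn.trans ?_)
        push_cast; linarith [K.cast_nonneg (α := ℝ)]
      calc 4 * ((b - a) / (((n + K : ℕ) : ℝ) + 1)) ^ 2 ≤ 4 * ((b - a) / κ) ^ 2 := by gcongr
        _ = _ := by ring
    calc _ ≤ (2 * (b - a) / κ) ^ 2 * ((2 * (b - a) / κ) ^ (2 * K) * ε) := by
          refine mul_le_mul_of_nonneg_right h3 ?_
          positivity
      _ = _ := by rw [show 2 * (K + 1) = 2 + 2 * K by ring, pow_add]; ring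

/-- The orthogonal projection is a best approximation. -/
lemma PolyApprox.integral_sq_le_of_orthogonal {a b : ℝ} (hab : a ≤ b) {n : ℕ} {u : ℝ → ℝ}
    (hu : MemLp u 2 (volume.restrict (Ioc a b))) {ε : ℝ} (h : PolyApprox a b n u ε) {q : ℝ[X]}
    (hq : q ∈ degreeLT ℝ n)
    (ho : ∀ p ∈ degreeLT ℝ n, ∫ x in a..b, (u x - q.eval x) * p.eval x = 0) :
    ∫ x in a..b, (u x - q.eval x) ^ 2 ≤ ε := by
  obtain ⟨p, hp, hp'⟩ := h
  have huq : MemLp (fun x => u x - q.eval x) 2 (volume.restrict (Ioc a b)) :=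
    hu.sub (memLp_poly a b q)
  have h1 : ∫ x in a..b, (u x - p.eval x) ^ 2 = (∫ x in a..b, (u x - q.eval x) ^ 2) +
      2 * (∫ x in a..b, (u x - q.eval x) * (q - p).eval x) +
      ∫ x in a..b, ((q - p).eval x) ^ 2 := by
    rw [← intervalIntegral.integral_const_mul, ← intervalIntegral.integral_add
      (intervalIntegrable_sq hab huq) ((intervalIntegrable_mul hab huq (memLp_poly a b _)).const_mul _),
      ← intervalIntegral.integral_add ((intervalIntegrable_sq hab huq).add
        ((intervalIntegrable_mul hab huq (memLp_poly a b _)).const_mul _))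
        (intervalIntegrable_sq hab (memLp_poly a b _))]
    congr 1; ext x; simp; ring
  rw [ho _ (Submodule.sub_mem _ hq hp)] at h1
  have := integral_sq_nonneg hab (fun x => (q - p).eval x)
  linarith

/-! ### Mollification inside an interval -/

/-- A mollifier supported in `(0, 1)`. -/
lemma exists_mollifier : ∃ κ : ℝ → ℝ, ContDiff ℝ 1 κ ∧ (∀ x ≤ 0, κ x = 0) ∧ (∀ x, 1 ≤ x → κ x = 0) ∧
    ∫ x in (0 : ℝ)..1, κ x = 1 := by
  let f : ContDiffBump (1 / 2 : ℝ) := ⟨1 / 4, 1 / 2, by norm_num, by norm_num⟩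
  have hs : Function.support (f.normed volume) = Ioo 0 1 := by
    rw [f.support_normed_eq, Real.ball_eq_Ioo]; norm_num [f]
  have h0 : ∀ x, x ∉ Ioo (0 : ℝ) 1 → f.normed volume x = 0 := fun x hx => by
    rwa [← hs, Function.notMem_support] at hx
  refine ⟨f.normed volume, f.contDiff_normed, fun x hx => h0 x fun h => by linarith [h.1],
    fun x hx => h0 x fun h => by linarith [h.2], ?_⟩
  rw [intervalIntegral.integral_eq_integral_of_support_subset (hs ▸ Ioo_subset_Ioc_self)]
  exact f.integral_normed

/-- Change of variables for functions supported in `[0, 1]`. -/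
lemma integral_comp_scaled {f : ℝ → ℝ} (hf : Continuous f) (h0 : ∀ x ≤ 0, f x = 0)
    (h1 : ∀ x, 1 ≤ x → f x = 0) {a b δ c : ℝ} (hδ : 0 < δ) (ha : a ≤ c) (hb : c + δ ≤ b) :
    ∫ y in a..b, f ((y - c) / δ) = δ * ∫ u in (0 : ℝ)..1, f u := by
  have e : ∀ y, (y - c) / δ = y / δ - c / δ := fun y => sub_div _ _ _
  simp only [e]
  rw [intervalIntegral.integral_comp_div_sub f hδ.ne', smul_eq_mul]
  congr 1
  have i : ∀ u v, IntervalIntegrable f volume u v := fun u v => hf.intervalIntegrable u v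
  rw [← intervalIntegral.integral_add_adjacent_intervals (i (a / δ - c / δ) 0) (i 0 _),
    ← intervalIntegral.integral_add_adjacent_intervals (i 0 1) (i 1 _)]
  have z1 : ∫ x in (a / δ - c / δ)..0, f x = 0 := by
    have : a / δ - c / δ ≤ 0 := by rw [← sub_div]; exact div_nonpos_of_nonpos_of_nonneg (by linarith) hδ.le
    refine intervalIntegral.integral_zero_ae (Filter.Eventually.of_forall fun x hx => h0 x ?_)
    rw [uIoc_of_le this] at hx; exact hx.2
  have z2 : ∫ x in (1 : ℝ)..(b / δ - c / δ), f x = 0 := by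
    have : 1 ≤ b / δ - c / δ := by rw [← sub_div, le_div_iff₀ hδ]; linarith
    refine intervalIntegral.integral_zero_ae (Filter.Eventually.of_forall fun x hx => h1 x ?_)
    rw [uIoc_of_le this] at hx; exact hx.1.le
  rw [z1, z2]; ring

/-- The (unscaled, squared) averaged `L²` modulus of continuity on `(a, b)`. -/
def modulus (a b δ : ℝ) (w : ℝ → ℝ) : ℝ :=
  ∫ z in {z : ℝ × ℝ | |z.1 - z.2| ≤ δ}, (w z.1 - w z.2) ^ 2
    ∂((volume.restrict (Ioc a b)).prod (volume.restrict (Ioc a b)))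

lemma measurableSet_strip (δ : ℝ) : MeasurableSet {z : ℝ × ℝ | |z.1 - z.2| ≤ δ} :=
  measurableSet_le (by fun_prop) (by fun_prop)

lemma memLp_sub_prod {a b : ℝ} {w : ℝ → ℝ} (hw : MemLp w 2 (volume.restrict (Ioc a b))) :
    MemLp (fun z : ℝ × ℝ => w z.1 - w z.2) 2
      ((volume.restrict (Ioc a b)).prod (volume.restrict (Ioc a b))) :=
  (hw.comp_fst _).sub (hw.comp_snd _)

/-- Mollify w at scale δ = (b - a)/n to a C¹ function w2. Both the squared norm of w - w2 and δ²
times that of w2' are at most a constant times the modulus divided by δ; the rate δ for one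
derivative then applies to w2. -/
lemma exists_mollified_approx : ∃ C : ℝ, 0 < C ∧ ∀ (a b : ℝ) (n : ℕ) (w : ℝ → ℝ), a < b → 1 ≤ n →
    MemLp w 2 (volume.restrict (Ioc a b)) →
      PolyApprox a b n w (C / ((b - a) / n) * modulus a b ((b - a) / n) w) := by
  obtain ⟨κ, hκ, hκ0, hκ1, hκi⟩ := exists_mollifier
  have hκc : Continuous κ := hκ.continuous
  have hκd : ∀ x, HasDerivAt κ (deriv κ x) x := fun x =>
    (hκ.differentiable one_ne_zero x).hasDerivAt
  have hκ'c : Continuous (deriv κ) := hκ.continuous_deriv le_rfl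
  have hd0 : ∀ x ≤ 0, deriv κ x = 0 := by
    have h : EqOn (deriv κ) 0 (Iio 0) := fun x hx => by
      have : κ =ᶠ[nhds x] fun _ => 0 := by
        filter_upwards [Iio_mem_nhds hx] with y hy using hκ0 y (le_of_lt hy)
      rw [this.deriv_eq]; simp
    have h2 := h.closure hκ'c continuous_const
    rw [closure_Iio] at h2
    exact fun x hx => h2 hx
  have hd1 : ∀ x, 1 ≤ x → deriv κ x = 0 := by
    have h : EqOn (deriv κ) 0 (Ioi 1) := fun x hx => by
      have : κ =ᶠ[nhds x] fun _ => 0 := by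
        filter_upwards [Ioi_mem_nhds hx] with y hy using hκ1 y (le_of_lt hy)
      rw [this.deriv_eq]; simp
    have h2 := h.closure hκ'c continuous_const
    rw [closure_Ioi] at h2
    exact fun x hx => h2 hx
  obtain ⟨B, hB⟩ : ∃ B, ∀ x, |deriv κ x| ≤ B := by
    obtain ⟨B, hB⟩ := isCompact_Icc.exists_bound_of_continuousOn (s := Icc (0 : ℝ) 1)
      hκ'c.continuousOn
    refine ⟨max B 0, fun x => ?_⟩
    by_cases hx : x ∈ Icc (0 : ℝ) 1
    · exact (hB x hx).trans (le_max_left _ _)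
    · have : deriv κ x = 0 := by
        rcases le_total x 0 with h | h
        · exact hd0 x h
        · exact hd1 x (by by_contra h'; exact hx ⟨h, by linarith⟩)
      rw [this, abs_zero]; exact le_max_right _ _
  set B0 := ∫ u in (0 : ℝ)..1, κ u ^ 2
  set B1 := ∫ u in (0 : ℝ)..1, deriv κ u ^ 2
  have hB0 : 0 ≤ B0 := integral_sq_nonneg zero_le_one _
  have hB1 : 0 ≤ B1 := integral_sq_nonneg zero_le_one _
  -- Here 2B0 comes from w - w2 and 8B1 = 2·4·B1 from the polynomial approximation of w2; the
  -- summand 1 only ensures positivity.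
  refine ⟨2 * B0 + 8 * B1 + 1, by positivity, fun a b n w hab hn hw => ?_⟩
  have hn0 : (0 : ℝ) < n := by exact_mod_cast hn
  have hn1 : (1 : ℝ) ≤ n := by exact_mod_cast hn
  have hh : 0 < b - a := by linarith
  set δ := (b - a) / n with hδ
  have hδ0 : 0 < δ := by positivity
  have hδh : n * δ = b - a := by rw [hδ]; field_simp
  set lam : ℝ := 1 - 1 / n with hlam
  have hlam0 : 0 ≤ lam := by
    rw [hlam, sub_nonneg, div_le_one hn0]; exact hn1
  have hlam1 : lam ≤ 1 := by
    have : (0 : ℝ) ≤ 1 / n := by positivity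
    linarith
  -- The contraction φ maps [a, b] onto [a, b - δ], so the window [φ(x), φ(x) + δ] stays inside [a,
  -- b] and contains x. Averages over these windows need no extension of w beyond the interval.
  set φ : ℝ → ℝ := fun x => a + lam * (x - a) with hφ
  have hφa : ∀ x ∈ Icc a b, a ≤ φ x := fun x hx =>
    le_add_of_nonneg_right (mul_nonneg hlam0 (by linarith [hx.1]))
  have hφx : ∀ x, x - φ x = (x - a) / n := fun x => by simp only [hφ, hlam]; ring
  have hlamδ : lam * (b - a) = b - a - δ := by rw [hlam, hδ]; ring
  have hφb : ∀ x ∈ Icc a b, φ x + δ ≤ b := fun x hx => by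
    have : lam * (x - a) ≤ lam * (b - a) :=
      mul_le_mul_of_nonneg_left (by linarith [hx.2]) hlam0
    simp only [hφ]; linarith
  have hφ1 : ∀ x ∈ Icc a b, φ x ≤ x := fun x hx => by
    have : 0 ≤ (x - a) / n := div_nonneg (by linarith [hx.1]) hn0.le
    linarith [hφx x]
  have hφ2 : ∀ x ∈ Icc a b, x ≤ φ x + δ := fun x hx => by
    have : (x - a) / n ≤ δ := by rw [hδ]; gcongr; exact hx.2
    linarith [hφx x]
  have hsupp : ∀ x ∈ Icc a b, ∀ y, ¬ |x - y| ≤ δ → (y - φ x) / δ ≤ 0 ∨ 1 ≤ (y - φ x) / δ := by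
    intro x hx y hxy
    rcases le_or_gt y (φ x) with h | h
    · left; exact div_nonpos_of_nonpos_of_nonneg (by linarith) hδ0.le
    rcases le_or_gt (φ x + δ) y with h' | h'
    · right; rw [le_div_iff₀ hδ0]; linarith
    · exact absurd (abs_le.2 ⟨by linarith [hφ1 x hx], by linarith [hφ2 x hx]⟩) hxy
  have hwi := intervalIntegrable_of_memLp hab.le hw
  -- Differences are cut off to the strip |x - y| ≤ δ, the only part that the kernel sees; S(x) is
  -- then the slice of the modulus at x.
  set m : ℝ → ℝ → ℝ := fun x y => if |x - y| ≤ δ then w x - w y else 0 with hm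
  have hmL : ∀ x, MemLp (m x) 2 (volume.restrict (Ioc a b)) := fun x => by
    have h1 : MemLp (fun y => w x - w y) 2 (volume.restrict (Ioc a b)) :=
      (memLp_const (w x)).sub hw
    have h2 : m x = {y | |x - y| ≤ δ}.indicator (fun y => w x - w y) := by
      ext y; simp [hm, indicator_apply]
    rw [h2]
    exact h1.indicator (measurableSet_le (by fun_prop) (by fun_prop))
  set S : ℝ → ℝ := fun x => ∫ y in a..b, m x y ^ 2 with hS
  have hindic : ∀ z : ℝ × ℝ, {z : ℝ × ℝ | |z.1 - z.2| ≤ δ}.indicator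
      (fun z => (w z.1 - w z.2) ^ 2) z = m z.1 z.2 ^ 2 := fun z => by
    by_cases h : |z.1 - z.2| ≤ δ <;> simp [hm, h]
  have hprod : Integrable (fun z : ℝ × ℝ => m z.1 z.2 ^ 2)
      ((volume.restrict (Ioc a b)).prod (volume.restrict (Ioc a b))) :=
    ((memLp_sub_prod hw).integrable_sq.indicator (measurableSet_strip δ)).congr
      (Filter.Eventually.of_forall hindic)
  have hSi : IntervalIntegrable S volume a b := by
    rw [intervalIntegrable_iff_integrableOn_Ioc_of_le hab.le]
    refine hprod.integral_prod_left.congr (Filter.Eventually.of_forall fun x => ?_)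
    simp only [hS, intervalIntegral.integral_of_le hab.le]
  have hmod : modulus a b δ w = ∫ x in a..b, S x := by
    rw [modulus, ← integral_indicator (measurableSet_strip δ),
      integral_congr_ae (Filter.Eventually.of_forall hindic), integral_prod _ hprod]
    simp only [hS, intervalIntegral.integral_of_le hab.le]
  -- the mollified function and its derivative
  set w2 : ℝ → ℝ := fun x => ∫ y in a..b, κ ((y - φ x) / δ) / δ * w y with hw2
  set g : ℝ → ℝ := fun x => ∫ y in a..b, -(lam / δ ^ 2) * deriv κ ((y - φ x) / δ) * w y with hg
  have hkm : ∀ f : ℝ → ℝ, Continuous f → ∀ x, Continuous fun y => f ((y - φ x) / δ) :=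
    fun f hf x => hf.comp (by fun_prop)
  have hder : ∀ x, HasDerivAt w2 (g x) x := by
    intro x
    refine (intervalIntegral.hasDerivAt_integral_of_dominated_loc_of_deriv_le (μ := volume)
      (F := fun x y => κ ((y - φ x) / δ) / δ * w y)
      (F' := fun x y => -(lam / δ ^ 2) * deriv κ ((y - φ x) / δ) * w y)
      (bound := fun y => lam / δ ^ 2 * B * |w y|) (Filter.univ_mem) ?_ ?_ ?_ ?_ ?_ ?_).2
    · refine Filter.Eventually.of_forall fun x => ?_
      exact (((hkm κ hκc x).div_const δ).aestronglyMeasurable).mul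
        (by rw [uIoc_of_le hab.le]; exact hw.1)
    · exact hwi.continuousOn_mul ((hkm κ hκc x).div_const δ).continuousOn
    · exact ((continuous_const.mul (hkm _ hκ'c x)).aestronglyMeasurable).mul
        (by rw [uIoc_of_le hab.le]; exact hw.1)
    · refine Filter.Eventually.of_forall fun y _ x _ => ?_
      rw [norm_mul, norm_mul, Real.norm_eq_abs, Real.norm_eq_abs, Real.norm_eq_abs, abs_neg,
        abs_of_nonneg (by positivity : 0 ≤ lam / δ ^ 2)]
      gcongr
      exact hB _
    · exact (hwi.norm.const_mul _)
    · refine Filter.Eventually.of_forall fun y _ x _ => ?_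
      have h1 : HasDerivAt (fun x => (y - φ x) / δ) (-lam / δ) x := by
        have := ((((hasDerivAt_id x).sub_const a).const_mul lam).const_add a).const_sub y
        convert! this.div_const δ using 1
        simp
      have h2 := (((hκd _).comp x h1).div_const δ).mul_const (w y)
      convert! h2 using 1
      field_simp
  have hgc : Continuous g := by
    refine intervalIntegral.continuous_of_dominated_interval
      (bound := fun y => lam / δ ^ 2 * B * |w y|) ?_ ?_ ?_ ?_
    · intro x
      exact ((continuous_const.mul (hkm _ hκ'c x)).aestronglyMeasurable).mul
        (by rw [uIoc_of_le hab.le]; exact hw.1)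
    · refine fun x => Filter.Eventually.of_forall fun y _ => ?_
      rw [norm_mul, norm_mul, Real.norm_eq_abs, Real.norm_eq_abs, Real.norm_eq_abs, abs_neg,
        abs_of_nonneg (by positivity : 0 ≤ lam / δ ^ 2)]
      gcongr
      exact hB _
    · exact (hwi.norm.const_mul _)
    · refine Filter.Eventually.of_forall fun y _ => ?_
      have : Continuous fun x => (y - φ x) / δ := by fun_prop
      exact (continuous_const.mul (hκ'c.comp this)).mul continuous_const
  have hw2c : Continuous w2 := continuous_iff_continuousAt.2 fun x => (hder x).continuousAt
  have hFTC : ∀ x, w2 x = w2 a + ∫ t in a..x, g t := fun x => by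
    rw [intervalIntegral.integral_eq_sub_of_hasDerivAt (fun t _ => hder t)
      (hgc.intervalIntegrable _ _)]
    ring
  -- pointwise bounds
  have hgen : ∀ (k : ℝ → ℝ), Continuous k → (∀ x ≤ 0, k x = 0) → (∀ x, 1 ≤ x → k x = 0) →
      ∀ x ∈ Icc a b, (∫ y in a..b, k ((y - φ x) / δ) * (w x - w y)) ^ 2 ≤
        δ * (∫ u in (0 : ℝ)..1, k u ^ 2) * S x := by
    intro k hk hk0 hk1 x hx
    have h1 : ∫ y in a..b, k ((y - φ x) / δ) * (w x - w y) =
        ∫ y in a..b, k ((y - φ x) / δ) * m x y := by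
      congr 1; ext y
      by_cases h : |x - y| ≤ δ
      · simp [hm, h]
      · have : k ((y - φ x) / δ) = 0 := (hsupp x hx y h).elim (hk0 _) (hk1 _)
        simp [this]
    rw [h1]
    refine (sq_intervalIntegral_mul_le hab.le (memLp_of_continuous (hkm k hk x).continuousOn)
      (hmL x)).trans (le_of_eq ?_)
    rw [integral_comp_scaled (f := fun u => k u ^ 2) (hk.pow 2) (fun x hx => by simp [hk0 x hx])
      (fun x hx => by simp [hk1 x hx]) hδ0 (hφa x hx) (hφb x hx)]
  have hone : ∀ x ∈ Icc a b, ∫ y in a..b, κ ((y - φ x) / δ) = δ := fun x hx => by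
    rw [integral_comp_scaled hκc hκ0 hκ1 hδ0 (hφa x hx) (hφb x hx), hκi, mul_one]
  -- Because the derivative of the kernel has mean zero, g(x) may be computed with differences of w
  -- instead of w.
  have hzero : ∀ x ∈ Icc a b, ∫ y in a..b, deriv κ ((y - φ x) / δ) = 0 := fun x hx => by
    rw [integral_comp_scaled hκ'c hd0 hd1 hδ0 (hφa x hx) (hφb x hx),
      intervalIntegral.integral_eq_sub_of_hasDerivAt (fun t _ => hκd t)
        (hκ'c.intervalIntegrable _ _), hκ0 0 le_rfl, hκ1 1 le_rfl]
    simp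
  have hsplit : ∀ (k : ℝ → ℝ), Continuous k → ∀ x,
      ∫ y in a..b, k ((y - φ x) / δ) * (w x - w y) =
        w x * (∫ y in a..b, k ((y - φ x) / δ)) - ∫ y in a..b, k ((y - φ x) / δ) * w y := by
    intro k hk x
    rw [← intervalIntegral.integral_const_mul, ← intervalIntegral.integral_sub
      (((hkm k hk x).intervalIntegrable _ _).const_mul _)
      (hwi.continuousOn_mul (hkm k hk x).continuousOn)]
    congr 1; ext y; ring
  have hb1 : ∀ x ∈ Icc a b, (w x - w2 x) ^ 2 ≤ B0 / δ * S x := by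
    intro x hx
    have h1 := hgen κ hκc hκ0 hκ1 x hx
    have h2 : w2 x = δ⁻¹ * ∫ y in a..b, κ ((y - φ x) / δ) * w y := by
      rw [← intervalIntegral.integral_const_mul]
      simp only [hw2]; congr 1; ext y; ring
    rw [hsplit κ hκc, hone x hx] at h1
    have h3 : w x - w2 x = δ⁻¹ * (w x * δ - ∫ y in a..b, κ ((y - φ x) / δ) * w y) := by
      rw [h2]; field_simp
    rw [h3, mul_pow]
    calc _ ≤ δ⁻¹ ^ 2 * (δ * B0 * S x) := by gcongr
      _ = _ := by field_simp
  have hSnn : ∀ x, 0 ≤ S x := fun x => integral_sq_nonneg hab.le _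
  have hb2 : ∀ x ∈ Icc a b, g x ^ 2 ≤ B1 / δ ^ 3 * S x := by
    intro x hx
    have h1 := hgen _ hκ'c hd0 hd1 x hx
    rw [hsplit _ hκ'c, hzero x hx, mul_zero, zero_sub, neg_sq] at h1
    have h2 : g x = -(lam / δ ^ 2) * ∫ y in a..b, deriv κ ((y - φ x) / δ) * w y := by
      rw [← intervalIntegral.integral_const_mul]
      simp only [hg]; congr 1; ext y; ring
    rw [h2, mul_pow]
    have h3 : (-(lam / δ ^ 2)) ^ 2 ≤ 1 / δ ^ 4 := by
      rw [neg_sq, div_pow, ← pow_mul]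
      gcongr
      exact pow_le_one₀ hlam0 hlam1
    calc _ ≤ 1 / δ ^ 4 * (δ * B1 * S x) := by
          gcongr
      _ = _ := by field_simp
  have hI1 : ∫ x in a..b, (w x - w2 x) ^ 2 ≤ B0 / δ * ∫ x in a..b, S x := by
    rw [← intervalIntegral.integral_const_mul]
    exact intervalIntegral.integral_mono_on hab.le
      (intervalIntegrable_sq hab.le (hw.sub (memLp_of_continuous hw2c.continuousOn)))
      (hSi.const_mul _) hb1
  have hI2 : ∫ x in a..b, g x ^ 2 ≤ B1 / δ ^ 3 * ∫ x in a..b, S x := by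
    rw [← intervalIntegral.integral_const_mul]
    exact intervalIntegral.integral_mono_on hab.le ((hgc.pow 2).intervalIntegrable _ _)
      (hSi.const_mul _) hb2
  obtain ⟨p, hp, hp'⟩ := exists_poly_approx hab hn (memLp_of_continuous hgc.continuousOn) (w2 a)
  have hSS : 0 ≤ ∫ x in a..b, S x := intervalIntegral.integral_nonneg hab.le fun x _ => hSnn x
  refine ⟨p, hp, ?_⟩
  have h4 := integral_sq_le_of_eq_add hab.le (hw.sub (memLp_of_continuous hw2c.continuousOn))
    ((memLp_of_continuous hw2c.continuousOn).sub (memLp_poly a b p))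
    (u := fun x => w x - p.eval x) (fun x _ => by simp)
  simp only [Pi.sub_apply] at h4
  simp only [← hFTC] at hp'
  rw [hmod]
  set Q := ∫ x in a..b, S x
  calc _ ≤ _ := h4
    _ ≤ 2 * (B0 / δ * Q) + 2 * (4 * δ ^ 2 * (B1 / δ ^ 3 * Q)) := by
        gcongr
        exact hp'.trans (by gcongr)
    _ = (2 * B0 + 8 * B1) / δ * Q := by field_simp; ring
    _ ≤ _ := mul_le_mul_of_nonneg_right (div_le_div_of_nonneg_right (by linarith) hδ0.le) hSS

/-! ### Stability of the Galerkin method on one interval -/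

lemma matMul_apply {M : ℕ} (D : Matrix (Fin M) (Fin M) ℝ) (u : ℝ → EuclideanSpace ℝ (Fin M))
    (x : ℝ) (i : Fin M) : matMul D u x i = ∑ j, D i j * u x j := by
  simp [matMul, Matrix.toLpLin_apply, Matrix.mulVec, dotProduct]

/-- Dissipativity of a matrix. -/
def Dissipative {M : ℕ} (D : Matrix (Fin M) (Fin M) ℝ) : Prop :=
  ∀ x : Fin M → ℝ, ∑ i, (∑ j, D i j * x j) * x i ≤ 0

lemma dissipative_of_posSemidef {M : ℕ} {D : Matrix (Fin M) (Fin M) ℝ}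
    (h : (-(D + D.transpose)).PosSemidef) : Dissipative D := by
  intro x
  have h1 := h.dotProduct_mulVec_nonneg x
  have e1 : dotProduct x (D.mulVec x) = ∑ i, (∑ j, D i j * x j) * x i := by
    simp only [dotProduct, Matrix.mulVec]
    exact Finset.sum_congr rfl fun i _ => mul_comm _ _
  have e2 : dotProduct x (D.transpose.mulVec x) = dotProduct x (D.mulVec x) := by
    rw [Matrix.mulVec_transpose, dotProduct_comm, Matrix.dotProduct_mulVec]
  rw [star_trivial, Matrix.neg_mulVec, Matrix.add_mulVec, dotProduct_neg, dotProduct_add, e2,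
    e1] at h1
  linarith

lemma two_polyInt_mul_le {a b μ : ℝ} (hab : a ≤ b) (hμ : 0 < μ) (g u : ℝ[X]) :
    2 * polyInt a b (g * u) ≤ μ * polyInt a b (g * g) + 1 / μ * polyInt a b (u * u) := by
  have h := polyInt_mul_self_nonneg hab (C μ * g - u)
  have e : (C μ * g - u) * (C μ * g - u) = C (μ ^ 2) * (g * g) - C (2 * μ) * (g * u) + u * u := by
    simp only [map_mul, map_pow, C_ofNat]; ring
  rw [e, map_add, map_sub, polyInt_C_mul, polyInt_C_mul] at h
  have : μ * (2 * polyInt a b (g * u)) ≤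
      μ * (μ * polyInt a b (g * g) + 1 / μ * polyInt a b (u * u)) := by
    rw [mul_add, ← mul_assoc μ (1 / μ), mul_one_div_cancel hμ.ne']; linarith
  exact le_of_mul_le_mul_left this hμ

section Stability

variable {M : ℕ} {D : Matrix (Fin M) (Fin M) ℝ} {a b : ℝ} {r : ℕ} {P U g : Fin M → ℝ[X]}

lemma sum_polyInt_dissipative_le (hD : Dissipative D) (hab : a ≤ b) {w : ℝ[X]}
    (hw : ∀ x ∈ Icc a b, 0 ≤ w.eval x) :
    ∑ i, polyInt a b (w * ((∑ j, C (D i j) * U j) * U i)) ≤ 0 := by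
  rw [← map_sum, ← neg_nonneg, ← map_neg]
  refine polyInt_nonneg hab fun x hx => ?_
  have h1 := hD fun i => (U i).eval x
  have h2 := hw x hx
  simp only [eval_neg, eval_finsetSum, eval_mul, eval_C]
  rw [← Finset.mul_sum]
  nlinarith

lemma polyInt_proj_le (hab : a ≤ b) {p u : ℝ[X]} (hu : u ∈ degreeLT ℝ r)
    (ho : ∀ s ∈ degreeLT ℝ r, polyInt a b ((p - u) * s) = 0) :
    polyInt a b (u * u) ≤ polyInt a b (p * p) := by
  have e : p * p = u * u + C 2 * ((p - u) * u) + (p - u) * (p - u) := by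
    rw [C_ofNat]; ring
  rw [e, map_add, map_add, polyInt_C_mul, ho u hu]
  linarith [polyInt_mul_self_nonneg hab (p - u)]

/-- `L²` stability of the Galerkin method on one interval. -/
lemma sum_polyInt_sq_le (hD : Dissipative D) (hab : a ≤ b)
    (hP : ∀ i, P i ∈ degreeLT ℝ (r + 1)) (hU : ∀ i, U i ∈ degreeLT ℝ r)
    (hder : ∀ i, derivative (P i) = (∑ j, C (D i j) * U j) + g i)
    (ho : ∀ i, ∀ s ∈ degreeLT ℝ r, polyInt a b ((P i - U i) * s) = 0) :
    ∑ i, polyInt a b (P i * P i) ≤ 2 * (b - a) * ∑ i, (P i).eval a ^ 2 +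
      4 * (b - a) ^ 2 * ∑ i, polyInt a b (g i * g i) := by
  have h1 : ∀ i, polyInt a b (P i * P i) ≤ (b - a) * (P i).eval a ^ 2 +
      2 * polyInt a b ((C b - X) * ((∑ j, C (D i j) * U j) * U i)) +
      (2 * (b - a) ^ 2 * polyInt a b (g i * g i) + 1 / 2 * polyInt a b (P i * P i)) := by
    intro i
    -- The weight b - x vanishes at b and has derivative -1: this turns the energy identity into a
    -- bound for the L² norm of P in terms of the initial value.
    have h2 := polyInt_derivative a b ((C b - X) * (P i * P i))
    have e2 : derivative ((C b - X) * (P i * P i)) =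
        C 2 * ((C b - X) * (derivative (P i) * P i)) - P i * P i := by
      simp only [derivative_mul, derivative_sub, derivative_X, derivative_C, C_ofNat]; ring
    rw [e2, map_sub, polyInt_C_mul] at h2
    simp only [eval_mul, eval_sub, eval_X, eval_C, sub_self, zero_mul, zero_sub] at h2
    have h3 := polyInt_weight_le hab (hP i) (hU i) (ho i)
    have e3 : (C b - X) * (derivative (P i) * U i) =
        (C b - X) * ((∑ j, C (D i j) * U j) * U i) + (C b - X) * (g i * U i) := by
      rw [hder i]; ring
    -- Young's inequality with coefficient 1/2 on U, so that this term, at most half the squared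
    -- norm of P, is absorbed on the left.
    have h4 : 2 * polyInt a b ((C b - X) * (g i * U i)) ≤
        2 * (b - a) ^ 2 * polyInt a b (g i * g i) + 1 / 2 * polyInt a b (U i * U i) := by
      rw [← polyInt_C_mul, ← polyInt_C_mul, ← polyInt_C_mul, ← map_add]
      refine intervalIntegral.integral_mono_on hab
        (Polynomial.continuous _ |>.intervalIntegrable _ _)
        (Polynomial.continuous _ |>.intervalIntegrable _ _) fun x hx => ?_
      simp only [eval_add, eval_mul, eval_sub, eval_X, eval_C]
      have h5 : (b - x) ^ 2 ≤ (b - a) ^ 2 :=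
        pow_le_pow_left₀ (by linarith [hx.2]) (by linarith [hx.1]) 2
      have h6 := mul_le_mul_of_nonneg_right h5 (sq_nonneg ((g i).eval x))
      nlinarith [sq_nonneg (2 * ((b - x) * (g i).eval x) - (U i).eval x)]
    have h7 := polyInt_proj_le hab (hU i) (ho i)
    rw [e3, map_add] at h3
    linarith
  have h8 := Finset.sum_le_sum fun i (_ : i ∈ Finset.univ) => h1 i
  have h9 := sum_polyInt_dissipative_le (U := U) hD hab (w := C b - X) fun x hx => by
    simp only [eval_sub, eval_X, eval_C]; linarith [hx.2]
  simp only [Finset.sum_add_distrib, ← Finset.mul_sum] at h8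
  linarith

/-- Growth of the Galerkin solution over one interval. -/
lemma sum_sq_eval_right_le (hD : Dissipative D) (hab : a ≤ b)
    (hP : ∀ i, P i ∈ degreeLT ℝ (r + 1)) (hU : ∀ i, U i ∈ degreeLT ℝ r)
    (hder : ∀ i, derivative (P i) = (∑ j, C (D i j) * U j) + g i)
    (ho : ∀ i, ∀ s ∈ degreeLT ℝ r, polyInt a b ((P i - U i) * s) = 0) {μ : ℝ} (hμ : 0 < μ) :
    ∑ i, (P i).eval b ^ 2 ≤ ∑ i, (P i).eval a ^ 2 + μ * ∑ i, polyInt a b (g i * g i) +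
      1 / μ * (2 * (b - a) * ∑ i, (P i).eval a ^ 2 +
        4 * (b - a) ^ 2 * ∑ i, polyInt a b (g i * g i)) := by
  have h1 : ∀ i, (P i).eval b ^ 2 ≤ (P i).eval a ^ 2 +
      2 * polyInt a b (1 * ((∑ j, C (D i j) * U j) * U i)) +
      (μ * polyInt a b (g i * g i) + 1 / μ * polyInt a b (P i * P i)) := by
    intro i
    have h2 := polyInt_derivative a b (P i * P i)
    -- The derivative of P has degree less than r, hence is orthogonal to P - U; testing with P
    -- therefore amounts to testing with U, and D meets U on both sides.
    have e2 : derivative (P i * P i) = C 2 * ((P i - U i) * derivative (P i)) +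
        C 2 * (1 * ((∑ j, C (D i j) * U j) * U i)) + C 2 * (g i * U i) := by
      have : C 2 * (1 * ((∑ j, C (D i j) * U j) * U i)) + C 2 * (g i * U i) =
          C 2 * (derivative (P i) * U i) := by rw [hder i]; ring
      rw [add_assoc, this, derivative_mul, C_ofNat]; ring
    rw [e2, map_add, map_add, polyInt_C_mul, polyInt_C_mul, polyInt_C_mul,
      ho i _ (derivative_mem_degreeLT (hP i))] at h2
    simp only [eval_mul] at h2
    have h3 := two_polyInt_mul_le hab hμ (g i) (U i)
    have h4 : 1 / μ * polyInt a b (U i * U i) ≤ 1 / μ * polyInt a b (P i * P i) :=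
      mul_le_mul_of_nonneg_left (polyInt_proj_le hab (hU i) (ho i)) (by positivity)
    linarith
  have h8 := Finset.sum_le_sum fun i (_ : i ∈ Finset.univ) => h1 i
  have h9 := sum_polyInt_dissipative_le (U := U) hD hab (w := 1) fun x hx => by simp
  simp only [Finset.sum_add_distrib, ← Finset.mul_sum] at h8
  have h10 := mul_le_mul_of_nonneg_left (sum_polyInt_sq_le hD hab hP hU hder ho)
    (by positivity : 0 ≤ 1 / μ)
  linarith

end Stability

/-! ### Consistency and error on one interval -/

lemma mem_degreeLT_succ_of_natDegree_le {n : ℕ} {p : ℝ[X]} (h : p.natDegree ≤ n) :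
    p ∈ degreeLT ℝ (n + 1) := by
  rw [mem_degreeLT]
  exact degree_le_natDegree.trans_lt (by exact_mod_cast Nat.lt_succ_of_le h)

lemma natDegree_le_of_mem_degreeLT_succ {n : ℕ} {p : ℝ[X]} (h : p ∈ degreeLT ℝ (n + 1)) :
    p.natDegree ≤ n :=
  natDegree_le_iff_coeff_eq_zero.2 fun _ hj => coeff_of_mem_degreeLT h hj

/-- The components of a local projection are scalar orthogonal projections. -/
lemma IsLocalProj.exists_poly {M : ℕ} {a b : ℝ} (hab : a ≤ b) {m : ℕ}
    {v w : ℝ → EuclideanSpace ℝ (Fin M)} (h : IsLocalProj a b m v w)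
    (hv : ∀ i, IntervalIntegrable (fun x => v x i) volume a b) :
    ∃ p : Fin M → ℝ[X], (∀ i, p i ∈ degreeLT ℝ (m + 1)) ∧
      (∀ i, ∀ x ∈ Ioo a b, w x i = (p i).eval x) ∧
      ∀ i, ∀ s ∈ degreeLT ℝ (m + 1), ∫ x in a..b, (v x i - (p i).eval x) * s.eval x = 0 := by
  obtain ⟨hw, ho⟩ := h
  choose p hp hp' using hw
  refine ⟨p, fun i => mem_degreeLT_succ_of_natDegree_le (hp i), hp', fun i s hs => ?_⟩
  have h1 := ho (fun t => EuclideanSpace.single i (s.eval t)) fun j => by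
    by_cases hij : j = i
    · exact ⟨s, natDegree_le_of_mem_degreeLT_succ hs, fun t _ => by simp [hij]⟩
    · exact ⟨0, by simp, fun t _ => by simp [hij]⟩
  simp only [EuclideanSpace.inner_single_right, conj_trivial] at h1
  rw [← integral_Ioc_eq_integral_Ioo, ← integral_Ioc_eq_integral_Ioo,
    ← intervalIntegral.integral_of_le hab, ← intervalIntegral.integral_of_le hab] at h1
  have h2 : ∫ x in a..b, s.eval x * w x i = ∫ x in a..b, s.eval x * (p i).eval x := by
    rw [intervalIntegral.integral_of_le hab, intervalIntegral.integral_of_le hab,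
      integral_Ioc_eq_integral_Ioo, integral_Ioc_eq_integral_Ioo]
    exact setIntegral_congr_fun measurableSet_Ioo fun x hx => by simp only [hp' i x hx]
  have h3 : ∫ x in a..b, (v x i - (p i).eval x) * s.eval x =
      (∫ x in a..b, s.eval x * v x i) - ∫ x in a..b, s.eval x * (p i).eval x := by
    rw [← intervalIntegral.integral_sub ((hv i).continuousOn_mul s.continuous.continuousOn)
      (Continuous.intervalIntegrable (u := fun x => s.eval x * (p i).eval x)
        (s.continuous.mul (p i).continuous) _ _)]
    congr 1; ext x; ring
  rw [h3, ← h2, h1, sub_self]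

/-- `u` is approximated componentwise by polynomials of degree less than `n` in `L²(a, b)`, with
total squared error `ε`. -/
def VecApprox {M : ℕ} (a b : ℝ) (n : ℕ) (u : ℝ → EuclideanSpace ℝ (Fin M)) (ε : ℝ) : Prop :=
  ∃ e : Fin M → ℝ, (∀ i, PolyApprox a b n (fun x => u x i) (e i)) ∧ ∑ i, e i ≤ ε

lemma VecApprox.nonneg {M : ℕ} {a b : ℝ} (hab : a ≤ b) {n : ℕ}
    {u : ℝ → EuclideanSpace ℝ (Fin M)} {ε : ℝ} (h : VecApprox a b n u ε) : 0 ≤ ε := by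
  obtain ⟨e, he, hs⟩ := h
  refine (Finset.sum_nonneg fun i _ => ?_).trans hs
  obtain ⟨p, -, hp⟩ := he i
  exact (integral_sq_nonneg hab fun x => u x i - p.eval x).trans hp

/-- Linear combinations of orthogonal residuals are orthogonal. -/
lemma integral_sum_mul_eval_eq_zero {M : ℕ} {a b : ℝ} {f : Fin M → ℝ → ℝ} (c : Fin M → ℝ)
    {s : ℝ[X]} (hf : ∀ j, IntervalIntegrable (f j) volume a b)
    (h : ∀ j, ∫ x in a..b, f j x * s.eval x = 0) :
    ∫ x in a..b, (∑ j, c j * f j x) * s.eval x = 0 := by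
  have h1 : ∀ x, (∑ j, c j * f j x) * s.eval x = ∑ j, c j * (f j x * s.eval x) := fun x => by
    rw [Finset.sum_mul]; exact Finset.sum_congr rfl fun j _ => by ring
  simp only [h1]
  rw [intervalIntegral.integral_finsetSum fun j _ => (intervalIntegrable_mul_eval (hf j) s).const_mul _]
  exact Finset.sum_eq_zero fun j _ => by rw [intervalIntegral.integral_const_mul, h j, mul_zero]

/-- The error of the Galerkin method over one interval. -/
lemma local_error {M r : ℕ} (hr : 1 ≤ r) {D : Matrix (Fin M) (Fin M) ℝ} (hD : Dissipative D)
    {a b : ℝ} (hab : a < b) {Y R Yr U F y1 : ℝ → EuclideanSpace ℝ (Fin M)}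
    (hYr : IsPolyOn a b r Yr) (hYrc : ContinuousOn Yr (Icc a b))
    (hU : IsLocalProj a b (r - 1) Yr U) (hF : IsLocalProj a b (r - 1) R F)
    (hder : ∀ x ∈ Ioo a b, HasDerivAt Yr (matMul D U x + F x) x)
    (hR : ∀ i, MemLp (fun x => R x i) 2 (volume.restrict (Ioc a b)))
    (hy1 : ∀ i, MemLp (fun x => y1 x i) 2 (volume.restrict (Ioc a b)))
    (hY : ∀ i, ∀ x ∈ Icc a b, Y x i = Y a i + ∫ t in a..x, y1 t i)
    (hy1e : ∀ i, (fun x => y1 x i) =ᵐ[volume.restrict (Ioc a b)]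
      fun x => (∑ j, D i j * Y x j) + R x i)
    {ε : ℝ} (hε : VecApprox a b r (matMul D y1) ε) :
    (∀ μ : ℝ, 0 < μ → ‖Y b - Yr b‖ ^ 2 ≤ ‖Y a - Yr a‖ ^ 2 + μ * (4 * ((b - a) / r) ^ 2 * ε) +
      1 / μ * (2 * (b - a) * ‖Y a - Yr a‖ ^ 2 +
        4 * (b - a) ^ 2 * (4 * ((b - a) / r) ^ 2 * ε))) ∧
    ∀ ε' : ℝ, VecApprox a b r y1 ε' → ∀ x ∈ Icc a b, ‖Y x - Yr x‖ ^ 2 ≤ 2 * (b - a) * ε' +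
      2 * ((r + 1) ^ 2 * (4 * ‖Y a - Yr a‖ ^ 2 +
        8 * (b - a) * (4 * ((b - a) / r) ^ 2 * ε))) := by
  have hh : 0 < b - a := by linarith
  -- Degree at most r - 1 is the same as degree less than r, since r ≥ 1 makes the subtraction
  -- exact.
  have hr1 : r - 1 + 1 = r := by omega
  have hyi := fun i => intervalIntegrable_of_memLp hab.le (hy1 i)
  have hYc : ∀ i, ContinuousOn (fun x => Y x i) (Icc a b) := fun i =>
    (continuousOn_primitive_add hab.le (hyi i) (Y a i)).congr fun x hx => hY i x hx
  have hYi : ∀ i, IntervalIntegrable (fun x => Y x i) volume a b := fun i =>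
    ContinuousOn.intervalIntegrable (by rw [uIcc_of_le hab.le]; exact hYc i)
  have hYrci : ∀ i, ContinuousOn (fun x => Yr x i) (Icc a b) := fun i =>
    (EuclideanSpace.proj (𝕜 := ℝ) i).continuous.comp_continuousOn hYrc
  have hYri : ∀ i, IntervalIntegrable (fun x => Yr x i) volume a b := fun i =>
    ContinuousOn.intervalIntegrable (by rw [uIcc_of_le hab.le]; exact hYrci i)
  obtain ⟨u, hu, hu1, hu2⟩ := hU.exists_poly hab.le hYri
  obtain ⟨f, hf, hf1, hf2⟩ := hF.exists_poly hab.le fun i => intervalIntegrable_of_memLp hab.le (hR i)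
  rw [hr1] at hu hu2 hf hf2
  choose y hy hyr using hYr
  have hyr' : ∀ i, ∀ x ∈ Icc a b, Yr x i = (y i).eval x := fun i => by
    have : EqOn (fun x => Yr x i) (fun x => (y i).eval x) (closure (Ioo a b)) :=
      EqOn.of_subset_closure (s := Ioo a b) (t := closure (Ioo a b)) (fun x hx => hyr i x hx)
        (by rw [closure_Ioo hab.ne]; exact hYrci i) (y i).continuous.continuousOn
        subset_closure subset_rfl
    rw [closure_Ioo hab.ne] at this
    exact fun x hx => this hx
  have hyd : ∀ i, derivative (y i) = (∑ j, C (D i j) * u j) + f i := by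
    intro i
    refine Polynomial.eq_of_infinite_eval_eq _ _ ((Ioo_infinite hab).mono fun x hx => ?_)
    have h1 : HasDerivAt (fun x => Yr x i) ((matMul D U x + F x) i) x :=
      (EuclideanSpace.proj (𝕜 := ℝ) i).hasFDerivAt.comp_hasDerivAt x (hder x hx)
    have h2 : HasDerivAt (fun x => Yr x i) ((derivative (y i)).eval x) x := by
      refine ((y i).hasDerivAt x).congr_of_eventuallyEq ?_
      filter_upwards [Ioo_mem_nhds hx.1 hx.2] with t ht using hyr i t ht
    have h3 := h2.unique h1
    rw [mem_ofPred_eq, h3, PiLp.add_apply, matMul_apply, hf1 i x hx]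
    simp only [eval_add, eval_finsetSum, eval_mul, eval_C]
    congr 1
    exact Finset.sum_congr rfl fun j _ => by rw [hu1 j x hx]
  -- the interpolant `Z` of `Y`, with derivative `q`
  choose W hW hWo using fun j => exists_proj hab r (fun x => Y x j) (hYi j)
  -- With W and f the projections of Y and R, q is the projection of Y' = DY + R, because the
  -- projection commutes with the constant matrix D.
  set q : Fin M → ℝ[X] := fun i => (∑ j, C (D i j) * W j) + f i with hq
  have hqm : ∀ i, q i ∈ degreeLT ℝ r := fun i => Submodule.add_mem _
    (Submodule.sum_mem _ fun j _ => by
      rw [← smul_eq_C_mul]; exact Submodule.smul_mem _ _ (hW j)) (hf i)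
  have hqo : ∀ i, ∀ s ∈ degreeLT ℝ r, ∫ x in a..b, (y1 x i - (q i).eval x) * s.eval x = 0 := by
    intro i s hs
    rw [integral_congr_ae_Ioc hab.le (fun x v => (v - (q i).eval x) * s.eval x) (hy1e i)]
    have hres : ∀ j, IntervalIntegrable (fun x => Y x j - (W j).eval x) volume a b := fun j =>
      (hYi j).sub ((W j).continuous.intervalIntegrable _ _)
    have h1 := integral_sum_mul_eval_eq_zero (fun j => D i j) hres fun j => hWo j s hs
    have h2 := hf2 i s hs
    have hsum : IntervalIntegrable (fun x => ∑ j, D i j * (Y x j - (W j).eval x)) volume a b := by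
      have := IntervalIntegrable.sum Finset.univ
        (f := fun j x => D i j * (Y x j - (W j).eval x)) fun j _ => (hres j).const_mul _
      exact this.congr fun x _ => by simp
    have h3 := intervalIntegral.integral_add (intervalIntegrable_mul_eval hsum s)
      (intervalIntegrable_mul_eval ((intervalIntegrable_of_memLp hab.le (hR i)).sub
        ((f i).continuous.intervalIntegrable _ _)) s)
    rw [h1, h2, add_zero] at h3
    rw [← h3]
    congr 1; ext x
    simp only [hq, eval_add, eval_finsetSum, eval_mul, eval_C, mul_sub, Finset.sum_sub_distrib]
    ring
  choose Z hZ hZd hZa using fun i => exists_antiderivative (hqm i) a (Y a i)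
  have hYZ : ∀ i, ∀ x ∈ Icc a b, Y x i - (Z i).eval x = ∫ t in a..x, (y1 t i - (q i).eval t) := by
    intro i x hx
    rw [hY i x hx, eval_eq_add_integral (Z i) a x, hZd, hZa, intervalIntegral.integral_sub
        ((hyi i).mono_set (by
          rw [uIcc_of_le hx.1, uIcc_of_le hab.le]; exact Icc_subset_Icc_right hx.2))
        ((q i).continuous.intervalIntegrable _ _)]
    ring
  -- Orthogonality of the residual to the constant 1: the interpolant is exact at the right node as
  -- well.
  have hZb : ∀ i, (Z i).eval b = Y b i := fun i => by
    have h1 := hYZ i b (right_mem_Icc.2 hab.le)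
    have h2 := hqo i 1 (by rw [mem_degreeLT, degree_one]; exact_mod_cast hr)
    simp only [eval_one, mul_one] at h2
    rw [h2] at h1; linarith
  choose V hV hVo using fun j => exists_proj hab r (fun x => (Z j).eval x)
    ((Z j).continuous.intervalIntegrable _ _)
  -- the discrete error
  set θ : Fin M → ℝ[X] := fun i => Z i - y i with hθ
  -- With V the projection of Z, this source is the projection of D(Y - Z); it is what remains when
  -- the Galerkin equation is subtracted from Z' = DW + f.
  set g : Fin M → ℝ[X] := fun i => ∑ j, C (D i j) * (W j - V j) with hg
  have hθm : ∀ i, θ i ∈ degreeLT ℝ (r + 1) := fun i =>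
    Submodule.sub_mem _ (hZ i) (mem_degreeLT_succ_of_natDegree_le (hy i))
  have hθU : ∀ i, V i - u i ∈ degreeLT ℝ r := fun i => Submodule.sub_mem _ (hV i) (hu i)
  have hθd : ∀ i, derivative (θ i) = (∑ j, C (D i j) * (V j - u j)) + g i := by
    intro i
    simp only [hθ, hg, hq, derivative_sub, hZd, hyd, mul_sub, Finset.sum_sub_distrib]
    ring
  have hθo : ∀ i, ∀ s ∈ degreeLT ℝ r, polyInt a b ((θ i - (V i - u i)) * s) = 0 := by
    intro i s hs
    have e : (θ i - (V i - u i)) * s = (Z i - V i) * s - (y i - u i) * s := by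
      simp only [hθ]; ring
    have h1 : polyInt a b ((Z i - V i) * s) = 0 := by
      rw [polyInt_apply]; simpa using hVo i s hs
    have h2 : polyInt a b ((y i - u i) * s) = 0 := by
      rw [← hu2 i s hs, polyInt_apply, intervalIntegral.integral_of_le hab.le,
        intervalIntegral.integral_of_le hab.le]
      exact setIntegral_congr_fun measurableSet_Ioc fun x hx => by
        simp [hyr' i x (Ioc_subset_Icc_self hx)]
    rw [e, map_sub, h1, h2, sub_zero]
  have hθa : ∑ i, (θ i).eval a ^ 2 = ‖Y a - Yr a‖ ^ 2 := by
    rw [EuclideanSpace.real_norm_sq_eq]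
    exact Finset.sum_congr rfl fun i _ => by
      simp [hθ, hZa, hyr' i a (left_mem_Icc.2 hab.le)]
  have hθb : ∑ i, (θ i).eval b ^ 2 = ‖Y b - Yr b‖ ^ 2 := by
    rw [EuclideanSpace.real_norm_sq_eq]
    exact Finset.sum_congr rfl fun i _ => by
      simp [hθ, hZb, hyr' i b (right_mem_Icc.2 hab.le)]
  -- consistency
  have hG : ∑ i, polyInt a b (g i * g i) ≤ 4 * ((b - a) / r) ^ 2 * ε := by
    obtain ⟨e, he, hes⟩ := hε
    have h1 : ∀ i, polyInt a b (g i * g i) ≤ 4 * ((b - a) / r) ^ 2 * e i := by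
      intro i
      set F' : ℝ → ℝ := fun x => ∑ j, D i j * (Y x j - (Z j).eval x) with hF'
      set E : ℝ → ℝ := fun x => ∑ j, D i j * (y1 x j - (q j).eval x) with hE
      have hresL : ∀ j, MemLp (fun x => y1 x j - (q j).eval x) 2 (volume.restrict (Ioc a b)) :=
        fun j => (hy1 j).sub (memLp_poly a b (q j))
      have hresI := fun j => intervalIntegrable_of_memLp hab.le (hresL j)
      have hEL : MemLp E 2 (volume.restrict (Ioc a b)) :=
        memLp_finsetSum _ fun j _ => (hresL j).const_mul _
      have hEo : ∀ s ∈ degreeLT ℝ r, ∫ x in a..b, E x * s.eval x = 0 := fun s hs =>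
        integral_sum_mul_eval_eq_zero (fun j => D i j) hresI fun j => hqo j s hs
      have hFE : ∀ x ∈ Icc a b, F' x = ∫ t in a..x, E t := by
        intro x hx
        simp only [hF', hE]
        rw [intervalIntegral.integral_finsetSum fun j _ => ((hresI j).mono_set (by
          rw [uIcc_of_le hx.1, uIcc_of_le hab.le]; exact Icc_subset_Icc_right hx.2)).const_mul _]
        exact Finset.sum_congr rfl fun j _ => by
          rw [intervalIntegral.integral_const_mul, hYZ j x hx]
      have hFc : ContinuousOn F' (Icc a b) := continuousOn_finsetSum _ fun j _ =>
        continuousOn_const.mul ((hYc j).sub (Z j).continuous.continuousOn)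
      have hgo : ∫ x in a..b, (F' x - (g i).eval x) * (g i).eval x = 0 := by
        have hgm : g i ∈ degreeLT ℝ r := Submodule.sum_mem _ fun j _ => by
          rw [← smul_eq_C_mul]
          exact Submodule.smul_mem _ _ (Submodule.sub_mem _ (hW j) (hV j))
        have i1 : ∀ j, IntervalIntegrable (fun x => Y x j - (W j).eval x) volume a b := fun j =>
          (hYi j).sub ((W j).continuous.intervalIntegrable _ _)
        have i2 : ∀ j, IntervalIntegrable (fun x => (Z j).eval x - (V j).eval x) volume a b :=
          fun j => ((Z j).continuous.sub (V j).continuous).intervalIntegrable _ _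
        have h2 := integral_sum_mul_eval_eq_zero (fun j => D i j) (s := g i)
          (f := fun j x => (Y x j - (W j).eval x) - ((Z j).eval x - (V j).eval x))
          (fun j => (i1 j).sub (i2 j)) fun j => by
            have h3 := intervalIntegral.integral_sub (intervalIntegrable_mul_eval (i1 j) (g i))
              (intervalIntegrable_mul_eval (i2 j) (g i))
            rw [hWo j _ hgm, hVo j _ hgm, sub_zero] at h3
            rw [← h3]; congr 1; ext x; ring
        rw [← h2]
        congr 1; ext x
        simp only [hF', hg, eval_finsetSum, eval_mul, eval_C, eval_sub]
        rw [← Finset.sum_sub_distrib]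
        congr 1
        exact Finset.sum_congr rfl fun j _ => by ring
      have hFL := memLp_of_continuous hFc
      have h3 : polyInt a b (g i * g i) ≤ ∫ x in a..b, F' x ^ 2 := by
        have h4 : ∫ x in a..b, F' x ^ 2 = (∫ x in a..b, (F' x - (g i).eval x) ^ 2) +
            2 * (∫ x in a..b, (F' x - (g i).eval x) * (g i).eval x) +
            polyInt a b (g i * g i) := by
          have hd : MemLp (fun x => F' x - (g i).eval x) 2 (volume.restrict (Ioc a b)) :=
            hFL.sub (memLp_poly a b (g i))
          rw [polyInt_apply, ← intervalIntegral.integral_const_mul, ← intervalIntegral.integral_add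
            (intervalIntegrable_sq hab.le hd)
            ((intervalIntegrable_mul hab.le hd (memLp_poly a b _)).const_mul _),
            ← intervalIntegral.integral_add ((intervalIntegrable_sq hab.le hd).add
              ((intervalIntegrable_mul hab.le hd (memLp_poly a b _)).const_mul _))
              ((g i * g i).continuous.intervalIntegrable _ _)]
          congr 1; ext x; simp; ring
        rw [h4, hgo]
        have := integral_sq_nonneg hab.le (fun x => F' x - (g i).eval x)
        linarith
      have h5 : ∫ x in a..b, F' x ^ 2 = ∫ x in a..b, (∫ t in a..x, E t) ^ 2 := by
        rw [intervalIntegral.integral_of_le hab.le, intervalIntegral.integral_of_le hab.le]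
        exact setIntegral_congr_fun measurableSet_Ioc fun x hx => by
          simp only [hFE x (Ioc_subset_Icc_self hx)]
      have h6 := integral_sq_primitive_le_of_orthogonal hab hr hEL hEo
      have h7 : ∫ x in a..b, E x ^ 2 ≤ e i := by
        have h8 : ∀ x, E x = matMul D y1 x i - (∑ j, C (D i j) * q j).eval x := fun x => by
          simp only [hE, matMul_apply, eval_finsetSum, eval_mul, eval_C, mul_sub,
            Finset.sum_sub_distrib]
        have hDy : MemLp (fun x => matMul D y1 x i) 2 (volume.restrict (Ioc a b)) := by
          simp only [matMul_apply]
          exact memLp_finsetSum _ fun j _ => (hy1 j).const_mul _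
        have h9 := PolyApprox.integral_sq_le_of_orthogonal hab.le hDy (he i)
          (q := ∑ j, C (D i j) * q j) (Submodule.sum_mem _ fun j _ => by
            rw [← smul_eq_C_mul]; exact Submodule.smul_mem _ _ (hqm j))
          (fun s hs => by simp only [← h8]; exact hEo s hs)
        simpa only [← h8] using h9
      calc polyInt a b (g i * g i) ≤ _ := h3
        _ ≤ _ := h5.le.trans h6
        _ ≤ _ := by gcongr
    calc _ ≤ ∑ i, 4 * ((b - a) / r) ^ 2 * e i := Finset.sum_le_sum fun i _ => h1 i
      _ = 4 * ((b - a) / r) ^ 2 * ∑ i, e i := by rw [Finset.mul_sum]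
      _ ≤ _ := by gcongr
  refine ⟨fun μ hμ => ?_, fun ε' hε' x hx => ?_⟩
  · have h1 := sum_sq_eval_right_le hD hab.le hθm hθU hθd hθo hμ
    rw [hθa, hθb] at h1
    refine h1.trans ?_
    gcongr
  · have h1 := sum_polyInt_sq_le hD hab.le hθm hθU hθd hθo
    rw [hθa] at h1
    obtain ⟨e, he, hes⟩ := hε'
    have h2 : ∀ i, (Y x i - (Z i).eval x) ^ 2 ≤ (b - a) * e i := by
      intro i
      rw [hYZ i x hx]
      refine (sq_primitive_le ((hy1 i).sub (memLp_poly a b (q i))) hx).trans ?_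
      exact mul_le_mul_of_nonneg_left
        (PolyApprox.integral_sq_le_of_orthogonal hab.le (hy1 i) (he i) (hqm i) (hqo i)) hh.le
    have h3 : ∀ i, (Y x i - Yr x i) ^ 2 ≤ 2 * ((b - a) * e i) + 2 * (θ i).eval x ^ 2 := by
      intro i
      have : Y x i - Yr x i = (Y x i - (Z i).eval x) + (θ i).eval x := by
        rw [hyr' i x hx]; simp [hθ]
      rw [this]
      nlinarith [h2 i, sq_nonneg ((Y x i - (Z i).eval x) - (θ i).eval x)]
    -- The inverse estimate for degree at most r; its factor 1/(b - a) is compensated by the length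
    -- appearing in the L² stability bound.
    have h4 : (b - a) * ∑ i, (θ i).eval x ^ 2 ≤
        2 * ((r + 1 : ℕ) : ℝ) ^ 2 * ∑ i, polyInt a b (θ i * θ i) := by
      rw [Finset.mul_sum, Finset.mul_sum]
      exact Finset.sum_le_sum fun i _ => sq_eval_le hab (hθm i) hx
    have h5 : ∑ i, (θ i).eval x ^ 2 ≤ (r + 1) ^ 2 * (4 * ‖Y a - Yr a‖ ^ 2 +
        8 * (b - a) * (4 * ((b - a) / r) ^ 2 * ε)) := by
      refine le_of_mul_le_mul_left (h4.trans ?_) hh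
      push_cast
      calc 2 * ((r : ℝ) + 1) ^ 2 * ∑ i, polyInt a b (θ i * θ i)
          ≤ 2 * ((r : ℝ) + 1) ^ 2 * (2 * (b - a) * ‖Y a - Yr a‖ ^ 2 +
            4 * (b - a) ^ 2 * (4 * ((b - a) / r) ^ 2 * ε)) := by
            gcongr
            exact h1.trans (by gcongr)
        _ = _ := by ring
    rw [EuclideanSpace.real_norm_sq_eq]
    simp only [PiLp.sub_apply]
    have h6 := Finset.sum_le_sum fun i (_ : i ∈ Finset.univ) => h3 i
    simp only [Finset.sum_add_distrib, ← Finset.mul_sum] at h6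
    have h7 : 2 * ((b - a) * ∑ i, e i) ≤ 2 * ((b - a) * ε') := by gcongr
    linarith

/-! ### Weak derivatives -/

section WeakDeriv

variable {E : Type*} [NormedAddCommGroup E] [NormedSpace ℝ E] {a b : ℝ}

/-- Test functions on `(a, b)`. -/
structure IsTest (a b : ℝ) (φ : ℝ → ℝ) : Prop where
  contDiff : ContDiff ℝ (⊤ : ℕ∞) φ
  compact : HasCompactSupport φ
  subset : tsupport φ ⊆ Ioo a b

lemma IsTest.deriv {φ : ℝ → ℝ} (h : IsTest a b φ) : IsTest a b (deriv φ) :=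
  ⟨(contDiff_infty_iff_deriv.1 h.contDiff).2, h.compact.deriv, tsupport_deriv_subset.trans h.subset⟩

lemma IsTest.iteratedDeriv {φ : ℝ → ℝ} (h : IsTest a b φ) (j : ℕ) :
    IsTest a b (iteratedDeriv j φ) := by
  induction j with
  | zero => simpa using h
  | succ j ih => rw [iteratedDeriv_succ]; exact ih.deriv

lemma IsTest.eq_zero {φ : ℝ → ℝ} (h : IsTest a b φ) {x : ℝ} (hx : x ∉ Ioo a b) : φ x = 0 :=
  image_eq_zero_of_notMem_tsupport fun h' => hx (h.subset h')

lemma IsTest.integrableOn_smul {φ : ℝ → ℝ} (h : IsTest a b φ) {u : ℝ → E}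
    (hu : LocallyIntegrableOn u (Ioo a b)) : IntegrableOn (fun x => φ x • u x) (Ioo a b) := by
  have h1 : IntegrableOn (fun x => φ x • u x) (tsupport φ) :=
    (hu.integrableOn_compact_subset h.subset h.compact).continuousOn_smul
      h.contDiff.continuous.continuousOn h.compact
  refine h1.of_forall_sdiff_eq_zero measurableSet_Ioo fun x hx => ?_
  rw [image_eq_zero_of_notMem_tsupport hx.2, zero_smul]

lemma IsTest.setIntegral {φ : ℝ → ℝ} (h : IsTest a b φ) (u : ℝ → E) :
    ∫ x in Ioo a b, φ x • u x = ∫ x, φ x • u x :=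
  setIntegral_eq_integral_of_forall_compl_eq_zero fun x hx => by rw [h.eq_zero hx, zero_smul]

lemma HasWeakDeriv.test {j : ℕ} {u v : ℝ → E} (h : HasWeakDeriv a b j u v) {φ : ℝ → ℝ}
    (hφ : IsTest a b φ) :
    ∫ t in Ioo a b, iteratedDeriv j φ t • u t = (-1 : ℝ) ^ j • ∫ t in Ioo a b, φ t • v t :=
  h.2.2 φ hφ.contDiff hφ.compact hφ.subset

/-- The fundamental lemma of the calculus of variations on an interval. -/
lemma ae_eq_of_test {v w : ℝ → E} [CompleteSpace E] (hv : LocallyIntegrableOn v (Ioo a b))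
    (hw : LocallyIntegrableOn w (Ioo a b))
    (h : ∀ φ, IsTest a b φ → ∫ t in Ioo a b, φ t • v t = ∫ t in Ioo a b, φ t • w t) :
    v =ᵐ[volume.restrict (Ioo a b)] w := by
  have h1 := isOpen_Ioo.ae_eq_zero_of_integral_contDiff_smul_eq_zero (hv.sub hw)
    fun φ h1 h2 h3 => by
      have hφ : IsTest a b φ := ⟨h1, h2, h3⟩
      rw [← hφ.setIntegral]
      simp only [Pi.sub_apply, smul_sub]
      rw [integral_sub (hφ.integrableOn_smul hv) (hφ.integrableOn_smul hw), h φ hφ, sub_self]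
  rw [Filter.EventuallyEq, ae_restrict_iff' measurableSet_Ioo]
  filter_upwards [h1] with x hx hx'
  exact sub_eq_zero.1 (hx hx')

lemma HasWeakDeriv.unique [CompleteSpace E] {j : ℕ} {u v w : ℝ → E} (hv : HasWeakDeriv a b j u v)
    (hw : HasWeakDeriv a b j u w) : v =ᵐ[volume.restrict (Ioo a b)] w :=
  ae_eq_of_test hv.2.1 hw.2.1 fun φ hφ => by
    have h := (hv.test hφ).symm.trans (hw.test hφ)
    rcases neg_one_pow_eq_or ℝ j with h' | h'
    · simpa [h'] using h
    · simpa [h'] using h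

lemma HasWeakDeriv.ae_eq_zeroth [CompleteSpace E] {u v : ℝ → E} (h : HasWeakDeriv a b 0 u v) :
    v =ᵐ[volume.restrict (Ioo a b)] u :=
  h.unique ⟨h.1, h.1, fun φ _ _ _ => by simp⟩

/-- The `j`-th weak derivative of the `i`-th weak derivative. -/
lemma HasWeakDeriv.of_add {i j : ℕ} {u v w : ℝ → E} (hv : HasWeakDeriv a b i u v)
    (hw : HasWeakDeriv a b (i + j) u w) : HasWeakDeriv a b j v w := by
  refine ⟨hv.2.1, hw.2.1, fun φ h1 h2 h3 => ?_⟩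
  have hφ : IsTest a b φ := ⟨h1, h2, h3⟩
  have e1 := hv.test (hφ.iteratedDeriv j)
  have e2 := hw.test hφ
  have e3 : iteratedDeriv i (iteratedDeriv j φ) = iteratedDeriv (i + j) φ := by
    rw [iteratedDeriv_eq_iterate, iteratedDeriv_eq_iterate, iteratedDeriv_eq_iterate,
      Function.iterate_add_apply]
  rw [e3, e2] at e1
  have e4 : (-1 : ℝ) ^ i * (-1) ^ i = 1 := by rw [← mul_pow]; simp
  calc ∫ t in Ioo a b, iteratedDeriv j φ t • v t
      = ((-1 : ℝ) ^ i * (-1) ^ i) • ∫ t in Ioo a b, iteratedDeriv j φ t • v t := by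
        rw [e4, one_smul]
    _ = (-1 : ℝ) ^ j • ∫ t in Ioo a b, φ t • w t := by
        rw [mul_smul, ← e1, smul_smul, pow_add, ← mul_assoc, e4, one_mul]

lemma locallyIntegrableOn_comp {E' : Type*} [NormedAddCommGroup E'] [NormedSpace ℝ E']
    (L : E →L[ℝ] E') {u : ℝ → E} (hu : LocallyIntegrableOn u (Ioo a b)) :
    LocallyIntegrableOn (fun x => L (u x)) (Ioo a b) := fun x hx => by
  obtain ⟨s, hs, hs'⟩ := hu x hx
  exact ⟨s, hs, L.integrable_comp hs'⟩

lemma HasWeakDeriv.comp_clm {E' : Type*} [NormedAddCommGroup E'] [NormedSpace ℝ E']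
    [CompleteSpace E] [CompleteSpace E'] (L : E →L[ℝ] E') {j : ℕ} {u v : ℝ → E}
    (h : HasWeakDeriv a b j u v) :
    HasWeakDeriv a b j (fun x => L (u x)) (fun x => L (v x)) := by
  refine ⟨locallyIntegrableOn_comp L h.1, locallyIntegrableOn_comp L h.2.1, fun φ h1 h2 h3 => ?_⟩
  have hφ : IsTest a b φ := ⟨h1, h2, h3⟩
  simp only [← map_smul]
  rw [L.integral_comp_comm ((hφ.iteratedDeriv j).integrableOn_smul h.1),
    L.integral_comp_comm (hφ.integrableOn_smul h.2.1), ← map_smul, h.test hφ]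

lemma HasWeakDeriv.add {j : ℕ} {u v u' v' : ℝ → E} (h : HasWeakDeriv a b j u v)
    (h' : HasWeakDeriv a b j u' v') : HasWeakDeriv a b j (u + u') (v + v') := by
  refine ⟨h.1.add h'.1, h.2.1.add h'.2.1, fun φ h1 h2 h3 => ?_⟩
  have hφ : IsTest a b φ := ⟨h1, h2, h3⟩
  simp only [Pi.add_apply, smul_add]
  rw [integral_add ((hφ.iteratedDeriv j).integrableOn_smul h.1)
    ((hφ.iteratedDeriv j).integrableOn_smul h'.1),
    integral_add (hφ.integrableOn_smul h.2.1) (hφ.integrableOn_smul h'.2.1), smul_add,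
    h.test hφ, h'.test hφ]

lemma hasWeakDeriv_weakDeriv {j : ℕ} {u v : ℝ → E} (h : HasWeakDeriv a b j u v) :
    HasWeakDeriv a b j u (weakDeriv a b j u) := by
  have h' : ∃ v, HasWeakDeriv a b j u v := ⟨v, h⟩
  rw [weakDeriv, dif_pos h']
  exact h'.choose_spec

/-- A compact subset of an open interval lies in a compact subinterval. -/
lemma exists_Icc_of_isCompact {K : Set ℝ} (hab : a < b) (hK : IsCompact K) (h : K ⊆ Ioo a b) :
    ∃ c d, a < c ∧ d < b ∧ c ≤ d ∧ K ⊆ Icc c d := by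
  rcases K.eq_empty_or_nonempty with rfl | hne
  · exact ⟨(a + b) / 2, (a + b) / 2, by linarith, by linarith, le_rfl, empty_subset _⟩
  · have h1 := h (hK.sInf_mem hne)
    have h2 := h (hK.sSup_mem hne)
    refine ⟨sInf K, sSup K, h1.1, h2.2, ?_, fun x hx =>
      ⟨csInf_le hK.bddBelow hx, le_csSup hK.bddAbove hx⟩⟩
    exact csInf_le hK.bddBelow (hK.sSup_mem hne)

/-- A test function of integral zero has a test function as primitive. -/
lemma IsTest.exists_primitive (hab : a < b) {ψ : ℝ → ℝ} (h : IsTest a b ψ)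
    (h0 : ∫ x in a..b, ψ x = 0) : ∃ φ, IsTest a b φ ∧ _root_.deriv φ = ψ := by
  obtain ⟨c, d, hc, hd, hcd, hK⟩ := exists_Icc_of_isCompact hab h.compact h.subset
  have hz : ∀ x, x ∉ Icc c d → ψ x = 0 := fun x hx =>
    image_eq_zero_of_notMem_tsupport fun h' => hx (hK h')
  have hψc := h.contDiff.continuous
  have hd' : ∀ x, HasDerivAt (fun x => ∫ t in a..x, ψ t) (ψ x) x := fun x =>
    intervalIntegral.integral_hasDerivAt_right (hψc.intervalIntegrable _ _)
      hψc.aestronglyMeasurable.stronglyMeasurableAtFilter hψc.continuousAt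
  have hde : _root_.deriv (fun x => ∫ t in a..x, ψ t) = ψ := funext fun x => (hd' x).deriv
  have hsupp : ∀ x, x ∉ Icc c d → ∫ t in a..x, ψ t = 0 := by
    intro x hx
    rcases lt_or_ge x c with h1 | h1
    · refine intervalIntegral.integral_zero_ae (Filter.Eventually.of_forall fun t ht => hz t ?_)
      intro ht'
      have : t ≤ max a x := ht.2
      exact absurd (this.trans_lt (max_lt hc h1)) (not_lt.2 ht'.1)
    · have h2 : d < x := by by_contra h3; exact hx ⟨h1, not_lt.1 h3⟩
      rw [← intervalIntegral.integral_add_adjacent_intervals (hψc.intervalIntegrable a b)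
        (hψc.intervalIntegrable b x), h0, zero_add]
      refine intervalIntegral.integral_zero_ae (Filter.Eventually.of_forall fun t ht => hz t ?_)
      intro ht'
      have : min b x < t := ht.1
      exact absurd ((lt_min hd h2).trans this) (not_lt.2 ht'.2)
  have hts : tsupport (fun x => ∫ t in a..x, ψ t) ⊆ Icc c d :=
    closure_minimal (fun x hx => by by_contra h'; exact hx (hsupp x h')) isClosed_Icc
  refine ⟨fun x => ∫ t in a..x, ψ t, ⟨contDiff_infty_iff_deriv.2
    ⟨fun x => (hd' x).differentiableAt, by rw [hde]; exact h.contDiff⟩,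
    isCompact_Icc.of_isClosed_subset (isClosed_tsupport _) hts,
    hts.trans fun x hx => ⟨hc.trans_le hx.1, hx.2.trans_lt hd⟩⟩, hde⟩

lemma exists_isTest_integral_one (hab : a < b) :
    ∃ ψ, IsTest a b ψ ∧ ∫ x in a..b, ψ x = 1 := by
  let f : ContDiffBump ((a + b) / 2 : ℝ) :=
    ⟨(b - a) / 8, (b - a) / 4, by linarith, by linarith⟩
  have hs : tsupport (f.normed volume) ⊆ Ioo a b := by
    rw [f.tsupport_normed_eq, Real.closedBall_eq_Icc]
    intro x hx
    have h1 : (a + b) / 2 - (b - a) / 4 ≤ x := hx.1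
    have h2 : x ≤ (a + b) / 2 + (b - a) / 4 := hx.2
    exact ⟨by linarith, by linarith⟩
  refine ⟨f.normed volume, ⟨f.contDiff_normed, f.hasCompactSupport_normed, hs⟩, ?_⟩
  rw [intervalIntegral.integral_eq_integral_of_support_subset
    ((subset_tsupport _).trans (hs.trans Ioo_subset_Ioc_self))]
  exact f.integral_normed

/-- A function whose weak derivative is integrable is a primitive of it. -/
lemma HasWeakDeriv.exists_ae_eq_primitive (hab : a < b) {u v : ℝ → ℝ}
    (h : HasWeakDeriv a b 1 u v) (hv : IntegrableOn v (Ioc a b)) :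
    ∃ c, u =ᵐ[volume.restrict (Ioc a b)] fun x => c + ∫ t in a..x, v t := by
  have hvi : IntervalIntegrable v volume a b :=
    (intervalIntegrable_iff_integrableOn_Ioc_of_le hab.le).2 hv
  set W : ℝ → ℝ := fun x => ∫ t in a..x, v t with hW
  have hWc : ContinuousOn W (Icc a b) := by
    simpa using continuousOn_primitive_add hab.le hvi 0
  have hWl : LocallyIntegrableOn W (Ioo a b) :=
    (hWc.mono Ioo_subset_Icc_self).locallyIntegrableOn measurableSet_Ioo
  have hul : LocallyIntegrableOn (fun x => u x - W x) (Ioo a b) := h.1.sub hWl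
  -- The difference of u and the primitive W of v has weak derivative zero; the remaining argument
  -- shows that it is constant.
  have key : ∀ φ, IsTest a b φ → ∫ t in Ioo a b, deriv φ t * (u t - W t) = 0 := by
    intro φ hφ
    have h1 := h.test hφ
    rw [iteratedDeriv_one] at h1
    simp only [smul_eq_mul, pow_one, neg_mul, one_mul] at h1
    have hac : AbsolutelyContinuousOnInterval φ a b := by
      have := ((hφ.deriv.contDiff.continuous.intervalIntegrable (μ := volume) a
        b).absolutelyContinuousOnInterval_intervalIntegral (c := a) left_mem_uIcc)
      have e : (fun x => ∫ t in a..x, deriv φ t) = φ := by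
        ext x
        rw [intervalIntegral.integral_eq_sub_of_hasDerivAt (fun t _ =>
          (hφ.contDiff.differentiable (by simp) t).hasDerivAt)
          (hφ.deriv.contDiff.continuous.intervalIntegrable _ _),
          hφ.eq_zero (x := a) (fun h' => lt_irrefl _ h'.1), sub_zero]
      rwa [e] at this
    have hWac := hvi.absolutelyContinuousOnInterval_intervalIntegral (c := a) left_mem_uIcc
    have h2 := hac.integral_mul_deriv_eq_deriv_mul hWac
    rw [hφ.eq_zero (x := a) (fun h' => lt_irrefl _ h'.1),
      hφ.eq_zero (x := b) (fun h' => lt_irrefl _ h'.2)] at h2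
    have h3 : ∫ x in a..b, φ x * deriv (fun x => ∫ t in a..x, v t) x = ∫ x in a..b, φ x * v x := by
      refine intervalIntegral.integral_congr_ae ?_
      filter_upwards [hvi.ae_hasDerivAt_integral] with x hx hx'
      rw [(hx (uIoc_subset_uIcc hx') a left_mem_uIcc).deriv]
    have h4 : ∀ f : ℝ → ℝ, ∫ x in a..b, f x = ∫ x in Ioo a b, f x := fun f => by
      rw [intervalIntegral.integral_of_le hab.le, integral_Ioc_eq_integral_Ioo]
    rw [h3, h4 (fun x => φ x * v x), h4 (fun x => deriv φ x * ∫ t in a..x, v t)] at h2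
    simp only [mul_sub]
    have i1 := hφ.deriv.integrableOn_smul h.1
    have i2 := hφ.deriv.integrableOn_smul hWl
    simp only [smul_eq_mul] at i1 i2
    rw [integral_sub i1 i2, h1, h2]
    ring
  obtain ⟨ψ₀, hψ₀, hψ₀i⟩ := exists_isTest_integral_one hab
  set c := ∫ t in Ioo a b, ψ₀ t * (u t - W t) with hc
  have hfin : (fun x => u x - W x) =ᵐ[volume.restrict (Ioo a b)] fun _ => c := by
    have hcl : LocallyIntegrableOn (fun _ : ℝ => c) (Ioo a b) :=
      continuousOn_const.locallyIntegrableOn measurableSet_Ioo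
    refine ae_eq_of_test hul hcl fun ψ hψ => ?_
    -- Subtracting from ψ the multiple of ψ₀ with the same integral leaves a test function of mean
    -- zero, which is a derivative to which `key` applies. The constant is thus the pairing with ψ₀.
    simp only [smul_eq_mul]
    set I := ∫ x in a..b, ψ x with hI
    have hχ : IsTest a b (fun x => ψ x - I * ψ₀ x) := by
      refine ⟨hψ.contDiff.sub (contDiff_const.mul hψ₀.contDiff), ?_, ?_⟩
      · exact hψ.compact.sub (hψ₀.compact.mul_left (f := fun _ => I))
      · refine (tsupport_sub ψ (fun x => I * ψ₀ x)).trans (union_subset hψ.subset ?_)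
        exact (tsupport_mul_subset_right (f := fun _ => I) (g := ψ₀)).trans hψ₀.subset
    obtain ⟨φ, hφ, hφd⟩ := hχ.exists_primitive hab (by
      rw [intervalIntegral.integral_sub (hψ.contDiff.continuous.intervalIntegrable _ _)
        ((hψ₀.contDiff.continuous.intervalIntegrable _ _).const_mul _),
        intervalIntegral.integral_const_mul, hψ₀i, mul_one, sub_self])
    have h1 := key φ hφ
    rw [hφd] at h1
    have i1 := hψ.integrableOn_smul hul
    have i2 := hψ₀.integrableOn_smul hul
    simp only [smul_eq_mul] at i1 i2
    have h2 : ∫ t in Ioo a b, (ψ t - I * ψ₀ t) * (u t - W t) =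
        (∫ t in Ioo a b, ψ t * (u t - W t)) - I * c := by
      rw [hc, ← integral_const_mul, ← integral_sub i1 (i2.const_mul _)]
      congr 1; ext t; ring
    rw [h2] at h1
    rw [integral_mul_const, ← integral_Ioc_eq_integral_Ioo (f := ψ),
      ← intervalIntegral.integral_of_le hab.le]
    linarith
  refine ⟨c, ?_⟩
  rw [restrict_Ioo_eq_restrict_Ioc] at hfin
  filter_upwards [hfin] with x hx
  linarith

end WeakDeriv

/-! ### Vector-valued approximation along chains of primitives -/

section Chain

variable {M : ℕ} {a b : ℝ}

lemma memLp_coord {α : Type*} [MeasurableSpace α] {μ : Measure α} {p : ℝ≥0∞}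
    {u : α → EuclideanSpace ℝ (Fin M)} (hu : MemLp u p μ) (i : Fin M) :
    MemLp (fun x => u x i) p μ :=
  (EuclideanSpace.proj (𝕜 := ℝ) i).comp_memLp' hu

lemma integral_norm_sq_eq_sum {α : Type*} [MeasurableSpace α] {μ : Measure α}
    {u : α → EuclideanSpace ℝ (Fin M)} (hu : MemLp u 2 μ) :
    ∫ x, ‖u x‖ ^ 2 ∂μ = ∑ i, ∫ x, u x i ^ 2 ∂μ := by
  simp only [EuclideanSpace.real_norm_sq_eq]
  exact integral_finsetSum _ fun i _ => (memLp_coord hu i).integrable_sq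

lemma VecApprox.mono {n : ℕ} {u : ℝ → EuclideanSpace ℝ (Fin M)} {ε δ : ℝ}
    (h : VecApprox a b n u ε) (hε : ε ≤ δ) : VecApprox a b n u δ :=
  let ⟨e, he, hs⟩ := h; ⟨e, he, hs.trans hε⟩

lemma VecApprox.congr (hab : a ≤ b) {n : ℕ} {u v : ℝ → EuclideanSpace ℝ (Fin M)} {ε : ℝ}
    (h : VecApprox a b n u ε) (huv : u =ᵐ[volume.restrict (Ioc a b)] v) :
    VecApprox a b n v ε :=
  let ⟨e, he, hs⟩ := h
  ⟨e, fun i => (he i).congr hab (by filter_upwards [huv] with x hx; rw [hx]), hs⟩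

lemma VecApprox.sub (hab : a ≤ b) {n : ℕ} {u v : ℝ → EuclideanSpace ℝ (Fin M)} {ε δ : ℝ}
    (hu : MemLp u 2 (volume.restrict (Ioc a b))) (hv : MemLp v 2 (volume.restrict (Ioc a b)))
    (h : VecApprox a b n u ε) (h' : VecApprox a b n v δ) :
    VecApprox a b n (u - v) (2 * ε + 2 * δ) := by
  obtain ⟨e, he, hs⟩ := h
  obtain ⟨d, hd, hs'⟩ := h'
  refine ⟨fun i => 2 * e i + 2 * d i, fun i =>
    (he i).sub hab (memLp_coord hu i) (memLp_coord hv i) (hd i), ?_⟩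
  rw [Finset.sum_add_distrib, ← Finset.mul_sum, ← Finset.mul_sum]
  linarith

/-- `Q` controls the (squared) seminorm of order `θ ∈ [0, 1)` of `g` on `(a, b)`: the `L²` norm for
`θ = 0`, the averaged `L²` modulus of continuity for `θ > 0`. -/
def SeminormBound (a b θ : ℝ) (g : ℝ → EuclideanSpace ℝ (Fin M)) (Q : ℝ) : Prop :=
  (θ = 0 → ∫ x in a..b, ‖g x‖ ^ 2 ≤ Q) ∧
  (0 < θ → ∀ δ > 0, ∫ z in {z : ℝ × ℝ | |z.1 - z.2| ≤ δ}, ‖g z.1 - g z.2‖ ^ 2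
    ∂((volume.restrict (Ioc a b)).prod (volume.restrict (Ioc a b))) ≤ δ ^ (1 + 2 * θ) * Q)

/-- On `(a, b)`, each of `g 0, …, g (K - 1)` is a primitive of the next function, and all of
`g 0, …, g K` are square integrable. -/
structure IsChain (a b : ℝ) (K : ℕ) (g : ℕ → ℝ → EuclideanSpace ℝ (Fin M)) : Prop where
  memLp : ∀ j ≤ K, MemLp (g j) 2 (volume.restrict (Ioc a b))
  primitive : ∀ j < K, ∀ i, ∃ c, (fun x => g j x i) =ᵐ[volume.restrict (Ioc a b)]
    fun x => c + ∫ t in a..x, g (j + 1) t i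

/-- The bound (n + K)/(K + 1) ≤ n + 1 expresses every rate in the final degree n + K, at the cost of
a factor K + 1 per integration. -/
lemma IsChain.iterate (hab : a < b) {K : ℕ} {g : ℕ → ℝ → EuclideanSpace ℝ (Fin M)}
    (hg : IsChain a b K g) {n : ℕ} (hn : 1 ≤ n + K) {ε : ℝ} (h : VecApprox a b n (g K) ε) :
    VecApprox a b (n + K) (g 0) ((2 * (K + 1) * ((b - a) / (n + K : ℕ))) ^ (2 * K) * ε) := by
  obtain ⟨e, he, hs⟩ := h
  have hr : (0 : ℝ) < (n + K : ℕ) := by exact_mod_cast hn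
  refine ⟨fun i => (2 * (K + 1) * ((b - a) / (n + K : ℕ))) ^ (2 * K) * e i, fun i => ?_, ?_⟩
  · have hκ : ((n + K : ℕ) : ℝ) / (K + 1) ≤ n + 1 := by
      rw [div_le_iff₀ (by positivity)]
      push_cast
      nlinarith [K.cast_nonneg (α := ℝ), n.cast_nonneg (α := ℝ),
        mul_nonneg (K.cast_nonneg (α := ℝ)) (n.cast_nonneg (α := ℝ))]
    have := PolyApprox.iterate hab (κ := ((n + K : ℕ) : ℝ) / (K + 1)) (by positivity) hκ K
      (fun j x => g j x i) (fun j hj => memLp_coord (hg.memLp j hj) i)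
      (fun j hj => hg.primitive j hj i) (he i)
    have e1 : 2 * (b - a) / (((n + K : ℕ) : ℝ) / (K + 1)) =
        2 * (K + 1) * ((b - a) / (n + K : ℕ)) := by
      field_simp
    rwa [e1] at this
  · rw [← Finset.mul_sum]
    have : 0 < b - a := by linarith
    exact mul_le_mul_of_nonneg_left hs (by positivity)

/-- Polynomial approximation of order `K + θ`. -/
lemma exists_vecApprox_of_chain : ∃ C : ℝ, 1 ≤ C ∧ ∀ (M : ℕ) (a b : ℝ) (r K : ℕ) (θ Q : ℝ)
    (g : ℕ → ℝ → EuclideanSpace ℝ (Fin M)), a < b → 1 ≤ r → 0 ≤ θ → θ < 1 → (K : ℝ) + θ ≤ r →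
      0 ≤ Q → IsChain a b K g → SeminormBound a b θ (g K) Q →
        VecApprox a b r (g 0)
          (C * (2 * (K + 1)) ^ (2 * (K + 1)) * ((b - a) / r) ^ (2 * (K + θ)) * Q) := by
  obtain ⟨C, hC0, hC⟩ := exists_mollified_approx
  refine ⟨max C 1, le_max_right _ _, fun M a b r K θ Q g hab hr hθ hθ1 hKr hQ hg hS => ?_⟩
  have hh : 0 < b - a := by linarith
  have hr0 : (0 : ℝ) < r := by exact_mod_cast hr
  have hC1 : 1 ≤ max C 1 := le_max_right _ _
  set x := (b - a) / r with hx
  have hx0 : 0 < x := by positivity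
  have hKle : K ≤ r := by
    have : (K : ℝ) ≤ r := by linarith
    exact_mod_cast this
  -- The K integrations raise the degree by K, so degree n is left for the top function.
  obtain ⟨n, rfl⟩ : ∃ n, r = n + K := ⟨r - K, by omega⟩
  have hA : (1 : ℝ) ≤ 2 * (K + 1) := by linarith [K.cast_nonneg (α := ℝ)]
  have hxp : x ^ (2 * (K : ℝ)) = x ^ (2 * K) := by
    rw [← Real.rpow_natCast]; push_cast; rfl
  -- For θ = 0 the top function is approximated by 0, and n = 0 is allowed. For θ > 0 mollification
  -- needs n ≥ 1, which the assumption K + θ ≤ r guarantees.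
  rcases hθ.eq_or_lt with h0 | h0
  · have h1 : VecApprox a b n (g K) Q := by
      refine ⟨fun i => ∫ x in a..b, g K x i ^ 2, fun i => PolyApprox.zero _ _ _ _, ?_⟩
      refine le_trans (le_of_eq ?_) (hS.1 h0.symm)
      simp only [intervalIntegral.integral_of_le hab.le]
      exact (integral_norm_sq_eq_sum (hg.memLp K le_rfl)).symm
    refine (hg.iterate hab hr h1).mono ?_
    rw [← h0, add_zero, hxp, mul_pow]
    gcongr
    calc (2 * ((K : ℝ) + 1)) ^ (2 * K) ≤ (2 * (K + 1)) ^ (2 * (K + 1)) :=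
          pow_le_pow_right₀ hA (by omega)
      _ ≤ _ := le_mul_of_one_le_left (by positivity) hC1
  · have hn : 1 ≤ n := by
      by_contra h
      obtain rfl : n = 0 := by omega
      push_cast at hKr
      linarith
    have hn0 : (0 : ℝ) < n := by exact_mod_cast hn
    set δ := (b - a) / n with hδ
    have hδ0 : 0 < δ := by positivity
    have hδx : δ ≤ (K + 1) * x := by
      rw [hδ, hx, mul_div_assoc', div_le_div_iff₀ hn0 hr0]
      push_cast
      have hn1 : (1 : ℝ) ≤ n := by exact_mod_cast hn
      have : (n : ℝ) + K ≤ (K + 1) * n := by nlinarith [K.cast_nonneg (α := ℝ)]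
      nlinarith
    have h1 : VecApprox a b n (g K) (C * δ ^ (2 * θ) * Q) := by
      refine ⟨fun i => C / δ * modulus a b δ (fun x => g K x i), fun i =>
        hC a b n _ hab hn (memLp_coord (hg.memLp K le_rfl) i), ?_⟩
      rw [← Finset.mul_sum]
      have h2 := hS.2 h0 δ hδ0
      have h3 : MemLp (fun z : ℝ × ℝ => g K z.1 - g K z.2) 2
          (((volume.restrict (Ioc a b)).prod (volume.restrict (Ioc a b))).restrict
            {z : ℝ × ℝ | |z.1 - z.2| ≤ δ}) :=
        (((hg.memLp K le_rfl).comp_fst _).sub ((hg.memLp K le_rfl).comp_snd _)).restrict _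
      rw [integral_norm_sq_eq_sum h3] at h2
      have h4 : ∑ i, modulus a b δ (fun x => g K x i) ≤ δ ^ (1 + 2 * θ) * Q := h2
      calc C / δ * ∑ i, modulus a b δ (fun x => g K x i) ≤ C / δ * (δ ^ (1 + 2 * θ) * Q) := by
            gcongr
        _ = _ := by
            rw [Real.rpow_add hδ0, Real.rpow_one]; field_simp
    refine (hg.iterate hab hr h1).mono ?_
    have h5 : δ ^ (2 * θ) ≤ (K + 1) ^ 2 * x ^ (2 * θ) := by
      calc δ ^ (2 * θ) ≤ ((K + 1) * x) ^ (2 * θ) :=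
            Real.rpow_le_rpow hδ0.le hδx (by positivity)
        _ = ((K : ℝ) + 1) ^ (2 * θ) * x ^ (2 * θ) := Real.mul_rpow (by positivity) hx0.le
        _ ≤ _ := by
            gcongr
            rw [← Real.rpow_natCast]
            exact Real.rpow_le_rpow_of_exponent_le (by linarith [K.cast_nonneg (α := ℝ)])
              (by push_cast; linarith)
    have h6 : x ^ (2 * (K + θ)) = x ^ (2 * K) * x ^ (2 * θ) := by
      rw [mul_add, Real.rpow_add hx0, hxp]
    rw [← hx, h6, mul_pow]
    calc (2 * ((K : ℝ) + 1)) ^ (2 * K) * x ^ (2 * K) * (C * δ ^ (2 * θ) * Q)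
        ≤ (2 * ((K : ℝ) + 1)) ^ (2 * K) * x ^ (2 * K) *
          (max C 1 * ((2 * (K + 1)) ^ 2 * x ^ (2 * θ)) * Q) := by
          gcongr
          · exact le_max_left _ _
          · refine h5.trans ?_
            gcongr
            linarith [K.cast_nonneg (α := ℝ)]
      _ = _ := by rw [mul_add 2 K 1, pow_add, mul_one]; ring

lemma IsChain.tail {K L : ℕ} {g : ℕ → ℝ → EuclideanSpace ℝ (Fin M)} (h : IsChain a b L g)
    (hKL : K + 1 ≤ L) : IsChain a b K (fun j => g (j + 1)) :=
  ⟨fun j hj => h.memLp _ (by omega), fun j hj => h.primitive _ (by omega)⟩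

/-- Polynomial approximation of the first derivative of a function of Sobolev order `s = K + θ`, in
the scaling in which it enters the Galerkin error. -/
lemma exists_vecApprox_deriv (s : ℝ) (hs : 1 ≤ s) : ∃ C : ℝ, 1 ≤ C ∧
    ∀ (M : ℕ) (a b τ : ℝ) (r : ℕ) (Q : ℝ) (u : ℕ → ℝ → EuclideanSpace ℝ (Fin M)),
      a < b → b - a ≤ τ → 1 ≤ r → IsChain a b ⌊s⌋₊ u →
      (∀ j ≤ ⌊s⌋₊, ∫ x in a..b, ‖u j x‖ ^ 2 ≤ Q) →
      SeminormBound a b (Int.fract s) (u ⌊s⌋₊) Q →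
      ∃ ε, VecApprox a b r (u 1) ε ∧
        ((b - a) / r) ^ 2 * ε ≤ C * (τ ^ min ((r : ℝ) + 1) s / (r : ℝ) ^ s) ^ 2 * Q := by
  obtain ⟨C, hC1, hC⟩ := exists_vecApprox_of_chain
  set K := ⌊s⌋₊ with hK
  set θ := Int.fract s with hθ
  have hsK : s = K + θ := by
    have h1 := Int.floor_add_fract s
    have h2 : ((⌊s⌋₊ : ℕ) : ℝ) = ⌊s⌋ := natCast_floor_eq_intCast_floor (by linarith)
    rw [hK, h2, hθ, h1]
  have hθ0 : 0 ≤ θ := Int.fract_nonneg s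
  have hθ1 : θ < 1 := Int.fract_lt_one s
  have hK1 : 1 ≤ K := Nat.le_floor (by exact_mod_cast hs)
  have hss : 1 ≤ s ^ s := Real.one_le_rpow hs (by linarith)
  set B : ℝ := (2 * (K + 1)) ^ (2 * (K + 1)) with hB
  have hB1 : 1 ≤ B := one_le_pow₀ (by linarith [K.cast_nonneg (α := ℝ)])
  have hBmono : ∀ k : ℕ, k + 1 ≤ K + 1 → (2 * ((k : ℝ) + 1)) ^ (2 * (k + 1)) ≤ B := by
    intro k hk
    have hk' : (k : ℝ) ≤ K := by exact_mod_cast (by omega : k ≤ K)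
    calc (2 * ((k : ℝ) + 1)) ^ (2 * (k + 1)) ≤ (2 * ((K : ℝ) + 1)) ^ (2 * (k + 1)) := by gcongr
      _ ≤ _ := pow_le_pow_right₀ (by linarith [K.cast_nonneg (α := ℝ)]) (by omega)
  refine ⟨C * B * (s ^ s) ^ 2, one_le_mul_of_one_le_of_one_le
    (one_le_mul_of_one_le_of_one_le hC1 hB1) (one_le_pow₀ hss), ?_⟩
  intro M a b τ r Q u hab hτ hr hch hQ hS
  have hh : 0 < b - a := by linarith
  have hr0 : (0 : ℝ) < r := by exact_mod_cast hr
  have hr1 : (1 : ℝ) ≤ r := by exact_mod_cast hr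
  have hQ0 : 0 ≤ Q := (intervalIntegral.integral_nonneg hab.le fun _ _ => sq_nonneg _).trans
    (hQ 0 (Nat.zero_le _))
  set x := (b - a) / r with hx
  have hx0 : 0 < x := by positivity
  -- If s ≤ r + 1 the full order s - 1 of the derivative is used. Otherwise degree less than r
  -- cannot exploit more than r further derivatives, so the chain stops at order r + 1; the missing
  -- powers of r are harmless since r < s gives r^s ≤ s^s.
  rcases le_or_gt s (r + 1) with hsr | hsr
  · obtain ⟨k, hk⟩ : ∃ k, K = k + 1 := ⟨K - 1, by omega⟩
    have hks : (k : ℝ) + θ = s - 1 := by rw [hsK, hk]; push_cast; ring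
    have h1 := hC M a b r k θ Q (fun j => u (j + 1)) hab hr hθ0 hθ1 (by linarith) hQ0
      (hch.tail (by omega)) (by rw [← hk]; exact hS)
    refine ⟨_, h1, ?_⟩
    rw [min_eq_right hsr, hks]
    have e1 : x ^ 2 * x ^ (2 * (s - 1)) = (x ^ s) ^ 2 := by
      rw [← Real.rpow_natCast (x ^ s) 2, ← Real.rpow_mul hx0.le, ← Real.rpow_natCast x 2,
        ← Real.rpow_add hx0]
      congr 1; push_cast; ring
    have e2 : x ^ s ≤ τ ^ s / r ^ s := by
      rw [hx, Real.div_rpow hh.le hr0.le]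
      gcongr
    have e3 : x ^ 2 * (C * (2 * ((k : ℝ) + 1)) ^ (2 * (k + 1)) * x ^ (2 * (s - 1)) * Q) =
        C * (2 * ((k : ℝ) + 1)) ^ (2 * (k + 1)) * (x ^ 2 * x ^ (2 * (s - 1))) * Q := by ring
    rw [e3, e1]
    have hp : 0 ≤ x ^ s := by positivity
    have h2 := hBmono k (by omega)
    calc C * (2 * ((k : ℝ) + 1)) ^ (2 * (k + 1)) * (x ^ s) ^ 2 * Q
        ≤ C * B * (τ ^ s / r ^ s) ^ 2 * Q := by gcongr
      _ ≤ C * B * (s ^ s) ^ 2 * (τ ^ s / r ^ s) ^ 2 * Q := by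
          refine mul_le_mul_of_nonneg_right (mul_le_mul_of_nonneg_right
            (le_mul_of_one_le_right (by positivity) (one_le_pow₀ hss)) (sq_nonneg _)) hQ0
  · have hrK : r + 1 ≤ K := by
      have : ((r + 1 : ℕ) : ℝ) ≤ s := by push_cast; exact hsr.le
      exact Nat.le_floor this
    have h1 := hC M a b r r 0 Q (fun j => u (j + 1)) hab hr le_rfl one_pos (by simp) hQ0
      (hch.tail (by omega)) ⟨fun _ => hQ _ hrK, fun h => absurd h (lt_irrefl _)⟩
    refine ⟨_, h1, ?_⟩
    rw [min_eq_left hsr.le, add_zero]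
    have e1 : x ^ 2 * x ^ (2 * (r : ℝ)) = (x ^ (r + 1)) ^ 2 := by
      rw [← Real.rpow_natCast, ← Real.rpow_natCast, ← Real.rpow_natCast x (r + 1),
        ← Real.rpow_mul hx0.le, ← Real.rpow_add hx0]
      congr 1; push_cast; ring
    have hxτ : x ≤ τ := (div_le_self hh.le hr1).trans hτ
    have e2 : x ^ (r + 1) ≤ s ^ s * (τ ^ ((r : ℝ) + 1) / r ^ s) := by
      have h3 : x ^ (r + 1) ≤ τ ^ ((r : ℝ) + 1) := by
        have : τ ^ ((r : ℝ) + 1) = τ ^ (r + 1) := by rw [← Real.rpow_natCast]; push_cast; rfl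
        rw [this]
        gcongr
      have h4 : (r : ℝ) ^ s ≤ s ^ s := Real.rpow_le_rpow hr0.le (by linarith) (by linarith)
      have h5 : (0 : ℝ) < (r : ℝ) ^ s := by positivity
      rw [mul_div_assoc', le_div_iff₀ h5, mul_comm]
      gcongr
    have e3 : x ^ 2 * (C * (2 * ((r : ℝ) + 1)) ^ (2 * (r + 1)) * x ^ (2 * (r : ℝ)) * Q) =
        C * (2 * ((r : ℝ) + 1)) ^ (2 * (r + 1)) * (x ^ 2 * x ^ (2 * (r : ℝ))) * Q := by ring
    rw [e3, e1]
    have h2 := hBmono r (by omega)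
    calc C * (2 * ((r : ℝ) + 1)) ^ (2 * (r + 1)) * (x ^ (r + 1)) ^ 2 * Q
        ≤ C * B * (s ^ s * (τ ^ ((r : ℝ) + 1) / r ^ s)) ^ 2 * Q := by gcongr
      _ = _ := by ring

end Chain

/-! ### Sobolev norms: local contributions, and the regularity of `D Y` -/

lemma MemLp.toReal_eLpNorm_two_sq {α E : Type*} [MeasurableSpace α] [NormedAddCommGroup E]
    {μ : Measure α} {f : α → E} (hf : MemLp f 2 μ) :
    (eLpNorm f 2 μ).toReal ^ 2 = ∫ x, ‖f x‖ ^ 2 ∂μ := by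
  have h0 : 0 ≤ ∫ x, ‖f x‖ ^ 2 ∂μ := integral_nonneg fun _ => sq_nonneg _
  rw [hf.eLpNorm_eq_integral_rpow_norm two_ne_zero ENNReal.ofNat_ne_top]
  simp only [ENNReal.toReal_ofNat, Real.rpow_two]
  rw [ENNReal.toReal_ofReal (by positivity), ← Real.rpow_natCast, ← Real.rpow_mul h0]
  norm_num

/-- The square integrable quotient whose norm is the Slobodeckij seminorm. -/
def slobodeckijQuot {E : Type*} [NormedAddCommGroup E] [NormedSpace ℝ E] (θ : ℝ) (g : ℝ → E)
    (z : ℝ × ℝ) : E :=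
  (|z.1 - z.2| ^ (θ + 1 / 2))⁻¹ • (g z.1 - g z.2)

lemma slobodeckij_two_eq {E : Type*} [NormedAddCommGroup E] [NormedSpace ℝ E] (a b θ : ℝ)
    (g : ℝ → E) : slobodeckij a b θ 2 g = eLpNorm (slobodeckijQuot θ g) 2
      ((volume.restrict (Ioc a b)).prod (volume.restrict (Ioc a b))) := by
  rw [slobodeckij, restrict_Ioo_eq_restrict_Ioc]
  congr 1
  ext z
  simp [slobodeckijQuot]

lemma memLp_slobodeckijQuot {E : Type*} [NormedAddCommGroup E] [NormedSpace ℝ E] {a b θ : ℝ}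
    {g : ℝ → E} (hg : MemLp g 2 (volume.restrict (Ioc a b))) (h : slobodeckij a b θ 2 g < ∞) :
    MemLp (slobodeckijQuot θ g) 2
      ((volume.restrict (Ioc a b)).prod (volume.restrict (Ioc a b))) := by
  rw [slobodeckij_two_eq] at h
  refine ⟨?_, h⟩
  have h1 : Measurable fun z : ℝ × ℝ => (|z.1 - z.2| ^ (θ + 1 / 2))⁻¹ := by fun_prop
  exact h1.aestronglyMeasurable.smul ((hg.comp_fst _).sub (hg.comp_snd _)).1

/-- On the strip |x - y| ≤ δ the singular weight of the Slobodeckij integral is bounded below, which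
is how that seminorm controls the averaged modulus of continuity. -/
lemma norm_sub_sq_le_slobodeckijQuot {E : Type*} [NormedAddCommGroup E] [NormedSpace ℝ E]
    {θ δ : ℝ} (hθ : 0 < θ) (g : ℝ → E) {z : ℝ × ℝ} (hz : |z.1 - z.2| ≤ δ) :
    ‖g z.1 - g z.2‖ ^ 2 ≤ δ ^ (1 + 2 * θ) * ‖slobodeckijQuot θ g z‖ ^ 2 := by
  rcases (abs_nonneg (z.1 - z.2)).eq_or_lt with h0 | h0
  · have : z.1 = z.2 := sub_eq_zero.1 (abs_eq_zero.1 h0.symm)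
    have hδ : 0 ≤ δ := h0.le.trans hz
    rw [this, sub_self, norm_zero, zero_pow two_ne_zero]
    positivity
  · have e : ‖g z.1 - g z.2‖ ^ 2 =
        |z.1 - z.2| ^ (1 + 2 * θ) * ‖slobodeckijQuot θ g z‖ ^ 2 := by
      have hp : 0 < |z.1 - z.2| ^ (θ + 1 / 2) := Real.rpow_pos_of_pos h0 _
      have e1 : |z.1 - z.2| ^ (1 + 2 * θ) = (|z.1 - z.2| ^ (θ + 1 / 2)) ^ 2 := by
        rw [← Real.rpow_natCast, ← Real.rpow_mul h0.le]
        congr 1; push_cast; ring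
      rw [slobodeckijQuot, norm_smul, norm_inv, Real.norm_of_nonneg hp.le, e1]
      field_simp
    rw [e]
    gcongr

lemma sum_setIntegral_le {α ι : Type*} [Fintype ι] [MeasurableSpace α] {μ : Measure α}
    {s : ι → Set α} {S : Set α} {f : α → ℝ} (hs : ∀ i, MeasurableSet (s i))
    (hd : Pairwise fun i j => Disjoint (s i) (s j)) (hsub : ∀ i, s i ⊆ S) (hf : ∀ x, 0 ≤ f x)
    (hi : IntegrableOn f S μ) : ∑ i, ∫ x in s i, f x ∂μ ≤ ∫ x in S, f x ∂μ := by
  rw [← integral_iUnion_fintype hs hd fun i => hi.mono_set (hsub i)]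
  exact setIntegral_mono_set hi (Filter.Eventually.of_forall hf)
    (Filter.Eventually.of_forall (iUnion_subset hsub))

/-! ### Partitions and restriction to their intervals -/

section Partition

variable {T : ℝ} {N : ℕ} {t : Fin (N + 1) → ℝ}

lemma IsPartition.nonneg (h : IsPartition T t) (n : Fin (N + 1)) : 0 ≤ t n := by
  rw [← h.2.1]; exact h.1.monotone (Fin.zero_le n)

lemma IsPartition.le (h : IsPartition T t) (n : Fin (N + 1)) : t n ≤ T := by
  rw [← h.2.2]; exact h.1.monotone (Fin.le_last n)

lemma IsPartition.lt (h : IsPartition T t) (n : Fin N) : t n.castSucc < t n.succ :=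
  h.1 Fin.castSucc_lt_succ

lemma IsPartition.step_le (_ : IsPartition T t) (n : Fin N) :
    t n.succ - t n.castSucc ≤ maxStep t :=
  le_ciSup (f := fun n : Fin N => t n.succ - t n.castSucc) (Set.finite_range _).bddAbove n

lemma IsPartition.sum_step (h : IsPartition T t) : ∑ n : Fin N, (t n.succ - t n.castSucc) = T := by
  have h1 := Fin.sum_univ_succ t
  have h2 := Fin.sum_univ_castSucc t
  rw [h.2.1] at h1
  rw [h.2.2] at h2
  rw [Finset.sum_sub_distrib]
  linarith

lemma IsPartition.disjoint (h : IsPartition T t) :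
    Pairwise fun m n : Fin N => Disjoint (Ioc (t m.castSucc) (t m.succ))
      (Ioc (t n.castSucc) (t n.succ)) := by
  have key : ∀ m n : Fin N, m < n → Disjoint (Ioc (t m.castSucc) (t m.succ))
      (Ioc (t n.castSucc) (t n.succ)) := by
    intro m n hmn
    have : t m.succ ≤ t n.castSucc := h.1.monotone (by
      rw [Fin.le_def, Fin.val_succ, Fin.val_castSucc]; exact hmn)
    rw [Set.disjoint_left]
    intro x hx hx'
    exact absurd (hx.2.trans this) (not_le.2 hx'.1)
  intro m n hmn
  rcases lt_or_gt_of_ne hmn with h' | h'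
  · exact key m n h'
  · exact (key n m h').symm

lemma IsPartition.subset (h : IsPartition T t) (n : Fin N) :
    Ioc (t n.castSucc) (t n.succ) ⊆ Ioc 0 T :=
  Ioc_subset_Ioc (h.nonneg _) (h.le _)

end Partition

lemma IsChain.restrict {M : ℕ} {T a b : ℝ} {K : ℕ} {g : ℕ → ℝ → EuclideanSpace ℝ (Fin M)}
    (h : IsChain 0 T K g) (ha : 0 ≤ a) (hab : a ≤ b) (hb : b ≤ T) : IsChain a b K g := by
  have hsub : Ioc a b ⊆ Ioc 0 T := Ioc_subset_Ioc ha hb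
  refine ⟨fun j hj => (h.memLp j hj).mono_measure (Measure.restrict_mono hsub le_rfl),
    fun j hj i => ?_⟩
  obtain ⟨c, hc⟩ := h.primitive j hj i
  have hi : IntervalIntegrable (fun x => g (j + 1) x i) volume 0 T :=
    intervalIntegrable_of_memLp (ha.trans (hab.trans hb)) (memLp_coord (h.memLp _ hj) i)
  refine ⟨c + ∫ t in (0 : ℝ)..a, g (j + 1) t i, ?_⟩
  have hc' := ae_restrict_of_ae_restrict_of_subset hsub hc
  filter_upwards [hc', ae_restrict_mem measurableSet_Ioc] with x hx hx'
  have hle : a ≤ T := hab.trans hb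
  rw [hx, add_assoc, intervalIntegral.integral_add_adjacent_intervals
    (hi.mono_set (by
      rw [uIcc_of_le ha, uIcc_of_le (ha.trans hle)]; exact Icc_subset_Icc_right hle))
    (hi.mono_set (by
      rw [uIcc_of_le hx'.1.le, uIcc_of_le (ha.trans hle)]
      exact Icc_subset_Icc ha (hx'.2.trans hb)))]

section Sobolev

variable {M : ℕ} {T s : ℝ} {p : ℝ≥0∞} {u : ℝ → EuclideanSpace ℝ (Fin M)}

lemma MemSobolev.hasWeakDeriv (h : MemSobolev 0 T s p u) {j : ℕ} (hj : j ≤ ⌊s⌋₊) :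
    HasWeakDeriv 0 T j u (weakDeriv 0 T j u) :=
  let ⟨_, hv, _⟩ := h.1 j hj; hasWeakDeriv_weakDeriv hv

/-- The definition only provides some representative in L^p; by uniqueness of weak derivatives the
chosen one agrees with it almost everywhere. -/
lemma MemSobolev.memLp_weakDeriv (h : MemSobolev 0 T s p u) {j : ℕ} (hj : j ≤ ⌊s⌋₊) :
    MemLp (weakDeriv 0 T j u) p (volume.restrict (Ioc 0 T)) := by
  obtain ⟨v, hv, hv'⟩ := h.1 j hj
  rw [← restrict_Ioo_eq_restrict_Ioc]
  exact hv'.ae_eq (hv.unique (hasWeakDeriv_weakDeriv hv))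

lemma MemSobolev.memLp_two (h : MemSobolev 0 T s p u) (hp : 2 ≤ p) {j : ℕ} (hj : j ≤ ⌊s⌋₊) :
    MemLp (weakDeriv 0 T j u) 2 (volume.restrict (Ioc 0 T)) :=
  (h.memLp_weakDeriv hj).mono_exponent hp

lemma MemSobolev.isChain (hT : 0 < T) (h : MemSobolev 0 T s p u) (hp : 2 ≤ p) :
    IsChain 0 T ⌊s⌋₊ (fun j => weakDeriv 0 T j u) := by
  refine ⟨fun j hj => h.memLp_two hp hj, fun j hj i => ?_⟩
  have h1 := (h.hasWeakDeriv hj.le).of_add (h.hasWeakDeriv (j := j + 1) hj)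
  have h2 := h1.comp_clm (EuclideanSpace.proj (𝕜 := ℝ) i)
  exact h2.exists_ae_eq_primitive hT
    ((memLp_coord (h.memLp_two hp (j := j + 1) hj) i).integrable (by norm_num))

lemma MemSobolev.slobodeckij_lt_top (h : MemSobolev 0 T s p u) (hs : Int.fract s ≠ 0) :
    slobodeckij 0 T (Int.fract s) p (weakDeriv 0 T ⌊s⌋₊ u) < ∞ := by
  have := h.2
  rwa [fracSeminorm, if_neg hs] at this

/-- The square of the `H^s` norm splits into contributions of the intervals of a partition. -/
lemma MemSobolev.exists_local (h : MemSobolev 0 T s 2 u) {N : ℕ}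
    {t : Fin (N + 1) → ℝ} (ht : IsPartition T t) :
    ∃ Q : Fin N → ℝ, (∀ n, ∀ j ≤ ⌊s⌋₊,
        ∫ x in (t n.castSucc)..(t n.succ), ‖weakDeriv 0 T j u x‖ ^ 2 ≤ Q n) ∧
      (∀ n, SeminormBound (t n.castSucc) (t n.succ) (Int.fract s) (weakDeriv 0 T ⌊s⌋₊ u) (Q n)) ∧
      ∑ n, Q n ≤ normH 0 T s u ^ 2 := by
  classical
  set θ := Int.fract s with hθ
  set K := ⌊s⌋₊ with hK
  set v : ℕ → ℝ → EuclideanSpace ℝ (Fin M) := fun j => weakDeriv 0 T j u with hv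
  have hvL : ∀ j ≤ K, MemLp (v j) 2 (volume.restrict (Ioc 0 T)) := fun j hj =>
    h.memLp_two le_rfl hj
  set I : Fin N → Set ℝ := fun n => Ioc (t n.castSucc) (t n.succ) with hI
  set F : ℝ × ℝ → ℝ := fun z => ‖slobodeckijQuot θ (v K) z‖ ^ 2 with hF
  -- Only the part of the double integral over the diagonal square of each interval is kept. These
  -- squares are disjoint subsets of the full square, so their contributions sum to at most the
  -- global seminorm.
  set P : Fin N → ℝ := fun n => if θ = 0 then 0 else ∫ z in I n ×ˢ I n, F z with hP
  have hP0 : ∀ n, 0 ≤ P n := fun n => by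
    simp only [hP]; split_ifs
    · exact le_rfl
    · exact integral_nonneg fun _ => sq_nonneg _
  have hFi : θ ≠ 0 → IntegrableOn F (Ioc 0 T ×ˢ Ioc 0 T) := fun h0 => by
    have := (memLp_slobodeckijQuot (hvL K le_rfl) (h.slobodeckij_lt_top h0)).norm.integrable_sq
    rwa [Measure.prod_restrict] at this
  have hnn : ∀ n j, 0 ≤ ∫ x in I n, ‖v j x‖ ^ 2 := fun n j => integral_nonneg fun _ => sq_nonneg _
  refine ⟨fun n => (∑ j ∈ Finset.range (K + 1), ∫ x in I n, ‖v j x‖ ^ 2) + P n, ?_, ?_, ?_⟩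
  · intro n j hj
    rw [intervalIntegral.integral_of_le (ht.lt n).le]
    have := Finset.single_le_sum (f := fun j => ∫ x in I n, ‖v j x‖ ^ 2)
      (fun j _ => hnn n j) (Finset.mem_range.2 (Nat.lt_succ_of_le hj))
    linarith [hP0 n]
  · intro n
    have hle : ∫ x in I n, ‖v K x‖ ^ 2 ≤ ∑ j ∈ Finset.range (K + 1), ∫ x in I n, ‖v j x‖ ^ 2 :=
      Finset.single_le_sum (f := fun j => ∫ x in I n, ‖v j x‖ ^ 2)
        (fun j _ => hnn n j) (Finset.mem_range.2 (Nat.lt_succ_self K))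
    refine ⟨fun _ => ?_, fun h0 δ hδ => ?_⟩
    · rw [intervalIntegral.integral_of_le (ht.lt n).le]
      linarith [hP0 n]
    · have hsub : I n ×ˢ I n ⊆ Ioc 0 T ×ˢ Ioc 0 T := prod_mono (ht.subset n) (ht.subset n)
      have hFn : IntegrableOn F (I n ×ˢ I n) := (hFi h0.ne').mono_set hsub
      have hvn : MemLp (v K) 2 (volume.restrict (I n)) :=
        (hvL K le_rfl).mono_measure (Measure.restrict_mono (ht.subset n) le_rfl)
      have hdi : Integrable (fun z : ℝ × ℝ => ‖v K z.1 - v K z.2‖ ^ 2)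
          ((volume.restrict (I n)).prod (volume.restrict (I n))) :=
        (((hvn.comp_fst _).sub (hvn.comp_snd _)).norm).integrable_sq
      have hF' : Integrable F ((volume.restrict (I n)).prod (volume.restrict (I n))) := by
        rw [Measure.prod_restrict]; exact hFn
      calc _ ≤ ∫ z in {z : ℝ × ℝ | |z.1 - z.2| ≤ δ}, δ ^ (1 + 2 * θ) * F z
            ∂((volume.restrict (I n)).prod (volume.restrict (I n))) := by
            refine setIntegral_mono_on hdi.integrableOn (hF'.const_mul _).integrableOn
              (measurableSet_strip δ) fun z hz => ?_
            exact norm_sub_sq_le_slobodeckijQuot h0 (v K) hz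
        _ = δ ^ (1 + 2 * θ) * ∫ z in {z : ℝ × ℝ | |z.1 - z.2| ≤ δ}, F z
            ∂((volume.restrict (I n)).prod (volume.restrict (I n))) := integral_const_mul _ _
        _ ≤ δ ^ (1 + 2 * θ) * ∫ z in I n ×ˢ I n, F z := by
            refine mul_le_mul_of_nonneg_left ((setIntegral_le_integral hF'
              (Filter.Eventually.of_forall fun _ => sq_nonneg _)).trans (le_of_eq ?_))
              (by positivity)
            rw [Measure.prod_restrict]; rfl
        _ ≤ _ := by
            gcongr
            have : ∫ z in I n ×ˢ I n, F z = P n := by simp only [hP, if_neg h0.ne']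
            rw [this]
            have := Finset.sum_nonneg fun j (_ : j ∈ Finset.range (K + 1)) => hnn n j
            linarith
  · rw [normH, Real.sq_sqrt (by positivity), Finset.sum_add_distrib, Finset.sum_comm]
    refine add_le_add (Finset.sum_le_sum fun j hj => ?_) ?_
    · have hj' : j ≤ K := Nat.le_of_lt_succ (Finset.mem_range.1 hj)
      rw [restrict_Ioo_eq_restrict_Ioc, MemLp.toReal_eLpNorm_two_sq (hvL j hj')]
      exact sum_setIntegral_le (fun n => measurableSet_Ioc) ht.disjoint ht.subset
        (fun _ => sq_nonneg _) (hvL j hj').norm.integrable_sq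
    · rw [fracSeminorm]
      by_cases h0 : θ = 0
      · simp [hP, h0]
      · rw [if_neg h0, slobodeckij_two_eq, MemLp.toReal_eLpNorm_two_sq
          (memLp_slobodeckijQuot (hvL K le_rfl) (h.slobodeckij_lt_top h0)), Measure.prod_restrict]
        simp only [hP, if_neg h0]
        refine sum_setIntegral_le (fun n => measurableSet_Ioc.prod measurableSet_Ioc)
          (fun m n hmn => ?_) (fun n => prod_mono (ht.subset n) (ht.subset n))
          (fun _ => sq_nonneg _) (hFi h0)
        exact Set.disjoint_prod.2 (Or.inl (ht.disjoint hmn))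

end Sobolev

/-! #### The Hölder scale -/

/-- The function is the integrand of the convolution of two integrable functions, the indicator of
(0, T] and |x|^α cut off to (-T, T]. -/
lemma integrable_abs_sub_rpow {T α : ℝ} (hα : -1 < α) :
    Integrable (fun z : ℝ × ℝ => |z.1 - z.2| ^ α)
      ((volume.restrict (Ioc 0 T)).prod (volume.restrict (Ioc 0 T))) := by
  rcases le_or_gt T 0 with hT | hT
  · simp [Ioc_eq_empty (not_lt.2 hT)]
  have h1 : IntegrableOn (fun x : ℝ => |x| ^ α) (Ioc (-T) T) := by
    have h2 : IntervalIntegrable (fun x : ℝ => |x| ^ α) volume 0 T := by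
      refine (intervalIntegral.intervalIntegrable_rpow' hα).congr fun x hx => ?_
      rw [uIoc_of_le hT.le] at hx
      simp only [abs_of_pos hx.1]
    have h3 : IntervalIntegrable (fun x : ℝ => |x| ^ α) volume (-T) 0 := by
      have := ((IntervalIntegrable.iff_comp_neg (by simp)).1 h2).symm
      simpa using this
    exact (intervalIntegrable_iff_integrableOn_Ioc_of_le (by linarith)).1 (h3.trans h2)
  have hf : Integrable ((Ioc 0 T).indicator fun _ : ℝ => (1 : ℝ)) volume :=
    (integrable_indicator_iff measurableSet_Ioc).2 (by simp)
  have hg : Integrable ((Ioc (-T) T).indicator fun x : ℝ => |x| ^ α) volume :=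
    (integrable_indicator_iff measurableSet_Ioc).2 h1
  have h4 := hf.convolution_integrand (ContinuousLinearMap.mul ℝ ℝ) hg
  have h5 : IntegrableOn (fun z : ℝ × ℝ => |z.1 - z.2| ^ α) (Ioc 0 T ×ˢ Ioc 0 T) := by
    refine (h4.integrableOn (s := Ioc 0 T ×ˢ Ioc 0 T)).congr_fun (fun z hz => ?_)
      (measurableSet_Ioc.prod measurableSet_Ioc)
    have hz1 := hz.1
    have hz2 := hz.2
    have h6 : z.1 - z.2 ∈ Ioc (-T) T :=
      ⟨by linarith [hz1.1, hz2.2], by linarith [hz1.2, hz2.1]⟩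
    simp [hz2, h6]
  rwa [IntegrableOn, Measure.volume_eq_prod, ← Measure.prod_restrict] at h5

/-- The quotient is at most L|x - y|^(1/2 - θ), whose square has exponent 1 - 2θ; this exceeds -1
exactly when θ < 1. -/
lemma slobodeckij_lt_top_of_lipschitz {E : Type*} [NormedAddCommGroup E] [NormedSpace ℝ E]
    {T θ L : ℝ} (hθ1 : θ < 1) {g w : ℝ → E}
    (hgw : g =ᵐ[volume.restrict (Ioc 0 T)] w)
    (hw : ∀ x ∈ Ioc 0 T, ∀ y ∈ Ioc 0 T, ‖w x - w y‖ ≤ L * |x - y|) :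
    slobodeckij 0 T θ 2 g < ∞ := by
  rw [slobodeckij_two_eq]
  set μ := volume.restrict (Ioc 0 T)
  have h1 : slobodeckijQuot θ g =ᵐ[μ.prod μ] slobodeckijQuot θ w := by
    filter_upwards [(Measure.quasiMeasurePreserving_fst (μ := μ) (ν := μ)).ae_eq_comp hgw,
      (Measure.quasiMeasurePreserving_snd (μ := μ) (ν := μ)).ae_eq_comp hgw] with z h1 h2
    simp only [Function.comp_apply] at h1 h2
    simp only [slobodeckijQuot, h1, h2]
  rw [eLpNorm_congr_ae h1]
  have h2 : MemLp (fun z : ℝ × ℝ => L * |z.1 - z.2| ^ (1 / 2 - θ)) 2 (μ.prod μ) := by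
    refine MemLp.const_mul ((memLp_two_iff_integrable_sq
      (Measurable.aestronglyMeasurable (by fun_prop))).2 ?_) L
    have := integrable_abs_sub_rpow (T := T) (α := 2 * (1 / 2 - θ)) (by linarith)
    refine this.congr (Filter.Eventually.of_forall fun z => ?_)
    simp only
    rw [← Real.rpow_natCast, ← Real.rpow_mul (abs_nonneg _)]
    congr 1; push_cast; ring
  refine lt_of_le_of_lt (eLpNorm_mono_ae ?_) h2.2
  have h3 : ∀ᵐ z ∂(μ.prod μ), z ∈ Ioc (0 : ℝ) T ×ˢ Ioc (0 : ℝ) T := by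
    simp only [μ, Measure.prod_restrict]
    exact ae_restrict_mem (measurableSet_Ioc.prod measurableSet_Ioc)
  filter_upwards [h3] with z hz
  rcases (abs_nonneg (z.1 - z.2)).eq_or_lt with h0 | h0
  · have : z.1 = z.2 := sub_eq_zero.1 (abs_eq_zero.1 h0.symm)
    rw [slobodeckijQuot, this, sub_self (w z.2), smul_zero, norm_zero]
    exact norm_nonneg _
  · have hp : 0 < |z.1 - z.2| ^ (θ + 1 / 2) := Real.rpow_pos_of_pos h0 _
    rw [slobodeckijQuot, norm_smul, norm_inv, Real.norm_of_nonneg hp.le, inv_mul_le_iff₀ hp]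
    refine (hw z.1 hz.1 z.2 hz.2).trans ?_
    have e : |z.1 - z.2| ^ (θ + 1 / 2) * |z.1 - z.2| ^ (1 / 2 - θ) = |z.1 - z.2| := by
      rw [← Real.rpow_add h0, show θ + 1 / 2 + (1 / 2 - θ) = 1 by ring, Real.rpow_one]
    calc L * |z.1 - z.2| = |z.1 - z.2| ^ (θ + 1 / 2) * (L * |z.1 - z.2| ^ (1 / 2 - θ)) := by
          rw [mul_left_comm, e]
      _ ≤ _ := by gcongr; exact le_abs_self _

/-- The Hölder bound on small intervals. -/
lemma seminormBound_of_holder {M : ℕ} {a b θ L : ℝ} (hab : a ≤ b) (hθ : 0 ≤ θ) (hL : 0 ≤ L)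
    {g : ℝ → EuclideanSpace ℝ (Fin M)} (hg : MemLp g 2 (volume.restrict (Ioc a b)))
    (h0 : ∀ᵐ x ∂(volume.restrict (Ioc a b)), ‖g x‖ ≤ L)
    (h1 : 0 < θ → ∀ᵐ z ∂((volume.restrict (Ioc a b)).prod (volume.restrict (Ioc a b))),
      ‖g z.1 - g z.2‖ ≤ L * |z.1 - z.2| ^ θ) :
    SeminormBound a b θ g (2 * (b - a) * L ^ 2) := by
  have hh : 0 ≤ b - a := by linarith
  refine ⟨fun _ => ?_, fun hθ0 δ hδ => ?_⟩
  · rw [intervalIntegral.integral_of_le hab]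
    calc ∫ x in Ioc a b, ‖g x‖ ^ 2 ≤ ∫ _ in Ioc a b, L ^ 2 := by
          refine integral_mono_ae hg.norm.integrable_sq (integrable_const _) ?_
          filter_upwards [h0] with x hx
          gcongr
      _ = (b - a) * L ^ 2 := by simp [hh]
      _ ≤ _ := by
          have : 0 ≤ (b - a) * L ^ 2 := by positivity
          linarith
  · set μ := volume.restrict (Ioc a b) with hμ
    set S := {z : ℝ × ℝ | |z.1 - z.2| ≤ δ} with hS
    have hSm : MeasurableSet S := measurableSet_strip δ
    have hdi : Integrable (fun z : ℝ × ℝ => ‖g z.1 - g z.2‖ ^ 2) (μ.prod μ) :=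
      (((hg.comp_fst _).sub (hg.comp_snd _)).norm).integrable_sq
    -- Each slice of the strip has length at most 2δ. This factor δ is the extra power in δ^(1 +
    -- 2θ), and b - a makes the local bounds sum to a multiple of T.
    have hmeas : (μ.prod μ) S ≤ ENNReal.ofReal (2 * δ * (b - a)) := by
      rw [Measure.prod_apply hSm]
      calc ∫⁻ x, μ (Prod.mk x ⁻¹' S) ∂μ ≤ ∫⁻ _, ENNReal.ofReal (2 * δ) ∂μ := by
            refine lintegral_mono fun x => ?_
            have : Prod.mk x ⁻¹' S ⊆ Icc (x - δ) (x + δ) := fun y hy => by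
              have hy' : |x - y| ≤ δ := hy
              rw [abs_le] at hy'
              exact ⟨by linarith, by linarith⟩
            refine (Measure.restrict_apply_le _ _).trans ((measure_mono this).trans ?_)
            rw [Real.volume_Icc]
            exact ENNReal.ofReal_le_ofReal (by linarith)
        _ = _ := by
            rw [lintegral_const, hμ, Measure.restrict_apply_univ, Real.volume_Ioc,
              ← ENNReal.ofReal_mul (by positivity)]
    calc ∫ z in S, ‖g z.1 - g z.2‖ ^ 2 ∂(μ.prod μ) ≤
          ∫ _ in S, δ ^ (2 * θ) * L ^ 2 ∂(μ.prod μ) := by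
          refine integral_mono_ae hdi.integrableOn (integrable_const _) ?_
          filter_upwards [ae_restrict_of_ae (h1 hθ0), ae_restrict_mem hSm] with z hz hzS
          have h2 : |z.1 - z.2| ^ θ ≤ δ ^ θ := Real.rpow_le_rpow (abs_nonneg _) hzS hθ
          have h3 : δ ^ (2 * θ) = (δ ^ θ) ^ 2 := by
            rw [← Real.rpow_natCast, ← Real.rpow_mul hδ.le]; congr 1; push_cast; ring
          rw [h3, ← mul_pow]
          refine pow_le_pow_left₀ (norm_nonneg _) (hz.trans ?_) 2
          rw [mul_comm]
          gcongr
      _ = ((μ.prod μ) S).toReal * (δ ^ (2 * θ) * L ^ 2) := by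
          simp [Measure.real]
      _ ≤ (2 * δ * (b - a)) * (δ ^ (2 * θ) * L ^ 2) := by
          gcongr
          exact ENNReal.toReal_le_of_le_ofReal (by positivity) hmeas
      _ = _ := by rw [Real.rpow_add hδ, Real.rpow_one]; ring

/-! ### Regularity of the exact solution -/

lemma ae_norm_le_of_eLpNorm_top_le {α E : Type*} [MeasurableSpace α] [NormedAddCommGroup E]
    {μ : Measure α} {f : α → E} {X : ℝ≥0∞} (h : eLpNorm f ∞ μ ≤ X) (hX : X ≠ ∞) :
    ∀ᵐ x ∂μ, ‖f x‖ ≤ X.toReal := by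
  rw [eLpNorm_exponent_top] at h
  filter_upwards [ae_le_eLpNormEssSup (f := f) (μ := μ)] with x hx
  rw [← toReal_enorm]
  exact ENNReal.toReal_mono hX (hx.trans h)

lemma floor_one_add {s : ℝ} (hs : 1 ≤ s) : ⌊1 + s⌋₊ = ⌊s⌋₊ + 1 := by
  rw [add_comm, Nat.floor_add_one (by linarith)]

/-- A matrix as a continuous linear map. -/
def matCLM {M : ℕ} (D : Matrix (Fin M) (Fin M) ℝ) :
    EuclideanSpace ℝ (Fin M) →L[ℝ] EuclideanSpace ℝ (Fin M) :=
  LinearMap.toContinuousLinearMap (Matrix.toEuclideanLin D)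

lemma matCLM_apply {M : ℕ} (D : Matrix (Fin M) (Fin M) ℝ) (u : ℝ → EuclideanSpace ℝ (Fin M))
    (x : ℝ) : matCLM D (u x) = matMul D u x := rfl

section Regularity

variable {M : ℕ} {T s : ℝ} {u Y : ℝ → EuclideanSpace ℝ (Fin M)}

lemma MemSobolev.normWInf_bounds (hs : 1 ≤ s) (h : MemSobolev 0 T (1 + s) ∞ Y) :
    (∀ j ≤ ⌊s⌋₊ + 1, ∀ᵐ x ∂(volume.restrict (Ioc 0 T)),
      ‖weakDeriv 0 T j Y x‖ ≤ normWInf 0 T (1 + s) Y) ∧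
    (0 < Int.fract s →
      ∀ᵐ z ∂((volume.restrict (Ioc 0 T)).prod (volume.restrict (Ioc 0 T))),
        ‖weakDeriv 0 T (⌊s⌋₊ + 1) Y z.1 - weakDeriv 0 T (⌊s⌋₊ + 1) Y z.2‖ ≤
          normWInf 0 T (1 + s) Y * |z.1 - z.2| ^ Int.fract s) := by
  have hK := floor_one_add hs
  have hfr : Int.fract (1 + s) = Int.fract s := Int.fract_one_add s
  have hL : ∀ j ≤ ⌊s⌋₊ + 1, eLpNorm (weakDeriv 0 T j Y) ∞ (volume.restrict (Ioc 0 T)) < ∞ :=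
    fun j hj => (h.memLp_weakDeriv (by rw [hK]; exact hj)).2
  set X := ((Finset.range (⌊s⌋₊ + 1 + 1)).sup
      fun j => eLpNorm (weakDeriv 0 T j Y) ∞ (volume.restrict (Ioc 0 T)))
    ⊔ fracSeminorm 0 T (1 + s) ∞ Y with hX
  have hXe : normWInf 0 T (1 + s) Y = X.toReal := by
    rw [normWInf, hK, restrict_Ioo_eq_restrict_Ioc]
  have hXt : X ≠ ∞ := by
    refine (max_lt ?_ h.2).ne
    rw [Finset.sup_lt_iff (by simp)]
    exact fun j hj => hL j (Nat.le_of_lt_succ (Finset.mem_range.1 hj))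
  rw [hXe]
  refine ⟨fun j hj => ae_norm_le_of_eLpNorm_top_le ?_ hXt, fun h0 => ?_⟩
  · exact le_trans (Finset.le_sup (f := fun j => eLpNorm (weakDeriv 0 T j Y) ∞
      (volume.restrict (Ioc 0 T))) (Finset.mem_range.2 (Nat.lt_succ_of_le hj))) le_sup_left
  · have h1 : fracSeminorm 0 T (1 + s) ∞ Y ≤ X := le_sup_right
    rw [fracSeminorm, hfr, if_neg h0.ne', slobodeckij, hK, restrict_Ioo_eq_restrict_Ioc] at h1
    filter_upwards [ae_norm_le_of_eLpNorm_top_le h1 hXt] with z hz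
    -- For p = ∞ the exponent θ + 1/p is θ, so the seminorm is the Hölder quotient.
    simp only [ENNReal.inv_top, ENNReal.toReal_zero, add_zero] at hz
    rcases (abs_nonneg (z.1 - z.2)).eq_or_lt with h2 | h2
    · have : z.1 = z.2 := sub_eq_zero.1 (abs_eq_zero.1 h2.symm)
      rw [this, sub_self (weakDeriv 0 T (⌊s⌋₊ + 1) Y z.2), norm_zero]
      positivity
    · have hp : 0 < |z.1 - z.2| ^ Int.fract s := Real.rpow_pos_of_pos h2 _
      rw [norm_smul, norm_inv, Real.norm_of_nonneg hp.le, inv_mul_le_iff₀ hp] at hz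
      linarith

lemma normWInf_nonneg : 0 ≤ normWInf 0 T s Y := ENNReal.toReal_nonneg

lemma HasWeakDeriv.matMul (D : Matrix (Fin M) (Fin M) ℝ) {j : ℕ}
    {v : ℝ → EuclideanSpace ℝ (Fin M)} (h : HasWeakDeriv 0 T j u v) :
    HasWeakDeriv 0 T j (matMul D u) (CTG.matMul D v) :=
  h.comp_clm (matCLM D)

/-- `D Y` has finite `H^s` norm. -/
lemma MemSobolev.matMul (hT : 0 < T) (hs : 1 ≤ s) (D : Matrix (Fin M) (Fin M) ℝ)
    (h : MemSobolev 0 T (1 + s) ∞ Y) : MemSobolev 0 T s 2 (matMul D Y) := by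
  have hK := floor_one_add hs
  have hD : ∀ j ≤ ⌊s⌋₊, HasWeakDeriv 0 T j (CTG.matMul D Y) (CTG.matMul D (weakDeriv 0 T j Y)) :=
    fun j hj => (h.hasWeakDeriv (by omega)).matMul D
  refine ⟨fun j hj => ⟨_, hD j hj, ?_⟩, ?_⟩
  · rw [restrict_Ioo_eq_restrict_Ioc]
    exact (matCLM D).comp_memLp' (h.memLp_two le_top (by omega))
  rw [fracSeminorm]
  split_ifs with h0
  · simp
  have hch := h.isChain hT le_top
  rw [hK] at hch
  choose c hc using hch.primitive ⌊s⌋₊ (Nat.lt_succ_self _)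
  set v := weakDeriv 0 T (⌊s⌋₊ + 1) Y with hv
  -- A Lipschitz representative of the derivative of Y of order ⌊s⌋: the next derivative is bounded.
  -- Only finiteness of the seminorm of DY is at stake, so constants depending on M and D do no harm
  -- here.
  set W : ℝ → EuclideanSpace ℝ (Fin M) := fun x =>
    WithLp.toLp 2 fun i => c i + ∫ t in (0 : ℝ)..x, v t i with hW
  set L := normWInf 0 T (1 + s) Y
  have hL0 : 0 ≤ L := normWInf_nonneg
  have hvL : ∀ᵐ x, x ∈ Ioc 0 T → ‖v x‖ ≤ L :=
    (ae_restrict_iff' measurableSet_Ioc).1 ((h.normWInf_bounds hs).1 _ le_rfl)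
  have hvi : ∀ i, IntervalIntegrable (fun x => v x i) volume 0 T := fun i =>
    intervalIntegrable_of_memLp hT.le (memLp_coord (hch.memLp _ le_rfl) i)
  have hWl : ∀ x ∈ Ioc 0 T, ∀ y ∈ Ioc 0 T, ‖W x - W y‖ ≤ √M * L * |x - y| := by
    intro x hx y hy
    refine le_of_sq_le_sq ?_ (by positivity)
    rw [EuclideanSpace.real_norm_sq_eq]
    have h1 : ∀ i, (W x - W y) i ^ 2 ≤ (L * |x - y|) ^ 2 := by
      intro i
      have e : (W x - W y) i = ∫ t in y..x, v t i := by
        have hsub : ∀ z ∈ Ioc 0 T, IntervalIntegrable (fun x => v x i) volume 0 z := fun z hz =>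
          (hvi i).mono_set (by
            rw [uIcc_of_le hz.1.le, uIcc_of_le hT.le]; exact Icc_subset_Icc_right hz.2)
        have := intervalIntegral.integral_interval_sub_left (hsub x hx) (hsub y hy)
        simp only [hW, PiLp.sub_apply]
        linarith
      rw [e, ← sq_abs, ← Real.norm_eq_abs]
      refine pow_le_pow_left₀ (norm_nonneg _)
        (intervalIntegral.norm_integral_le_of_norm_le_const_ae ?_) 2
      filter_upwards [hvL] with t ht ht'
      have hsubset : uIoc y x ⊆ Ioc 0 T := Ioc_subset_Ioc (le_min hy.1.le hx.1.le)
        (max_le hy.2 hx.2)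
      exact (PiLp.norm_apply_le (v t) i).trans (ht (hsubset ht'))
    refine (Finset.sum_le_sum fun i _ => h1 i).trans (le_of_eq ?_)
    rw [Finset.sum_const, Finset.card_univ, Fintype.card_fin, nsmul_eq_mul]
    have : √(M : ℝ) ^ 2 = M := Real.sq_sqrt (Nat.cast_nonneg M)
    rw [mul_assoc, mul_pow (√(M : ℝ)), this]
  have hgw : weakDeriv 0 T ⌊s⌋₊ (CTG.matMul D Y) =ᵐ[volume.restrict (Ioc 0 T)]
      fun x => matCLM D (W x) := by
    have h1 := (hasWeakDeriv_weakDeriv (hD _ le_rfl)).unique (hD _ le_rfl)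
    rw [restrict_Ioo_eq_restrict_Ioc] at h1
    filter_upwards [h1, Filter.eventually_all.2 hc] with x hx hx'
    rw [hx, ← matCLM_apply]
    congr 1
    ext i
    exact hx' i
  refine slobodeckij_lt_top_of_lipschitz (Int.fract_lt_one s) hgw
    (L := ‖matCLM D‖ * (√M * L)) fun x hx y hy => ?_
  rw [← map_sub, mul_assoc]
  exact ((matCLM D).le_opNorm _).trans (by gcongr; exact hWl x hx y hy)

/-- The exact solution is the primitive of its weak derivative. -/
lemma MemSobolev.eq_primitive (hT : 0 < T) (hs : 1 ≤ s) (h : MemSobolev 0 T (1 + s) ∞ Y)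
    (hYc : ContinuousOn Y (Icc 0 T)) {a b : ℝ} (ha : 0 ≤ a) (hb : b ≤ T) (i : Fin M) :
    ∀ x ∈ Icc a b, Y x i = Y a i + ∫ t in a..x, weakDeriv 0 T 1 Y t i := by
  have hK := floor_one_add hs
  have hch := h.isChain hT le_top
  obtain ⟨c, hc⟩ := hch.primitive 0 (by omega) i
  have hvi : IntervalIntegrable (fun x => weakDeriv 0 T 1 Y x i) volume 0 T :=
    intervalIntegrable_of_memLp hT.le (memLp_coord (hch.memLp 1 (by omega)) i)
  have h0 := (h.hasWeakDeriv (j := 0) (Nat.zero_le _)).ae_eq_zeroth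
  have hae : (fun x => Y x i) =ᵐ[volume.restrict (Icc 0 T)]
      fun x => c + ∫ t in (0 : ℝ)..x, weakDeriv 0 T 1 Y t i := by
    rw [restrict_Ioo_eq_restrict_Ioc] at h0
    rw [← restrict_Ioc_eq_restrict_Icc]
    filter_upwards [h0, hc] with x hx hx'
    rw [← hx, hx']
  have heq := Measure.eqOn_Icc_of_ae_eq volume hT.ne hae
    ((EuclideanSpace.proj (𝕜 := ℝ) i).continuous.comp_continuousOn hYc)
    (continuousOn_primitive_add hT.le hvi c)
  intro x hx
  have hx0 : 0 ≤ x := ha.trans hx.1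
  have hxT : x ≤ T := hx.2.trans hb
  have e1 := heq ⟨hx0, hxT⟩
  have e2 := heq ⟨ha, hx.1.trans hxT⟩
  simp only at e1 e2
  rw [e1, e2, add_assoc, intervalIntegral.integral_add_adjacent_intervals
    (hvi.mono_set (by
      rw [uIcc_of_le ha, uIcc_of_le hT.le]; exact Icc_subset_Icc_right (hx.1.trans hxT)))
    (hvi.mono_set (by
      rw [uIcc_of_le hx.1, uIcc_of_le hT.le]; exact Icc_subset_Icc ha hxT))]

end Regularity

/-! ### Summation over the intervals of the partition -/

lemma le_sum_of_growth {N : ℕ} {α : Fin (N + 1) → ℝ} {b : Fin N → ℝ} (hb : ∀ n, 0 ≤ b n)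
    (h : ∀ n : Fin N, α n.succ ≤ α n.castSucc + b n) (i : Fin (N + 1)) :
    α i ≤ α 0 + ∑ n, b n := by
  classical
  have key : ∀ i : Fin (N + 1), α i ≤ α 0 + ∑ n : Fin N with n.castSucc < i, b n := by
    intro i
    induction i using Fin.induction with
    | zero => simp
    | succ n ih =>
      refine (h n).trans ?_
      have h1 : n ∉ ({k : Fin N | k.castSucc < n.castSucc} : Finset (Fin N)) := by simp
      have h2 : insert n ({k : Fin N | k.castSucc < n.castSucc} : Finset (Fin N)) ⊆
          ({k : Fin N | k.castSucc < n.succ} : Finset (Fin N)) := by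
        intro k hk
        rw [Finset.mem_insert, Finset.mem_filter] at hk
        rw [Finset.mem_filter]
        refine ⟨Finset.mem_univ _, ?_⟩
        rcases hk with rfl | ⟨-, hk⟩
        · exact Fin.castSucc_lt_succ
        · exact hk.trans Fin.castSucc_lt_succ
      have h3 := Finset.sum_le_sum_of_subset_of_nonneg h2 fun k _ _ => hb k
      rw [Finset.sum_insert h1] at h3
      linarith
  refine (key i).trans ?_
  gcongr
  · exact fun n _ _ => hb n
  · exact Finset.filter_subset _ _

/-- A discrete Gronwall argument with a constant that is linear in `T`. -/
lemma le_of_local_growth {T : ℝ} {N : ℕ} {t : Fin (N + 1) → ℝ} (hT : 0 < T)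
    (ht : IsPartition T t) {α : Fin (N + 1) → ℝ} {G : Fin N → ℝ} (hα : ∀ i, 0 ≤ α i)
    (hα0 : α 0 = 0) (hG : ∀ n, 0 ≤ G n)
    (h : ∀ n : Fin N, ∀ μ : ℝ, 0 < μ → α n.succ ≤ α n.castSucc + μ * G n +
      1 / μ * (2 * (t n.succ - t n.castSucc) * α n.castSucc +
        4 * (t n.succ - t n.castSucc) ^ 2 * G n)) (i : Fin (N + 1)) :
    α i ≤ 10 * T * ∑ n, G n := by
  -- Gronwall without an exponential: every α on the right is replaced by the maximum m. With μ = 4T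
  -- and step sizes summing to T, the resulting term is m/2 and is absorbed; the rest is 4T + T = 5T
  -- times the sum of G, doubled by the absorption.
  obtain ⟨k, hk⟩ := Finite.exists_max α
  set m := α k
  have hm : 0 ≤ m := hα k
  have hst : ∀ n : Fin N, 0 ≤ t n.succ - t n.castSucc := fun n => by linarith [ht.lt n]
  have hsT : ∀ n : Fin N, t n.succ - t n.castSucc ≤ T := fun n => by
    linarith [ht.le n.succ, ht.nonneg n.castSucc]
  set b : Fin N → ℝ := fun n => 4 * T * G n + 1 / (4 * T) *
    (2 * (t n.succ - t n.castSucc) * m + 4 * T ^ 2 * G n) with hb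
  have hb0 : ∀ n, 0 ≤ b n := fun n => by
    have := hG n; have := hst n
    simp only [hb]; positivity
  have h1 := le_sum_of_growth (α := α) hb0 (fun n => by
    refine (h n (4 * T) (by positivity)).trans ?_
    have := hG n
    have := hst n
    have := hsT n
    simp only [hb]
    rw [add_assoc]
    gcongr
    exact hk _) k
  rw [hα0, zero_add] at h1
  have h2 : ∑ n, b n = 5 * T * (∑ n, G n) + m / 2 := by
    simp only [hb, Finset.sum_add_distrib, ← Finset.mul_sum, ← Finset.sum_mul, ht.sum_step]
    field_simp; ring
  refine (hk i).trans ?_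
  rw [h2] at h1
  change m ≤ _ at h1
  linarith

lemma IsPartition.exists_mem {T : ℝ} {N : ℕ} {t : Fin (N + 1) → ℝ} (hT : 0 < T)
    (ht : IsPartition T t) {x : ℝ} (hx : x ∈ Icc 0 T) :
    ∃ n : Fin N, x ∈ Icc (t n.castSucc) (t n.succ) := by
  by_contra hcon
  have key : ∀ i : Fin (N + 1), t i ≤ x := by
    intro i
    induction i using Fin.induction with
    | zero => rw [ht.2.1]; exact hx.1
    | succ n ih =>
      by_contra h
      exact hcon ⟨n, ih, (not_le.1 h).le⟩
  rcases N with _ | N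
  · have h1 := ht.2.1
    have h2 := ht.2.2
    rw [show Fin.last 0 = 0 from rfl, h1] at h2
    exact hT.ne h2
  · refine hcon ⟨Fin.last N, key _, ?_⟩
    rw [Fin.succ_last, ht.2.2]
    exact hx.2

/-- The error of the Galerkin method in terms of local approximation errors. -/
lemma global_error {T s : ℝ} {M N r : ℕ} {D : Matrix (Fin M) (Fin M) ℝ}
    {Y₀ : EuclideanSpace ℝ (Fin M)} {R Y Yr : ℝ → EuclideanSpace ℝ (Fin M)}
    {t : Fin (N + 1) → ℝ} (hs : 1 ≤ s) (hT : 0 < T) (hr : 1 ≤ r)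
    (hD : (-(D + D.transpose)).PosSemidef) (ht : IsPartition T t)
    (hY : IsExactSolution T D R Y₀ Y) (hYr : IsCTGSolution T D R Y₀ t r Yr)
    (hR : MemSobolev 0 T s 2 R) (hYS : MemSobolev 0 T (1 + s) ∞ Y) {ε B : Fin N → ℝ}
    (hε : ∀ n, VecApprox (t n.castSucc) (t n.succ) r (matMul D (weakDeriv 0 T 1 Y)) (ε n))
    (hB : ∀ n, ((t n.succ - t n.castSucc) / r) ^ 2 * ε n ≤ B n) :
    (∀ n, ‖Y (t n) - Yr (t n)‖ ^ 2 ≤ 40 * T * ∑ n, B n) ∧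
    ∀ ε' : Fin N → ℝ,
      (∀ n, VecApprox (t n.castSucc) (t n.succ) r (weakDeriv 0 T 1 Y) (ε' n)) →
      ∀ n, ∀ x ∈ Icc (t n.castSucc) (t n.succ), ‖Y x - Yr x‖ ^ 2 ≤
        2 * (t n.succ - t n.castSucc) * ε' n + 1536 * r ^ 2 * T * ∑ n, B n := by
  have hK := floor_one_add hs
  have hDd := dissipative_of_posSemidef hD
  have hy1L : MemLp (weakDeriv 0 T 1 Y) 2 (volume.restrict (Ioc 0 T)) :=
    hYS.memLp_two le_top (by omega)
  have hRL : MemLp R 2 (volume.restrict (Ioc 0 T)) := by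
    have h0 := (hR.hasWeakDeriv (j := 0) (Nat.zero_le _)).ae_eq_zeroth
    rw [restrict_Ioo_eq_restrict_Ioc] at h0
    exact (hR.memLp_two le_rfl (Nat.zero_le _)).ae_eq h0
  have hy1e : weakDeriv 0 T 1 Y =ᵐ[volume.restrict (Ioc 0 T)] matMul D Y + R := by
    rw [← restrict_Ioo_eq_restrict_Ioc]
    exact (hYS.hasWeakDeriv (j := 1) (by omega)).unique hY.2.2
  have hloc := fun n : Fin N => local_error hr hDd (ht.lt n) (Y := Y) (R := R) (Yr := Yr)
    (y1 := weakDeriv 0 T 1 Y) (hYr.2.2 n).1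
    (hYr.1.mono (Icc_subset_Icc (ht.nonneg _) (ht.le _)))
    (hYr.2.2 n).2.choose_spec.choose_spec.1 (hYr.2.2 n).2.choose_spec.choose_spec.2.1
    (hYr.2.2 n).2.choose_spec.choose_spec.2.2
    (memLp_coord (hRL.mono_measure (Measure.restrict_mono (ht.subset n) le_rfl)))
    (memLp_coord (hy1L.mono_measure (Measure.restrict_mono (ht.subset n) le_rfl)))
    (hYS.eq_primitive hT hs hY.1 (ht.nonneg _) (ht.le _))
    (fun i => by
      filter_upwards [ae_restrict_of_ae_restrict_of_subset (ht.subset n) hy1e] with x hx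
      rw [hx, Pi.add_apply, PiLp.add_apply, matMul_apply]) (hε n)
  set G : Fin N → ℝ := fun n => 4 * ((t n.succ - t n.castSucc) / r) ^ 2 * ε n with hG
  have hG0 : ∀ n, 0 ≤ G n := fun n => by
    have := (hε n).nonneg (ht.lt n).le
    simp only [hG]; positivity
  have hGB : ∑ n, G n ≤ 4 * ∑ n, B n := by
    rw [Finset.mul_sum]
    exact Finset.sum_le_sum fun n _ => by
      have := hB n
      simp only [hG]; linarith
  have hnode : ∀ i, ‖Y (t i) - Yr (t i)‖ ^ 2 ≤ 10 * T * ∑ n, G n :=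
    le_of_local_growth hT ht (α := fun i => ‖Y (t i) - Yr (t i)‖ ^ 2) (fun _ => sq_nonneg _)
      (by simp [ht.2.1, hY.2.1, hYr.2.1]) hG0 fun n μ hμ => (hloc n).1 μ hμ
  refine ⟨fun i => (hnode i).trans ?_, fun ε' hε' n x hx => ?_⟩
  · calc 10 * T * ∑ n, G n ≤ 10 * T * (4 * ∑ n, B n) := by gcongr
      _ = _ := by ring
  · refine ((hloc n).2 (ε' n) (hε' n) x hx).trans ?_
    have h1 := hnode n.castSucc
    have h2 : G n ≤ ∑ n, G n := Finset.single_le_sum (fun n _ => hG0 n) (Finset.mem_univ n)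
    have hr1 : (1 : ℝ) ≤ r := by exact_mod_cast hr
    have h3 : ((r : ℝ) + 1) ^ 2 ≤ 4 * r ^ 2 := by nlinarith
    have h4 : t n.succ - t n.castSucc ≤ T := by
      linarith [ht.le n.succ, ht.nonneg n.castSucc]
    have h5 : 0 ≤ t n.succ - t n.castSucc := by linarith [ht.lt n]
    have hS0 : 0 ≤ ∑ n, G n := Finset.sum_nonneg fun n _ => hG0 n
    have h6 : (t n.succ - t n.castSucc) * G n ≤ T * ∑ n, G n :=
      mul_le_mul h4 h2 (hG0 n) hT.le
    change 2 * (t n.succ - t n.castSucc) * ε' n + 2 * (((r : ℝ) + 1) ^ 2 *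
      (4 * ‖Y (t n.castSucc) - Yr (t n.castSucc)‖ ^ 2 +
        8 * (t n.succ - t n.castSucc) * G n)) ≤ _
    -- Here 48 = 4·10 + 8, from the nodal bound and the local source; the final constant is 1536 =
    -- 2·4·48·4.
    have h7 : ((r : ℝ) + 1) ^ 2 * (4 * ‖Y (t n.castSucc) - Yr (t n.castSucc)‖ ^ 2 +
        8 * (t n.succ - t n.castSucc) * G n) ≤ 4 * r ^ 2 * (48 * T * ∑ n, G n) := by
      have h8 := hG0 n
      refine mul_le_mul h3 (by linarith) (by positivity) (by positivity)
    have h9 : 4 * (r : ℝ) ^ 2 * (48 * T * ∑ n, G n) ≤ 4 * r ^ 2 * (48 * T * (4 * ∑ n, B n)) := by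
      gcongr
    linarith

/-! ### The error estimates -/

/-! ### Local approximation of DY', Y'', R' and Y' -/

/-- Supplies the consistency terms: with u = DY in (i) and with u = R in (ii). Squared local
contributions add up, so the sum costs no factor depending on N. -/
lemma exists_local_approx_of_memSobolev (s : ℝ) (hs : 1 ≤ s) : ∃ C : ℝ, 1 ≤ C ∧
    ∀ (T : ℝ) (M N r : ℕ) (u : ℝ → EuclideanSpace ℝ (Fin M)) (t : Fin (N + 1) → ℝ),
      0 < T → 1 ≤ r → IsPartition T t → MemSobolev 0 T s 2 u → ∃ ε B : Fin N → ℝ,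
        (∀ n, VecApprox (t n.castSucc) (t n.succ) r (weakDeriv 0 T 1 u) (ε n)) ∧
        (∀ n, ((t n.succ - t n.castSucc) / r) ^ 2 * ε n ≤ B n) ∧
        ∑ n, B n ≤ C * (maxStep t ^ min ((r : ℝ) + 1) s / (r : ℝ) ^ s) ^ 2 *
          normH 0 T s u ^ 2 := by
  obtain ⟨C, hC1, hC⟩ := exists_vecApprox_deriv s hs
  refine ⟨C, hC1, fun T M N r u t hT hr ht hu => ?_⟩
  obtain ⟨Q, hQ1, hQ2, hQ3⟩ := hu.exists_local ht
  choose ε hε hB using fun n => hC M (t n.castSucc) (t n.succ) (maxStep t) r (Q n)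
    (fun j => weakDeriv 0 T j u) (ht.lt n) (ht.step_le n) hr
    ((hu.isChain hT le_rfl).restrict (ht.nonneg _) (ht.lt n).le (ht.le _)) (hQ1 n) (hQ2 n)
  refine ⟨ε, _, hε, hB, ?_⟩
  rw [← Finset.mul_sum]
  gcongr

section Exact

variable {T s : ℝ} {M N : ℕ} {Y : ℝ → EuclideanSpace ℝ (Fin M)} {t : Fin (N + 1) → ℝ}

lemma MemSobolev.isChain_local (hs : 1 ≤ s) (hT : 0 < T) (ht : IsPartition T t)
    (h : MemSobolev 0 T (1 + s) ∞ Y) (n : Fin N) :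
    IsChain (t n.castSucc) (t n.succ) (⌊s⌋₊ + 1) (fun j => weakDeriv 0 T j Y) := by
  have := h.isChain hT le_top
  rw [floor_one_add hs] at this
  exact this.restrict (ht.nonneg _) (ht.lt n).le (ht.le _)

lemma MemSobolev.ae_norm_le_local (hs : 1 ≤ s) (ht : IsPartition T t)
    (h : MemSobolev 0 T (1 + s) ∞ Y) (n : Fin N) {j : ℕ} (hj : j ≤ ⌊s⌋₊ + 1) :
    ∀ᵐ x ∂(volume.restrict (Ioc (t n.castSucc) (t n.succ))),
      ‖weakDeriv 0 T j Y x‖ ≤ normWInf 0 T (1 + s) Y :=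
  ae_restrict_of_ae_restrict_of_subset (ht.subset n) ((h.normWInf_bounds hs).1 j hj)

lemma MemSobolev.seminormBound_zero_local (hs : 1 ≤ s) (hT : 0 < T) (ht : IsPartition T t)
    (h : MemSobolev 0 T (1 + s) ∞ Y) (n : Fin N) {j : ℕ} (hj : j ≤ ⌊s⌋₊ + 1) :
    SeminormBound (t n.castSucc) (t n.succ) 0 (weakDeriv 0 T j Y)
      (2 * (t n.succ - t n.castSucc) * normWInf 0 T (1 + s) Y ^ 2) :=
  seminormBound_of_holder (ht.lt n).le le_rfl normWInf_nonneg
    ((h.isChain_local hs hT ht n).memLp j hj) (h.ae_norm_le_local hs ht n hj)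
    fun h0 => absurd h0 (lt_irrefl 0)

lemma MemSobolev.seminormBound_local (hs : 1 ≤ s) (hT : 0 < T) (ht : IsPartition T t)
    (h : MemSobolev 0 T (1 + s) ∞ Y) (n : Fin N) :
    SeminormBound (t n.castSucc) (t n.succ) (Int.fract s) (weakDeriv 0 T (⌊s⌋₊ + 1) Y)
      (2 * (t n.succ - t n.castSucc) * normWInf 0 T (1 + s) Y ^ 2) := by
  refine seminormBound_of_holder (ht.lt n).le (Int.fract_nonneg s) normWInf_nonneg
    ((h.isChain_local hs hT ht n).memLp _ le_rfl) (h.ae_norm_le_local hs ht n le_rfl)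
    fun h0 => ?_
  have h1 := (h.normWInf_bounds hs).2 h0
  rw [Measure.prod_restrict] at h1 ⊢
  exact ae_restrict_of_ae_restrict_of_subset (prod_mono (ht.subset n) (ht.subset n)) h1

/-- For the exact solution, `D Y'` has a representation in terms of `Y''` and `R'`. -/
lemma matMul_weakDeriv_ae_eq {D : Matrix (Fin M) (Fin M) ℝ} {Y₀ : EuclideanSpace ℝ (Fin M)}
    {R : ℝ → EuclideanSpace ℝ (Fin M)} (hs : 1 ≤ s) (hY : IsExactSolution T D R Y₀ Y)
    (hR : MemSobolev 0 T s 2 R) (h : MemSobolev 0 T (1 + s) ∞ Y) :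
    weakDeriv 0 T 2 Y - weakDeriv 0 T 1 R =ᵐ[volume.restrict (Ioc 0 T)]
      matMul D (weakDeriv 0 T 1 Y) := by
  have hK := floor_one_add hs
  have hK1 : 1 ≤ ⌊s⌋₊ := Nat.le_floor (by exact_mod_cast hs)
  have h1 := ((h.hasWeakDeriv (j := 1) (by omega)).matMul D).add (hR.hasWeakDeriv (j := 1) hK1)
  have h2 := hY.2.2.of_add (j := 1) (h.hasWeakDeriv (j := 1 + 1) (by omega))
  have h3 := h2.unique h1
  rw [restrict_Ioo_eq_restrict_Ioc] at h3
  filter_upwards [h3] with x hx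
  change weakDeriv 0 T 2 Y x = _ at hx
  rw [Pi.sub_apply, hx, Pi.add_apply, add_sub_cancel_right]

end Exact

/-- The H^s argument applied to the chain starting at Y', with local size h times the squared
W^{1+s,∞} norm; the lengths sum to T. -/
lemma exists_local_approx_second (s : ℝ) (hs : 1 ≤ s) : ∃ C : ℝ, 1 ≤ C ∧
    ∀ (T : ℝ) (M N r : ℕ) (Y : ℝ → EuclideanSpace ℝ (Fin M)) (t : Fin (N + 1) → ℝ),
      0 < T → 1 ≤ r → IsPartition T t → MemSobolev 0 T (1 + s) ∞ Y → ∃ ε B : Fin N → ℝ,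
        (∀ n, VecApprox (t n.castSucc) (t n.succ) r (weakDeriv 0 T 2 Y) (ε n)) ∧
        (∀ n, ((t n.succ - t n.castSucc) / r) ^ 2 * ε n ≤ B n) ∧
        ∑ n, B n ≤ C * (maxStep t ^ min ((r : ℝ) + 1) s / (r : ℝ) ^ s) ^ 2 *
          (2 * T * normWInf 0 T (1 + s) Y ^ 2) := by
  obtain ⟨C, hC1, hC⟩ := exists_vecApprox_deriv s hs
  refine ⟨C, hC1, fun T M N r Y t hT hr ht hY => ?_⟩
  choose ε hε hB using fun n => hC M (t n.castSucc) (t n.succ) (maxStep t) r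
    (2 * (t n.succ - t n.castSucc) * normWInf 0 T (1 + s) Y ^ 2)
    (fun j => weakDeriv 0 T (j + 1) Y) (ht.lt n) (ht.step_le n) hr
    ((hY.isChain_local hs hT ht n).tail le_rfl)
    (fun j hj => (hY.seminormBound_zero_local hs hT ht n (by omega)).1 rfl)
    (hY.seminormBound_local hs hT ht n)
  refine ⟨ε, _, hε, hB, le_of_eq ?_⟩
  rw [← Finset.mul_sum, ← Finset.sum_mul, ← Finset.mul_sum, ht.sum_step]

/-- Away from T = 0, 1 + √T is comparable with √T. This recovers the factor T required by (ii),
which a low-degree interpolation error does not provide by itself. -/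
lemma one_add_sq_le_of_le {T₀ T : ℝ} (hT₀ : 0 < T₀) (h : T₀ ≤ T) :
    (1 + T) ^ 2 ≤ (1 + 1 / √T₀) ^ 2 * ((1 + √T) ^ 2 * T) := by
  have hT : 0 < T := hT₀.trans_le h
  have h0 : 0 < √T₀ := Real.sqrt_pos.2 hT₀
  have h1 : √T₀ ≤ √T := Real.sqrt_le_sqrt h
  have h2 : √T ^ 2 = T := Real.sq_sqrt hT.le
  have h3 : 1 + √T ≤ (1 + 1 / √T₀) * √T := by
    have : 1 ≤ 1 / √T₀ * √T := by
      rw [one_div, ← div_eq_inv_mul]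
      exact (one_le_div h0).2 h1
    linarith
  have h4 : 1 + T ≤ (1 + √T) * (1 + √T) := by nlinarith [Real.sqrt_nonneg T]
  calc (1 + T) ^ 2 ≤ ((1 + √T) * ((1 + 1 / √T₀) * √T)) ^ 2 := by
        gcongr
        exact h4.trans (by gcongr)
    _ = (1 + 1 / √T₀) ^ 2 * ((1 + √T) ^ 2 * √T ^ 2) := by ring
    _ = _ := by rw [h2]

/-- The surplus exponent r + 1 - min(r + 1, s) lies in [0, 1], so the surplus power of h is at most
1 + T. -/
lemma pow_succ_le_rpow_min {h τ T s : ℝ} {r : ℕ} (hh : 0 < h) (hτ : h ≤ τ) (hT : h ≤ T)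
    (hr : (r : ℝ) < s) : h ^ (r + 1) ≤ τ ^ min ((r : ℝ) + 1) s * (1 + T) := by
  set σ := min ((r : ℝ) + 1) s with hσ
  have h1 : σ ≤ r + 1 := min_le_left _ _
  have h2 : (r : ℝ) ≤ σ := le_min (by linarith) hr.le
  have h3 : 0 ≤ σ := (Nat.cast_nonneg r).trans h2
  have e : h ^ (r + 1) = h ^ σ * h ^ ((r : ℝ) + 1 - σ) := by
    rw [← Real.rpow_add hh, ← Real.rpow_natCast]
    congr 1; push_cast; ring
  rw [e]
  refine mul_le_mul (Real.rpow_le_rpow hh.le hτ h3) ?_ (by positivity)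
    (Real.rpow_nonneg (hh.le.trans hτ) _)
  calc h ^ ((r : ℝ) + 1 - σ) ≤ (1 + T) ^ ((r : ℝ) + 1 - σ) :=
        Real.rpow_le_rpow hh.le (by linarith) (by linarith)
    _ ≤ (1 + T) ^ (1 : ℝ) := Real.rpow_le_rpow_of_exponent_le (by linarith) (by linarith)
    _ = _ := Real.rpow_one _

/-- This controls the interpolation error Y - Z between the nodes, where no duality gain is
available: the extra power of h comes from Cauchy-Schwarz and from the L^∞ control of the
derivatives on an interval of length h. -/
lemma exists_local_approx_first (s : ℝ) (hs : 1 ≤ s) {T₀ : ℝ} (hT₀ : 0 < T₀) :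
    ∃ C : ℝ, 1 ≤ C ∧
    ∀ (T : ℝ) (M N r : ℕ) (Y : ℝ → EuclideanSpace ℝ (Fin M)) (t : Fin (N + 1) → ℝ),
      0 < T → (T₀ ≤ T ∨ s ≤ r) → 1 ≤ r → IsPartition T t → MemSobolev 0 T (1 + s) ∞ Y →
        ∀ n : Fin N, ∃ ε,
          VecApprox (t n.castSucc) (t n.succ) r (weakDeriv 0 T 1 Y) ε ∧
          2 * (t n.succ - t n.castSucc) * ε ≤
            C * (maxStep t ^ min ((r : ℝ) + 1) s / (r : ℝ) ^ s) ^ 2 *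
              ((1 + √T) ^ 2 * T * normWInf 0 T (1 + s) Y ^ 2) := by
  obtain ⟨A, hA1, hA⟩ := exists_vecApprox_of_chain
  set K := ⌊s⌋₊ with hK
  set θ := Int.fract s with hθ
  have hsK : (K : ℝ) + θ = s := by
    have h1 := Int.floor_add_fract s
    have h2 : ((⌊s⌋₊ : ℕ) : ℝ) = ⌊s⌋ := natCast_floor_eq_intCast_floor (by linarith)
    rw [hK, h2, hθ, h1]
  set B : ℝ := (2 * (K + 1)) ^ (2 * (K + 1)) with hB
  have hB1 : 1 ≤ B := one_le_pow₀ (by linarith [K.cast_nonneg (α := ℝ)])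
  have hss : 1 ≤ s ^ s := Real.one_le_rpow hs (by linarith)
  have hS0 : 0 < √T₀ := Real.sqrt_pos.2 hT₀
  have hF : 1 ≤ (s ^ s) ^ 2 * (1 + 1 / √T₀) ^ 2 := by
    have : 1 ≤ 1 + 1 / √T₀ := by
      have : 0 < 1 / √T₀ := by positivity
      linarith
    exact one_le_mul_of_one_le_of_one_le (one_le_pow₀ hss) (one_le_pow₀ this)
  have hAB : 1 ≤ A * B := one_le_mul_of_one_le_of_one_le hA1 hB1
  refine ⟨4 * (A * B) * ((s ^ s) ^ 2 * (1 + 1 / √T₀) ^ 2), ?_, ?_⟩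
  · exact one_le_mul_of_one_le_of_one_le (by linarith) hF
  intro T M N r Y t hT hc hr ht hY n
  set h := t n.succ - t n.castSucc with hh
  set L := normWInf 0 T (1 + s) Y
  have hh0 : 0 < h := by linarith [ht.lt n]
  have hhT : h ≤ T := by linarith [ht.le n.succ, ht.nonneg n.castSucc]
  have hhτ : h ≤ maxStep t := ht.step_le n
  have hr1 : (1 : ℝ) ≤ r := by exact_mod_cast hr
  have hr0 : (0 : ℝ) < r := by linarith
  set τ := maxStep t
  have hτ0 : 0 < τ := hh0.trans_le hhτ
  -- For s ≤ r the rate h^s holds with a spare factor h ≤ T. For r < s the full power h^(r + 1) goes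
  -- into the rate, and the missing factor √T is where T₀ ≤ T is needed.
  by_cases hsr : s ≤ r
  · refine ⟨_, hA M (t n.castSucc) (t n.succ) r K θ (2 * h * L ^ 2)
      (fun j => weakDeriv 0 T (j + 1) Y) (ht.lt n) hr (Int.fract_nonneg s) (Int.fract_lt_one s)
      (by rw [hsK]; exact hsr) (by positivity) ((hY.isChain_local hs hT ht n).tail le_rfl)
      (hY.seminormBound_local hs hT ht n), ?_⟩
    rw [hsK, min_eq_right (by linarith), ← hB, ← hh]
    have e1 : (h / r) ^ (2 * s) = (h ^ s / (r : ℝ) ^ s) ^ 2 := by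
      rw [← Real.div_rpow hh0.le hr0.le, ← Real.rpow_natCast, ← Real.rpow_mul (by positivity)]
      congr 1; push_cast; ring
    have e2 : h ^ 2 ≤ (1 + √T) ^ 2 * T := by
      have h1 : √T ^ 2 = T := Real.sq_sqrt hT.le
      calc h ^ 2 ≤ T ^ 2 := by gcongr
        _ = √T ^ 2 * T := by rw [h1]; ring
        _ ≤ _ := by gcongr; linarith
    have e3 : h ^ s ≤ τ ^ s := Real.rpow_le_rpow hh0.le hhτ (by linarith)
    calc 2 * h * (A * B * (h / r) ^ (2 * s) * (2 * h * L ^ 2))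
        = 4 * (A * B) * 1 * (h ^ s / (r : ℝ) ^ s) ^ 2 * (h ^ 2 * L ^ 2) := by rw [e1]; ring
      _ ≤ _ := by gcongr
  · rw [not_le] at hsr
    have hT0 : T₀ ≤ T := hc.resolve_right (not_le.2 hsr)
    have hrK : r ≤ K := Nat.le_floor hsr.le
    refine ⟨_, hA M (t n.castSucc) (t n.succ) r r 0 (2 * h * L ^ 2)
      (fun j => weakDeriv 0 T (j + 1) Y) (ht.lt n) hr le_rfl one_pos
      (by rw [add_zero]) (by positivity) ((hY.isChain_local hs hT ht n).tail (by omega))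
      (hY.seminormBound_zero_local hs hT ht n (by omega)), ?_⟩
    have e1 : (h / r) ^ (2 * ((r : ℝ) + 0)) ≤ (h ^ r) ^ 2 := by
      calc (h / r) ^ (2 * ((r : ℝ) + 0)) = ((h / r) ^ r) ^ 2 := by
            rw [← pow_mul, ← Real.rpow_natCast]; congr 1; push_cast; ring
        _ ≤ _ := by
            gcongr
            exact div_le_self hh0.le hr1
    have e2 : ((2 : ℝ) * (r + 1)) ^ (2 * (r + 1)) ≤ B := by
      have : (r : ℝ) ≤ K := by exact_mod_cast hrK
      calc ((2 : ℝ) * (r + 1)) ^ (2 * (r + 1)) ≤ (2 * ((K : ℝ) + 1)) ^ (2 * (r + 1)) := by gcongr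
        _ ≤ _ := pow_le_pow_right₀ (by linarith) (by omega)
    have e3 := pow_succ_le_rpow_min hh0 hhτ hhT hsr
    set X := τ ^ min ((r : ℝ) + 1) s with hX
    have hX0 : 0 < X := Real.rpow_pos_of_pos hτ0 _
    have e4 : X ≤ X / (r : ℝ) ^ s * s ^ s := by
      have : (r : ℝ) ^ s ≤ s ^ s := Real.rpow_le_rpow hr0.le hsr.le (by linarith)
      rw [div_mul_eq_mul_div, le_div_iff₀ (by positivity)]
      gcongr
    calc 2 * h * (A * (2 * (r + 1)) ^ (2 * (r + 1)) *
          ((t n.succ - t n.castSucc) / r) ^ (2 * ((r : ℝ) + 0)) * (2 * h * L ^ 2))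
        ≤ 2 * h * (A * B * (h ^ r) ^ 2 * (2 * h * L ^ 2)) := by
          rw [← hh]; gcongr
      _ = 4 * (A * B) * (h ^ (r + 1)) ^ 2 * L ^ 2 := by ring
      _ ≤ 4 * (A * B) * (X / (r : ℝ) ^ s * s ^ s * (1 + T)) ^ 2 * L ^ 2 := by
          gcongr
          exact e3.trans (by gcongr)
      _ = 4 * (A * B) * ((s ^ s) ^ 2 * (1 + T) ^ 2) * (X / (r : ℝ) ^ s) ^ 2 * L ^ 2 := by ring
      _ ≤ 4 * (A * B) * ((s ^ s) ^ 2 * ((1 + 1 / √T₀) ^ 2 * ((1 + √T) ^ 2 * T))) *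
          (X / (r : ℝ) ^ s) ^ 2 * L ^ 2 := by
          gcongr
          exact one_add_sq_le_of_le hT₀ hT0
      _ = _ := by ring

end CTG

end

/-! ### The two error estimates -/

theorem theorem2p1 (s : ℝ) (hs : 1 ≤ s) :
    (∃ C : ℝ, 0 < C ∧
      ∀ (T : ℝ) (M N r : ℕ) (D : Matrix (Fin M) (Fin M) ℝ)
        (Y₀ : EuclideanSpace ℝ (Fin M)) (R Y Yr : ℝ → EuclideanSpace ℝ (Fin M))
        (t : Fin (N + 1) → ℝ),
        0 < T → 1 ≤ r → (-(D + D.transpose)).PosSemidef →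
        CTG.IsPartition T t →
        CTG.IsExactSolution T D R Y₀ Y →
        CTG.IsCTGSolution T D R Y₀ t r Yr →
        CTG.MemSobolev 0 T s 2 R →
        CTG.MemSobolev 0 T (1 + s) ∞ Y →
        ∀ n : Fin N, ‖Y (t n.succ) - Yr (t n.succ)‖ ≤
          C * √T * (CTG.maxStep t ^ min ((r : ℝ) + 1) s / (r : ℝ) ^ s) *
            CTG.normH 0 T s (CTG.matMul D Y)) ∧
    (∀ T₀ : ℝ, 0 < T₀ → ∃ C : ℝ, 0 < C ∧
      ∀ (T : ℝ) (M N r : ℕ) (D : Matrix (Fin M) (Fin M) ℝ)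
        (Y₀ : EuclideanSpace ℝ (Fin M)) (R Y Yr : ℝ → EuclideanSpace ℝ (Fin M))
        (t : Fin (N + 1) → ℝ),
        0 < T → (T₀ ≤ T ∨ s ≤ r) → 1 ≤ r → (-(D + D.transpose)).PosSemidef →
        CTG.IsPartition T t →
        CTG.IsExactSolution T D R Y₀ Y →
        CTG.IsCTGSolution T D R Y₀ t r Yr →
        CTG.MemSobolev 0 T s 2 R →
        CTG.MemSobolev 0 T (1 + s) ∞ Y →
        ∀ x ∈ Icc 0 T, ‖Y x - Yr x‖ ≤
          C * (1 + √T) *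
            (CTG.maxStep t ^ min ((r : ℝ) + 1) s / (r : ℝ) ^ (s - 2)) *
            (√T * CTG.normWInf 0 T (1 + s) Y + CTG.normH 0 T s R)) := by
  refine ⟨?_, fun T₀ hT₀ => ?_⟩
  · obtain ⟨C, hC1, hC⟩ := CTG.exists_local_approx_of_memSobolev s hs
    -- The squared estimate carries 40C; since 40C ≥ 1 it is dominated by its square, which avoids a
    -- root in the constant.
    refine ⟨40 * C, by positivity, fun T M N r D Y₀ R Y Yr t hT hr hD ht hY hYr hR hYS n => ?_⟩
    have hDY := hYS.matMul hT hs D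
    obtain ⟨ε, B, hε, hB, hsum⟩ := hC T M N r _ t hT hr ht hDY
    have hK1 : 1 ≤ ⌊s⌋₊ := Nat.le_floor (by exact_mod_cast hs)
    -- D commutes with the weak derivative up to null sets, so the approximation of (DY)' is one of
    -- DY'.
    have hae := (hDY.hasWeakDeriv (j := 1) hK1).unique
      ((hYS.hasWeakDeriv (j := 1) (by rw [CTG.floor_one_add hs]; omega)).matMul D)
    rw [restrict_Ioo_eq_restrict_Ioc] at hae
    have h1 := (CTG.global_error hs hT hr hD ht hY hYr hR hYS
      (fun n => (hε n).congr (ht.lt n).le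
        (ae_restrict_of_ae_restrict_of_subset (ht.subset n) hae)) hB).1 n.succ
    have hτ : 0 ≤ CTG.maxStep t := le_trans (by linarith [ht.lt n]) (ht.step_le n)
    set X := CTG.maxStep t ^ min ((r : ℝ) + 1) s / (r : ℝ) ^ s with hX
    have hX0 : 0 ≤ X := by positivity
    set H := CTG.normH 0 T s (CTG.matMul D Y) with hH
    have hH0 : 0 ≤ H := Real.sqrt_nonneg _
    have hT2 : √T ^ 2 = T := Real.sq_sqrt hT.le
    refine le_of_sq_le_sq ?_ (by positivity)
    calc _ ≤ 40 * T * ∑ n, B n := h1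
      _ ≤ 40 * T * (C * X ^ 2 * H ^ 2) := by gcongr
      _ = 40 * C * (√T ^ 2 * X ^ 2 * H ^ 2) := by rw [hT2]; ring
      _ ≤ (40 * C) ^ 2 * (√T ^ 2 * X ^ 2 * H ^ 2) := by
          gcongr
          nlinarith
      _ = _ := by ring
  · obtain ⟨C, hC1, hC⟩ := CTG.exists_local_approx_of_memSobolev s hs
    obtain ⟨C', hC'1, hC'⟩ := CTG.exists_local_approx_second s hs
    obtain ⟨A, hA1, hA⟩ := CTG.exists_local_approx_first s hs hT₀
    refine ⟨A + 1536 * (2 * C + 4 * C'), by positivity,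
      fun T M N r D Y₀ R Y Yr t hT hc hr hD ht hY hYr hR hYS x hx => ?_⟩
    obtain ⟨ε, B, hε, hB, hsum⟩ := hC T M N r R t hT hr ht hR
    obtain ⟨δ, B', hδ, hB', hsum'⟩ := hC' T M N r Y t hT hr ht hYS
    choose η hη hηb using hA T M N r Y t hT hc hr ht hYS
    have hK := CTG.floor_one_add hs
    have hK1 : 1 ≤ ⌊s⌋₊ := Nat.le_floor (by exact_mod_cast hs)
    obtain ⟨n, hn⟩ := ht.exists_mem hT hx
    -- The differentiated equation DY' = Y'' - R' replaces the only term containing D by quantities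
    -- bounded independently of it.
    have hloc : ∀ n : Fin N, CTG.VecApprox (t n.castSucc) (t n.succ) r
        (CTG.matMul D (CTG.weakDeriv 0 T 1 Y)) (2 * δ n + 2 * ε n) := fun n =>
      ((hδ n).sub (ht.lt n).le
        ((hYS.memLp_two le_top (by omega)).mono_measure
          (Measure.restrict_mono (ht.subset n) le_rfl))
        ((hR.memLp_two le_rfl hK1).mono_measure
          (Measure.restrict_mono (ht.subset n) le_rfl)) (hε n)).congr (ht.lt n).le
        (ae_restrict_of_ae_restrict_of_subset (ht.subset n)
          (CTG.matMul_weakDeriv_ae_eq hs hY hR hYS))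
    have h1 := (CTG.global_error hs hT hr hD ht hY hYr hR hYS hloc
      (B := fun n => 2 * B' n + 2 * B n) (fun n => by
        have h2 := hB n
        have h3 := hB' n
        linarith)).2 η hη n x hn
    have hτ : 0 ≤ CTG.maxStep t := le_trans (by linarith [ht.lt n]) (ht.step_le n)
    have hr1 : (1 : ℝ) ≤ r := by exact_mod_cast hr
    have hr0 : (0 : ℝ) < r := by linarith
    have hXe : CTG.maxStep t ^ min ((r : ℝ) + 1) s / (r : ℝ) ^ (s - 2) =
        CTG.maxStep t ^ min ((r : ℝ) + 1) s / (r : ℝ) ^ s * r ^ 2 := by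
      rw [Real.rpow_sub hr0, Real.rpow_two]
      field_simp
    rw [hXe]
    have hηn := hηb n
    set X := CTG.maxStep t ^ min ((r : ℝ) + 1) s / (r : ℝ) ^ s with hX
    have hX0 : 0 ≤ X := by positivity
    set H := CTG.normH 0 T s R with hH
    have hH0 : 0 ≤ H := Real.sqrt_nonneg _
    set L := CTG.normWInf 0 T (1 + s) Y with hL
    have hL0 : 0 ≤ L := CTG.normWInf_nonneg
    have hT2 : √T ^ 2 = T := Real.sq_sqrt hT.le
    have hT0 : 0 ≤ √T := Real.sqrt_nonneg T
    set Z := √T * L + H with hZ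
    have hTL : T * L ^ 2 ≤ Z ^ 2 := by
      rw [← hT2, ← mul_pow]
      exact pow_le_pow_left₀ (by positivity) (by linarith) 2
    have hHZ : H ^ 2 ≤ Z ^ 2 :=
      pow_le_pow_left₀ hH0 (by have : 0 ≤ √T * L := by positivity
                               linarith) 2
    have hS : ∑ n, (2 * B' n + 2 * B n) ≤ (2 * C + 4 * C') * X ^ 2 * Z ^ 2 := by
      rw [Finset.sum_add_distrib, ← Finset.mul_sum, ← Finset.mul_sum]
      calc 2 * ∑ n, B' n + 2 * ∑ n, B n
          ≤ 2 * (C' * X ^ 2 * (2 * T * L ^ 2)) + 2 * (C * X ^ 2 * H ^ 2) := by gcongr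
        _ = 4 * C' * X ^ 2 * (T * L ^ 2) + 2 * C * X ^ 2 * H ^ 2 := by ring
        _ ≤ 4 * C' * X ^ 2 * Z ^ 2 + 2 * C * X ^ 2 * Z ^ 2 := by gcongr
        _ = _ := by ring
    have hP : X ^ 2 * (1 + √T) ^ 2 * Z ^ 2 ≤ X ^ 2 * (1 + √T) ^ 2 * Z ^ 2 * (r ^ 2) ^ 2 :=
      le_mul_of_one_le_right (by positivity) (one_le_pow₀ (one_le_pow₀ hr1))
    -- After squaring, the inverse estimate costs r² while the claimed rate allows r⁴; the
    -- difference is given away here.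
    have hP' : (r : ℝ) ^ 2 * T * (X ^ 2 * Z ^ 2) ≤
        X ^ 2 * (1 + √T) ^ 2 * Z ^ 2 * (r ^ 2) ^ 2 := by
      have h2 : (r : ℝ) ^ 2 ≤ (r ^ 2) ^ 2 := le_self_pow₀ (one_le_pow₀ hr1) two_ne_zero
      have h3 : T ≤ (1 + √T) ^ 2 := by nlinarith
      calc (r : ℝ) ^ 2 * T * (X ^ 2 * Z ^ 2) ≤ (r ^ 2) ^ 2 * (1 + √T) ^ 2 * (X ^ 2 * Z ^ 2) := by
            gcongr
        _ = _ := by ring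
    have hE : 1 ≤ A + 1536 * (2 * C + 4 * C') := by linarith
    refine le_of_sq_le_sq ?_ (by positivity)
    calc _ ≤ _ := h1
      _ ≤ A * X ^ 2 * ((1 + √T) ^ 2 * T * L ^ 2) +
          1536 * r ^ 2 * T * ((2 * C + 4 * C') * X ^ 2 * Z ^ 2) := by gcongr
      _ = A * X ^ 2 * (1 + √T) ^ 2 * (T * L ^ 2) +
          1536 * (2 * C + 4 * C') * (r ^ 2 * T * (X ^ 2 * Z ^ 2)) := by ring
      _ ≤ A * X ^ 2 * (1 + √T) ^ 2 * Z ^ 2 + 1536 * (2 * C + 4 * C') *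
          (X ^ 2 * (1 + √T) ^ 2 * Z ^ 2 * (r ^ 2) ^ 2) := by gcongr
      _ = A * (X ^ 2 * (1 + √T) ^ 2 * Z ^ 2) + 1536 * (2 * C + 4 * C') *
          (X ^ 2 * (1 + √T) ^ 2 * Z ^ 2 * (r ^ 2) ^ 2) := by ring
      _ ≤ A * (X ^ 2 * (1 + √T) ^ 2 * Z ^ 2 * (r ^ 2) ^ 2) + 1536 * (2 * C + 4 * C') *
          (X ^ 2 * (1 + √T) ^ 2 * Z ^ 2 * (r ^ 2) ^ 2) := by gcongr
      _ = (A + 1536 * (2 * C + 4 * C')) * (X ^ 2 * (1 + √T) ^ 2 * Z ^ 2 * (r ^ 2) ^ 2) := by ring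
      _ ≤ (A + 1536 * (2 * C + 4 * C')) ^ 2 * (X ^ 2 * (1 + √T) ^ 2 * Z ^ 2 * (r ^ 2) ^ 2) := by
          gcongr
          exact le_self_pow₀ hE two_ne_zero
      _ = _ := by ring
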